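/- **Theorem 4.2.** Let $a_0\ge 0$ and let $a:[0,\infty)\to\mathbb R$ be measurable, integrable on $(0,1)$ and essentially bounded on $[\varepsilon,\infty)$ for every $\varepsilon>0$. Put $A(t)=a_0+\int_0^t a(s)\,ds$ and $\tilde a(z)=\int_0^\infty e^{-zt}a(t)\,dt$ for $\operatorname{Re} z>0$. Let $u_0\in L^1(\mathbb R^n)$ and $U_0=\int_{\mathbb R^n}u_0(x)\,dx$. Let $\sigma\in\mathbb R$ and let $u\in C([0,\infty),H^\sigma(\mathbb R^n))$ be the solution, in the sense of distributions, of $$u_t(x,t)=a_0\,\Delta u(x,t)+\int_0^t a(t-s)\,\Delta u(x,s)\,ds\quad(t>0),\qquad u(\cdot,0)=u_0 .$$ Assume that 1. $\displaystyle\liminf_{h\downarrow 0}\bigl(a_0+\operatorname{Re}\tilde a(i\omega+h)\bigr)\ge 0$ for every $\omega\in\mathbb R$ (for instance, the limit exists in $[0,+\infty]$); 2. $A$ is eventually positive and regularly varying with index $\beta\in(-1,1]$, that is, $A(T\tau)/A(T)\to\tau^\beta$ as $T\to\infty$ for every $\tau>0$. Set $k(t)=\sqrt{t\,A(t)\,\Gamma(1+\beta)}$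 (for large $t$), and let $u_{T,k}(\cdot,t)$ be the distribution with $\langle u_{T,k}(\cdot,t),\varphi\rangle=\langle u(\cdot,Tt),\varphi(k(T)^{-1}\,\cdot)\rangle$, i.e. $u_{T,k}(x,t)=k(T)^n u(k(T)x,Tt)$ when $u(\cdot,Tt)$ is a function. With the Fourier transform $\hat f(\xi)=\int e^{-ix\cdot\xi}f(x)\,dx$ and the Mittag-Leffler function $E_\alpha(z)=\sum_{j\ge0}z^j/\Gamma(1+\alpha j)$, there is for every $t>0$ a tempered distribution $u_\infty(\cdot,t)$ on $\mathbb R^n$ with $$\hat u_\infty(\xi,t)=E_{1+\beta}\bigl(-|\xi|^2t^{1+\beta}\bigr),$$ and for every $s<-n/2$ it lies in $H^s(\mathbb R^n)$ and $$u_{T,k}(\cdot,t)\to U_0\,u_\infty(\cdot,t)\quad\text{in }H^s(\mathbb R^n)\text{ as }T\to\infty,$$ uniformly for $t$ in every interval $[c,d]\subset(0,\infty)$. -/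

import Mathlib

open MeasureTheory Filter Topology
open scoped SchwartzMap FourierTransform Laplacian ENNReal ContDiff

noncomputable section

namespace SelfSimilar

/-- The Laplace transform `∫₀^∞ e^{-st} a(t) dt` of `a : [0, ∞) → ℝ`. -/
def laplaceTransform (a : ℝ → ℝ) (s : ℂ) : ℂ :=
  ∫ t in Set.Ioi (0 : ℝ), Complex.exp (-(s * (t : ℂ))) * (a t : ℂ)

/-- The integrated kernel `A(t) = a₀ + ∫₀ᵗ a(s) ds`. -/
def integratedKernel (a₀ : ℝ) (a : ℝ → ℝ) (t : ℝ) : ℝ :=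
  a₀ + ∫ s in (0 : ℝ)..t, a s

/-- `f` is eventually positive and regularly varying at infinity with index `β`. -/
def RegularlyVarying (f : ℝ → ℝ) (β : ℝ) : Prop :=
  (∀ᶠ t in atTop, 0 < f t) ∧
    ∀ τ : ℝ, 0 < τ → Tendsto (fun T : ℝ => f (T * τ) / f T) atTop (𝓝 (τ ^ β))

/-- The Mittag-Leffler function `E_α(z) = ∑ₖ zᵏ / Γ(1 + α k)`, for `α > 0`. -/
def mittagLeffler (α : ℝ) (z : ℂ) : ℂ :=
  ∑' k : ℕ, z ^ k / Complex.Gamma (1 + (α : ℂ) * (k : ℂ))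

/-- The scaling function `k(t) = √(t A(t) Γ(1 + β))`. -/
def scaling (a₀ : ℝ) (a : ℝ → ℝ) (β t : ℝ) : ℝ :=
  √(t * integratedKernel a₀ a t * Real.Gamma (1 + β))

variable {E : Type*} [NormedAddCommGroup E] [InnerProductSpace ℝ E]

/-- The map `φ ↦ φ(K⁻¹ ·)` on Schwartz functions, for `K ≠ 0`. -/
def dilateTest (K : ℝ) (hK : K ≠ 0) : 𝓢(E, ℂ) →L[ℂ] 𝓢(E, ℂ) :=
  SchwartzMap.compCLMOfContinuousLinearEquiv ℂ
    (ContinuousLinearEquiv.smulLeft (R₁ := ℝ) (M₁ := E) (Units.mk0 K⁻¹ (inv_ne_zero hK)))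

theorem dilateTest_apply (K : ℝ) (hK : K ≠ 0) (φ : 𝓢(E, ℂ)) (x : E) :
    dilateTest K hK φ x = φ (K⁻¹ • x) := rfl

/-- The scaled distribution `v_K`, `⟨v_K, φ⟩ = ⟨v, φ(K⁻¹ ·)⟩`; if `v` is a function then
`v_K(x) = Kⁿ v(K x)` for `K > 0`. (The value at `K = 0` is irrelevant.) -/
def dilate (K : ℝ) (v : 𝓢'(E, ℂ)) : 𝓢'(E, ℂ) :=
  if hK : K ≠ 0 then PointwiseConvergenceCLM.precomp ℂ (dilateTest K hK) v else 0

theorem dilate_apply (K : ℝ) (hK : K ≠ 0) (v : 𝓢'(E, ℂ)) (φ : 𝓢(E, ℂ)) :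
    dilate K v φ = v (dilateTest K hK φ) := by
  rw [dilate, dif_pos hK]
  rfl

/-- The rescaled family `u_{T,k}(·, t)`:
`⟨u_{T,k}(·, t), φ⟩ = ⟨u(·, T t), φ(k(T)⁻¹ ·)⟩`. -/
def rescaled (k : ℝ → ℝ) (u : ℝ → 𝓢'(E, ℂ)) (T t : ℝ) : 𝓢'(E, ℂ) :=
  dilate (k T) (u (T * t))

variable [FiniteDimensional ℝ E] [MeasurableSpace E] [BorelSpace E]

/-- The norm of `f` in the Sobolev space `H^s`, with the value `∞` if `f ∉ H^s`: the `L²` norm of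
the function that represents the Bessel potential of `f`. (With Mathlib's normalization of the
Fourier transform this is, up to equivalence of norms, `‖(1 + |ξ|²)^{s/2} f̂‖_{L²}`.) -/
def sobolevENorm (s : ℝ) (f : 𝓢'(E, ℂ)) : ℝ≥0∞ :=
  ⨅ (g : Lp ℂ 2 (volume : Measure E))
    (_ : TemperedDistribution.besselPotential E ℂ s f = (g : 𝓢'(E, ℂ))), ‖g‖ₑ

/-- The Fourier transform of the tempered distribution `v`, in the normalization
`f̂(ξ) = ∫ e^{-i x·ξ} f(x) dx`, is the function `m`. Mathlib's transform has the kernel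
`e^{-2πi x·η}`, so that `(𝓕 v)(η) = v̂(2πη)`. -/
def HasFourierTransform (v : 𝓢'(E, ℂ)) (m : E → ℂ) : Prop :=
  ∀ φ : 𝓢(E, ℂ), Integrable (fun η : E => m ((2 * Real.pi) • η) * φ η) ∧
    𝓕 v φ = ∫ η : E, m ((2 * Real.pi) • η) * φ η

/-- `u` solves `u_t = a₀ Δu + ∫₀ᵗ a(t - s) Δu(·, s) ds`, `t > 0`, in the sense of distributions:
the equation is tested with all `Φ ∈ C_c^∞(E × [0, ∞))`, given as restrictions of smooth compactly
supported functions on `E × ℝ` (`Φ t` is the slice `Φ(·, t)`, and `Ψ t` is `∂_t Φ(·, t)`). -/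
def IsDistributionalSolution (a₀ : ℝ) (a : ℝ → ℝ) (u : ℝ → 𝓢'(E, ℂ)) : Prop :=
  ∀ Φ Ψ : ℝ → 𝓢(E, ℂ),
    ContDiff ℝ ∞ (fun p : E × ℝ => Φ p.2 p.1) →
    HasCompactSupport (fun p : E × ℝ => Φ p.2 p.1) →
    (∀ (t : ℝ) (x : E), HasDerivAt (fun τ : ℝ => Φ τ x) (Ψ t x) t) →
    (∫ s in Set.Ioi (0 : ℝ),
        (u s (Ψ s) + (a₀ : ℂ) * u s (Δ (Φ s))
          + ∫ t in Set.Ioi s, (a (t - s) : ℂ) * u s (Δ (Φ t))))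
      + u 0 (Φ 0) = 0

/-- `u ∈ C([0, ∞), H^σ)`. -/
def ContinuousInSobolev (σ : ℝ) (u : ℝ → 𝓢'(E, ℂ)) : Prop :=
  (∀ t : ℝ, 0 ≤ t → TemperedDistribution.MemSobolev σ 2 (u t)) ∧
    ∀ t : ℝ, 0 ≤ t →
      Tendsto (fun τ : ℝ => sobolevENorm σ (u τ - u t)) (𝓝[Set.Ici 0] t) (𝓝 0)

/-- `u ∈ C([0, ∞), H^σ)` is a distributional solution of the integrodifferential equation with
initial value the function `u₀`. -/
structure IsSolution (a₀ : ℝ) (a : ℝ → ℝ) (u₀ : E → ℂ) (σ : ℝ) (u : ℝ → 𝓢'(E, ℂ)) : Prop where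
  continuous : ContinuousInSobolev σ u
  equation : IsDistributionalSolution a₀ a u
  initial : ∀ φ : 𝓢(E, ℂ), u 0 φ = ∫ x, u₀ x * φ x

end SelfSimilar

end

/-! On the Fourier side the equation decouples: `û(ξ, t) = û₀(ξ) w(|ξ|², t)`, where `w(z, ·)` solves
the scalar Volterra equation `w + z A * w = 1` (`volterraSol`). Since `k(T)² = T A(T) Γ(1 + β)`, the
rescaled scalar solution solves the same kind of equation with kernel `A(Tτ) / (A(T) Γ(1 + β))`.
Regular variation makes this kernel tend to `τ^β / Γ(1 + β)` in `L¹(0, d)`, by Potter's bounds, and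
the Volterra solution of the limit kernel is the Mittag-Leffler function. Also `û₀(ξ / k(T)) → û₀(0)
= U₀`. Hence the symbols converge uniformly on bounded sets of frequencies
(`tendsto_volterraSol_rescaled`, `eventually_norm_symbol_sub_le`). As they are uniformly bounded and
`(1 + |ξ|²)^{s/2}` is square integrable for `s < -n/2`, this gives convergence in `H^s`.

The uniform bound is `|w| ≤ 1`, and this is where positivity enters. From `w' = -z (a₀ w + a * w)`
one sees that `w²` stays below `1` as soon as `∫ w (a₀ w + a * w) ≥ 0` (`energy_nonneg`,
`abs_volterraSol_le_one`). The hypothesis only gives pointwise lower limits of Abel means, without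
any uniformity in the frequency, so one cannot simply integrate over frequencies and pass to the
limit. Riemann's method for trigonometric series is used instead. The second primitive `G(x) = a₀
x²/2 + ∫ a(t) (1 - cos xt)/t² dt` converges absolutely. If it were not convex, `G` plus a small
parabola minus a linear function would have an interior maximum, where the second differences of `G`
lie below `-2εr²`. Averaging them against `(1 + r²)⁻²`, whose cosine transform is a multiple of `(1
+ |x|) e^{-|x|}`, yields integrated Abel means and a contradiction (`not_secondDiff_le_of_abel`).
Convexity says that the Fejér-damped kernels have nonnegative cosine transforms; Plancherel turns
this into a positive quadratic form, and the damping is then removed.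

The solution is only known to be a distributional one in some `H^σ`, so the formula for `û` is
obtained by uniqueness (`IsSolution.fourier_apply`): on frequencies in a ball the symbol of the
Laplacian is bounded, and the Volterra operator is a contraction in a sup norm with exponential
weight. -/

noncomputable section

namespace SelfSimilar

/-! ### Scalar Volterra equations: causal convolution, contraction, Neumann series. -/

section Volterra

variable {F : Type*} [NormedAddCommGroup F] [NormedSpace ℝ F]

/-- The causal convolution `(b * f)(t) = ∫₀ᵗ b(s) f(t - s) ds`, which vanishes for `t ≤ 0`. -/
def volterraConv (b : ℝ → ℝ) (f : ℝ → F) (t : ℝ) : F :=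
  ∫ s in Set.Ioc 0 t, b s • f (t - s)

theorem volterraConv_of_nonpos (b : ℝ → ℝ) (f : ℝ → F) {t : ℝ} (ht : t ≤ 0) :
    volterraConv b f t = 0 := by
  simp [volterraConv, Set.Ioc_eq_empty (not_lt.2 ht)]

theorem integrableOn_volterra {b : ℝ → ℝ} {t : ℝ} (hb : IntegrableOn b (Set.Ioc 0 t))
    {g : ℝ → F} (hg : Continuous g) : IntegrableOn (fun s => b s • g s) (Set.Ioc 0 t) := by
  obtain ⟨C, hC⟩ := (isCompact_Icc (a := (0 : ℝ)) (b := t)).exists_bound_of_continuousOn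
    hg.continuousOn
  refine Integrable.mono' (g := fun s => ‖b s‖ * C) (hb.norm.mul_const C)
    (hb.aestronglyMeasurable.smul hg.aestronglyMeasurable) ?_
  filter_upwards [ae_restrict_mem measurableSet_Ioc] with s hs
  rw [norm_smul]
  exact mul_le_mul_of_nonneg_left (hC s ⟨hs.1.le, hs.2⟩) (norm_nonneg _)

theorem integrableOn_volterra_sub {b : ℝ → ℝ} {t : ℝ} (hb : IntegrableOn b (Set.Ioc 0 t))
    {f : ℝ → F} (hf : Continuous f) :
    IntegrableOn (fun s => b s • f (t - s)) (Set.Ioc 0 t) :=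
  integrableOn_volterra hb (hf.comp (continuous_const.sub continuous_id))

theorem continuous_volterraConv {b : ℝ → ℝ} (hb : ∀ X, IntegrableOn b (Set.Ioc 0 X))
    {f : ℝ → F} (hf : Continuous f) : Continuous (volterraConv b f) := by
  have key : ∀ t, volterraConv b f t
      = ∫ s, (Set.Ioc 0 t).indicator (fun s => b s • f (t - s)) s := fun t => by
    rw [volterraConv, integral_indicator measurableSet_Ioc]
  rw [continuous_iff_continuousAt]
  intro t₀
  rw [funext key]
  obtain ⟨C, hC⟩ := (isCompact_Icc (a := (0 : ℝ)) (b := t₀ + 1)).exists_bound_of_continuousOn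
    hf.continuousOn
  have hC' : ∀ s ∈ Set.Icc 0 (t₀ + 1), ‖f s‖ ≤ |C| := fun s hs => (hC s hs).trans (le_abs_self C)
  apply continuousAt_of_dominated
    (bound := (Set.Ioc 0 (t₀ + 1)).indicator (fun s => ‖b s‖ * |C|))
  · filter_upwards with t
    rw [aestronglyMeasurable_indicator_iff measurableSet_Ioc]
    exact (integrableOn_volterra_sub (hb t) hf).aestronglyMeasurable
  · filter_upwards [gt_mem_nhds (lt_add_one t₀)] with t ht
    filter_upwards with s
    by_cases hs : s ∈ Set.Ioc 0 t
    · have hs' : s ∈ Set.Ioc 0 (t₀ + 1) := ⟨hs.1, hs.2.trans ht.le⟩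
      rw [Set.indicator_of_mem hs, Set.indicator_of_mem hs', norm_smul]
      exact mul_le_mul_of_nonneg_left (hC' _ ⟨sub_nonneg.2 hs.2, by linarith [hs.1]⟩)
        (norm_nonneg _)
    · rw [Set.indicator_of_notMem hs, norm_zero]
      exact Set.indicator_nonneg (fun _ _ => by positivity) _
  · exact IntegrableOn.integrable_indicator ((hb _).norm.mul_const _) measurableSet_Ioc
  · filter_upwards [compl_mem_ae_iff.2 (measure_singleton t₀)] with s hs
    rcases lt_or_gt_of_ne (hs : s ≠ t₀) with h | h
    · by_cases h0 : 0 < s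
      · have : ContinuousAt (fun t => b s • f (t - s)) t₀ := by fun_prop
        refine this.congr ?_
        filter_upwards [lt_mem_nhds h] with t ht
        have hs' : s ∈ Set.Ioc 0 t := ⟨h0, ht.le⟩
        rw [Set.indicator_of_mem hs']
      · refine (continuousAt_const (y := (0 : F))).congr ?_
        filter_upwards with t
        rw [Set.indicator_of_notMem (fun hs => h0 hs.1)]
    · refine (continuousAt_const (y := (0 : F))).congr ?_
      filter_upwards [gt_mem_nhds h] with t ht
      rw [Set.indicator_of_notMem (fun hs => not_le.2 ht hs.2)]

/-- The mass `∫₀^X e^{-μ s} |b(s)| ds`. -/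
def weightedMass (b : ℝ → ℝ) (X μ : ℝ) : ℝ :=
  ∫ s in Set.Ioc 0 X, Real.exp (-(μ * s)) * |b s|

theorem integrableOn_weightedMass {b : ℝ → ℝ} {X : ℝ} (hb : IntegrableOn b (Set.Ioc 0 X))
    (μ : ℝ) : IntegrableOn (fun s => Real.exp (-(μ * s)) * |b s|) (Set.Ioc 0 X) := by
  have := integrableOn_volterra (b := fun s => |b s|) hb.abs (g := fun s => Real.exp (-(μ * s)))
    (by fun_prop)
  simpa [mul_comm] using this

theorem weightedMass_nonneg (b : ℝ → ℝ) (X μ : ℝ) : 0 ≤ weightedMass b X μ :=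
  integral_nonneg fun _ => by positivity

/-- Dominated convergence. It is the source of every contraction below: for large `μ`, convolution
with any fixed multiple of `b` contracts the exponentially weighted sup norm on `[0, X]`. -/
theorem tendsto_weightedMass {b : ℝ → ℝ} {X : ℝ} (hb : IntegrableOn b (Set.Ioc 0 X)) :
    Tendsto (weightedMass b X) atTop (𝓝 0) := by
  have h0 : (0 : ℝ) = ∫ s in Set.Ioc 0 X, (0 : ℝ) := by simp
  rw [h0]
  apply tendsto_integral_filter_of_dominated_convergence (fun s => |b s|)
  · filter_upwards with μ
    exact (integrableOn_weightedMass hb μ).aestronglyMeasurable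
  · filter_upwards [eventually_ge_atTop 0] with μ hμ
    filter_upwards [ae_restrict_mem measurableSet_Ioc] with s hs
    rw [Real.norm_of_nonneg (by positivity)]
    refine mul_le_of_le_one_left (abs_nonneg _) (Real.exp_le_one_iff.2 ?_)
    have := mul_nonneg hμ hs.1.le
    linarith
  · exact hb.abs
  · filter_upwards [ae_restrict_mem measurableSet_Ioc] with s hs
    have : Tendsto (fun μ : ℝ => Real.exp (-(μ * s))) atTop (𝓝 0) :=
      Real.tendsto_exp_neg_atTop_nhds_zero.comp (tendsto_id.atTop_mul_const hs.1)
    simpa using this.mul_const |b s|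

/-- The convolution contracts the norm `sup e^{-μ t} ‖f(t)‖` by the factor `weightedMass b X μ`. -/
theorem norm_volterraConv_le {b : ℝ → ℝ} {X : ℝ} (hb : IntegrableOn b (Set.Ioc 0 X)) (μ : ℝ)
    {f : ℝ → F} {S : ℝ} (hf : ∀ t ∈ Set.Icc 0 X, ‖f t‖ ≤ S * Real.exp (μ * t))
    {t : ℝ} (ht : t ∈ Set.Icc 0 X) :
    ‖volterraConv b f t‖ ≤ weightedMass b X μ * S * Real.exp (μ * t) := by
  have hsub : Set.Ioc 0 t ⊆ Set.Ioc 0 X := Set.Ioc_subset_Ioc_right ht.2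
  have hS : 0 ≤ S := by
    have := (norm_nonneg _).trans (hf t ht)
    exact nonneg_of_mul_nonneg_left this (Real.exp_pos _)
  have hint := (integrableOn_weightedMass hb μ).mono_set hsub
  calc ‖volterraConv b f t‖
      ≤ ∫ s in Set.Ioc 0 t, (Real.exp (-(μ * s)) * |b s|) * (S * Real.exp (μ * t)) := by
        refine norm_integral_le_of_norm_le (hint.mul_const _) ?_
        filter_upwards [ae_restrict_mem measurableSet_Ioc] with s hs
        rw [norm_smul, Real.norm_eq_abs]
        have h1 := hf (t - s) ⟨sub_nonneg.2 hs.2, by linarith [hs.1, ht.2]⟩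
        have h2 : Real.exp (μ * (t - s)) = Real.exp (-(μ * s)) * Real.exp (μ * t) := by
          rw [← Real.exp_add]; ring_nf
        rw [h2] at h1
        calc |b s| * ‖f (t - s)‖ ≤ |b s| * (S * (Real.exp (-(μ * s)) * Real.exp (μ * t))) :=
              mul_le_mul_of_nonneg_left h1 (abs_nonneg _)
          _ = _ := by ring
    _ = (∫ s in Set.Ioc 0 t, Real.exp (-(μ * s)) * |b s|) * (S * Real.exp (μ * t)) :=
        integral_mul_const _ _
    _ ≤ weightedMass b X μ * (S * Real.exp (μ * t)) := by
        refine mul_le_mul_of_nonneg_right ?_ (by positivity)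
        refine setIntegral_mono_set (integrableOn_weightedMass hb μ) ?_ hsub.eventuallyLE
        filter_upwards with s
        positivity
    _ = _ := by ring

/-- If a bounded family satisfies `bound S ⟹ bound (ρ + S/2)`, then it satisfies the bound `2ρ`. -/
theorem le_two_mul_of_half_contraction {ι : Type*} {e : ι → ℝ} {M ρ : ℝ} (hM : ∀ i, e i ≤ M)
    (h : ∀ S, (∀ i, e i ≤ S) → ∀ i, e i ≤ ρ + S / 2) (i : ι) : e i ≤ 2 * ρ := by
  -- The map `S ↦ ρ + S/2` has the fixed point `2ρ`, and each application halves the distance from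
  -- it.
  have : ∀ k : ℕ, ∀ i, e i ≤ 2 * ρ + (M - 2 * ρ) / 2 ^ k := by
    intro k
    induction k with
    | zero => intro i; simpa using hM i
    | succ k ih =>
      intro i
      refine (h _ ih i).trans (le_of_eq ?_)
      rw [pow_succ]
      field_simp
      ring
  have hlim : Tendsto (fun k : ℕ => 2 * ρ + (M - 2 * ρ) / 2 ^ k) atTop (𝓝 (2 * ρ + 0)) := by
    refine tendsto_const_nhds.add ?_
    exact Tendsto.div_atTop tendsto_const_nhds (tendsto_pow_atTop_atTop_of_one_lt one_lt_two)
  rw [add_zero] at hlim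
  exact ge_of_tendsto' hlim fun k => this k i

/-- The iterated convolutions `b * b * ⋯ * b * 1`. -/
def volterraTerm (b : ℝ → ℝ) : ℕ → ℝ → ℝ
  | 0 => fun _ => 1
  | k + 1 => volterraConv b (volterraTerm b k)

theorem continuous_volterraTerm {b : ℝ → ℝ} (hb : ∀ X, IntegrableOn b (Set.Ioc 0 X)) (k : ℕ) :
    Continuous (volterraTerm b k) := by
  induction k with
  | zero => exact continuous_const
  | succ k ih => exact continuous_volterraConv hb ih

theorem abs_volterraTerm_le {b : ℝ → ℝ} {X : ℝ} (hb : IntegrableOn b (Set.Ioc 0 X)) {μ : ℝ}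
    (hμ : 0 ≤ μ) (k : ℕ) :
    ∀ t ∈ Set.Icc 0 X, |volterraTerm b k t| ≤ weightedMass b X μ ^ k * Real.exp (μ * t) := by
  induction k with
  | zero =>
    intro t ht
    simpa [volterraTerm] using mul_nonneg hμ ht.1
  | succ k ih =>
    intro t ht
    have := norm_volterraConv_le hb μ (f := volterraTerm b k) ih ht
    rw [pow_succ']
    exact this

/-- The solution `w = ∑ₖ (-z)ᵏ b^{*k} * 1` of the Volterra equation `w + z b * w = 1`. -/
def volterraSol (b : ℝ → ℝ) (z t : ℝ) : ℝ :=
  ∑' k : ℕ, (-z) ^ k * volterraTerm b k t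

theorem volterraTerm_of_neg (b : ℝ → ℝ) (k : ℕ) {t : ℝ} (ht : t ≤ 0) :
    volterraTerm b k t = volterraTerm b k 0 := by
  cases k with
  | zero => rfl
  | succ k => simp [volterraTerm, volterraConv_of_nonpos b _ ht, volterraConv_of_nonpos b _ le_rfl]

/-- Choosing `μ` with `Z * weightedMass b X μ ≤ 1/2` makes the Neumann series geometric, uniformly
in `|z| ≤ Z` and `t ≤ X`. This one majorant gives summability, joint continuity and termwise
convolution. -/
theorem exists_geometric_bound {b : ℝ → ℝ} (hb : ∀ X, IntegrableOn b (Set.Ioc 0 X))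
    {X : ℝ} (hX : 0 ≤ X) (Z : ℝ) :
    ∃ C, ∀ z, |z| ≤ Z → ∀ t ≤ X, ∀ k : ℕ,
      ‖(-z) ^ k * volterraTerm b k t‖ ≤ C * (1 / 2) ^ k := by
  have hlim : Tendsto (fun μ => Z * weightedMass b X μ) atTop (𝓝 (Z * 0)) :=
    (tendsto_weightedMass (hb X)).const_mul Z
  rw [mul_zero] at hlim
  obtain ⟨μ, hμ, hμ0⟩ := ((hlim.eventually_le_const (by norm_num : (0 : ℝ) < 1 / 2)).and
    (eventually_ge_atTop 0)).exists
  refine ⟨Real.exp (μ * X), fun z hz t ht k => ?_⟩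
  have hb0 : ∀ t ∈ Set.Icc 0 X, ‖(-z) ^ k * volterraTerm b k t‖
      ≤ Real.exp (μ * X) * (1 / 2) ^ k := by
    intro t ht
    rw [norm_mul, norm_pow, norm_neg, Real.norm_eq_abs, Real.norm_eq_abs]
    have h1 := abs_volterraTerm_le (hb X) hμ0 k t ht
    have h2 : Real.exp (μ * t) ≤ Real.exp (μ * X) :=
      Real.exp_le_exp.2 (mul_le_mul_of_nonneg_left ht.2 hμ0)
    have h0 := weightedMass_nonneg b X μ
    calc |z| ^ k * |volterraTerm b k t|
        ≤ Z ^ k * (weightedMass b X μ ^ k * Real.exp (μ * X)) := by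
          refine mul_le_mul (pow_le_pow_left₀ (abs_nonneg z) hz k) (h1.trans (by gcongr))
            (abs_nonneg _) (pow_nonneg ((abs_nonneg z).trans hz) k)
      _ = Real.exp (μ * X) * (Z * weightedMass b X μ) ^ k := by rw [mul_pow]; ring
      _ ≤ Real.exp (μ * X) * (1 / 2) ^ k := by
          have : 0 ≤ Z := (abs_nonneg z).trans hz
          gcongr
  rcases le_total 0 t with h | h
  · exact hb0 t ⟨h, ht⟩
  · rw [volterraTerm_of_neg b k h]
    exact hb0 0 ⟨le_rfl, hX⟩

theorem summable_volterraSol {b : ℝ → ℝ} (hb : ∀ X, IntegrableOn b (Set.Ioc 0 X)) (z t : ℝ) :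
    Summable fun k : ℕ => (-z) ^ k * volterraTerm b k t := by
  obtain ⟨C, hC⟩ := exists_geometric_bound hb (le_max_right t 0) |z|
  refine Summable.of_norm_bounded ((summable_geometric_of_lt_one (by norm_num)
    (by norm_num : (1 / 2 : ℝ) < 1)).mul_left C) fun k => hC z le_rfl t (le_max_left _ _) k

theorem continuous_volterraSol {b : ℝ → ℝ} (hb : ∀ X, IntegrableOn b (Set.Ioc 0 X)) :
    Continuous fun p : ℝ × ℝ => volterraSol b p.1 p.2 := by
  rw [continuous_iff_continuousAt]
  rintro ⟨z₀, t₀⟩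
  obtain ⟨C, hC⟩ := exists_geometric_bound hb (le_max_right (t₀ + 1) 0) (|z₀| + 1)
  have hopen : IsOpen {p : ℝ × ℝ | |p.1| < |z₀| + 1 ∧ p.2 < t₀ + 1} :=
    (isOpen_lt (continuous_fst.abs) continuous_const).inter
      (isOpen_lt continuous_snd continuous_const)
  have : ContinuousOn (fun p : ℝ × ℝ => volterraSol b p.1 p.2)
      {p : ℝ × ℝ | |p.1| < |z₀| + 1 ∧ p.2 < t₀ + 1} := by
    refine continuousOn_tsum (u := fun k => C * (1 / 2) ^ k) (fun k => ?_)
      ((summable_geometric_of_lt_one (by norm_num) (by norm_num : (1 / 2 : ℝ) < 1)).mul_left C)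
      fun k p hp => hC p.1 hp.1.le p.2 (hp.2.le.trans (le_max_left _ _)) k
    have := continuous_volterraTerm hb k
    fun_prop
  exact this.continuousAt (hopen.mem_nhds ⟨lt_add_one _, lt_add_one _⟩)

theorem continuous_volterraSol_right {b : ℝ → ℝ} (hb : ∀ X, IntegrableOn b (Set.Ioc 0 X))
    (z : ℝ) : Continuous (volterraSol b z) :=
  (continuous_volterraSol hb).comp (continuous_const.prodMk continuous_id)

/-- Convolving the Neumann series with `b` term by term, which the geometric majorant permits,
shifts its index by one. -/
theorem volterraSol_eq {b : ℝ → ℝ} (hb : ∀ X, IntegrableOn b (Set.Ioc 0 X)) (z t : ℝ) :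
    volterraSol b z t = 1 - z * volterraConv b (volterraSol b z) t := by
  have hsum := summable_volterraSol hb z
  rw [volterraSol, (hsum t).tsum_eq_zero_add]
  have hconv : HasSum (fun k : ℕ => ∫ s in Set.Ioc 0 t,
      b s • ((-z) ^ k * volterraTerm b k (t - s))) (volterraConv b (volterraSol b z) t) := by
    obtain ⟨C, hC⟩ := exists_geometric_bound hb (le_max_right t 0) |z|
    refine hasSum_integral_of_dominated_convergence (fun k s => ‖b s‖ * (C * (1 / 2) ^ k))
      (fun k => ?_) (fun k => ?_) ?_ ?_ ?_
    · have := continuous_volterraTerm hb k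
      exact (integrableOn_volterra_sub (hb t) (f := fun s => (-z) ^ k * volterraTerm b k s)
        (by fun_prop)).aestronglyMeasurable
    · filter_upwards [ae_restrict_mem measurableSet_Ioc] with s hs
      rw [norm_smul]
      exact mul_le_mul_of_nonneg_left
        (hC z le_rfl _ ((by linarith [hs.1] : t - s ≤ t).trans (le_max_left _ _)) k) (norm_nonneg _)
    · filter_upwards with s
      exact ((summable_geometric_of_lt_one (by norm_num)
        (by norm_num : (1 / 2 : ℝ) < 1)).mul_left C).mul_left _
    · simp_rw [tsum_mul_left]
      exact (hb t).norm.mul_const _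
    · filter_upwards with s
      exact (hsum (t - s)).hasSum.const_smul (b s)
  have h2 : ∀ k : ℕ, (-z) ^ (k + 1) * volterraTerm b (k + 1) t
      = (-z) * ∫ s in Set.Ioc 0 t, b s • ((-z) ^ k * volterraTerm b k (t - s)) := by
    intro k
    have : ∀ s, b s • ((-z) ^ k * volterraTerm b k (t - s))
        = (-z) ^ k * (b s • volterraTerm b k (t - s)) := fun s => by
      simp only [smul_eq_mul]; ring
    simp_rw [this]
    rw [integral_const_mul, volterraTerm, volterraConv, pow_succ]
    ring
  simp_rw [h2]
  rw [tsum_mul_left, hconv.tsum_eq]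
  simp [volterraTerm]
  ring

end Volterra

/-! ### The integrated kernel as a primitive. -/

section Primitive

variable {F : Type*} [NormedAddCommGroup F] [NormedSpace ℝ F]

/-- Exchange of the order of integration over the triangle `0 < r ≤ t ≤ X`. -/
theorem integral_triangle_swap {a : ℝ → ℝ} {X : ℝ}
    (ha : IntegrableOn a (Set.Ioc 0 X)) {g : ℝ → ℝ → F}
    (hg : Continuous fun p : ℝ × ℝ => g p.1 p.2) :
    ∫ t in Set.Ioc 0 X, ∫ r in Set.Ioc 0 t, a r • g r t
      = ∫ r in Set.Ioc 0 X, a r • ∫ t in Set.Ioc r X, g r t := by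
  let T : Set (ℝ × ℝ) := {p | p.2 ≤ p.1}
  have hT : MeasurableSet T := measurableSet_le measurable_snd measurable_fst
  have hint : Integrable (fun p : ℝ × ℝ => T.indicator (fun p => a p.2 • g p.2 p.1) p)
      ((volume.restrict (Set.Ioc 0 X)).prod (volume.restrict (Set.Ioc 0 X))) := by
    apply Integrable.indicator _ hT
    obtain ⟨C, hC⟩ := ((isCompact_Icc (a := (0 : ℝ)) (b := X)).prod
      (isCompact_Icc (a := (0 : ℝ)) (b := X))).exists_bound_of_continuousOn hg.continuousOn
    have h1 : Integrable (fun p : ℝ × ℝ => (1 : ℝ) * ‖a p.2‖)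
        ((volume.restrict (Set.Ioc 0 X)).prod (volume.restrict (Set.Ioc 0 X))) :=
      (integrable_const (1 : ℝ)).mul_prod ha.norm
    refine Integrable.mono' (h1.mul_const C) ?_ ?_
    · refine AEStronglyMeasurable.smul ?_ (hg.comp continuous_swap).aestronglyMeasurable
      exact ha.aestronglyMeasurable.comp_snd
    · rw [Measure.prod_restrict]
      filter_upwards [ae_restrict_mem (measurableSet_Ioc.prod measurableSet_Ioc)] with p hp
      rw [norm_smul, one_mul]
      exact mul_le_mul_of_nonneg_left (hC (p.2, p.1) ⟨⟨hp.2.1.le, hp.2.2⟩, ⟨hp.1.1.le, hp.1.2⟩⟩)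
        (norm_nonneg _)
  have hswap := integral_integral_swap (f := fun t r => T.indicator
    (fun p : ℝ × ℝ => a p.2 • g p.2 p.1) (t, r)) hint
  have hl : ∀ t ∈ Set.Ioc 0 X, ∫ r in Set.Ioc 0 X, T.indicator
      (fun p : ℝ × ℝ => a p.2 • g p.2 p.1) (t, r) = ∫ r in Set.Ioc 0 t, a r • g r t := by
    intro t ht
    have : (fun r => T.indicator (fun p : ℝ × ℝ => a p.2 • g p.2 p.1) (t, r))
        = (Set.Iic t).indicator (fun r => a r • g r t) := by
      ext r
      simp [Set.indicator, T]
    rw [this, setIntegral_indicator measurableSet_Iic]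
    congr 2
    ext r
    simp only [Set.mem_inter_iff, Set.mem_Ioc, Set.mem_Iic]
    exact ⟨fun h => ⟨h.1.1, h.2⟩, fun h => ⟨⟨h.1, h.2.trans ht.2⟩, h.2⟩⟩
  have hr : ∀ r ∈ Set.Ioc 0 X, ∫ t in Set.Ioc 0 X, T.indicator
      (fun p : ℝ × ℝ => a p.2 • g p.2 p.1) (t, r) = a r • ∫ t in Set.Ioc r X, g r t := by
    intro r hr
    have : (fun t => T.indicator (fun p : ℝ × ℝ => a p.2 • g p.2 p.1) (t, r))
        = (Set.Ici r).indicator (fun t => a r • g r t) := by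
      ext t
      simp [Set.indicator, T]
    rw [this, setIntegral_indicator measurableSet_Ici, integral_smul]
    have h : Set.Ioc 0 X ∩ Set.Ici r = Set.Icc r X := by
      ext t
      simp only [Set.mem_inter_iff, Set.mem_Ioc, Set.mem_Icc, Set.mem_Ici]
      exact ⟨fun h => ⟨h.2, h.1.2⟩, fun h => ⟨⟨hr.1.trans_le h.1, h.2⟩, h.1⟩⟩
    rw [h, integral_Icc_eq_integral_Ioc]
  rw [setIntegral_congr_fun measurableSet_Ioc hl, setIntegral_congr_fun measurableSet_Ioc hr]
    at hswap
  exact hswap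

theorem continuousOn_integratedKernel (a₀ : ℝ) {a : ℝ → ℝ}
    (ha : ∀ X, IntegrableOn a (Set.Ioc 0 X)) :
    ContinuousOn (integratedKernel a₀ a) (Set.Ici 0) := by
  have h : Continuous fun t => a₀ + volterraConv a (fun _ => (1 : ℝ)) t :=
    continuous_const.add (continuous_volterraConv ha continuous_const)
  refine h.continuousOn.congr fun t ht => ?_
  simp [integratedKernel, volterraConv, intervalIntegral.integral_of_le (Set.mem_Ici.1 ht)]

theorem integrableOn_integratedKernel (a₀ : ℝ) {a : ℝ → ℝ}
    (ha : ∀ X, IntegrableOn a (Set.Ioc 0 X)) (X : ℝ) :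
    IntegrableOn (integratedKernel a₀ a) (Set.Ioc 0 X) :=
  (((continuousOn_integratedKernel a₀ ha).mono Set.Icc_subset_Ici_self).integrableOn_compact
    isCompact_Icc).mono_set Set.Ioc_subset_Icc_self

variable [CompleteSpace F]

/-- `A * f` is the primitive of `a₀ f + a * f`. -/
theorem volterraConv_integratedKernel (a₀ : ℝ) {a : ℝ → ℝ}
    (ha : ∀ X, IntegrableOn a (Set.Ioc 0 X)) {f : ℝ → F} (hf : Continuous f) (X : ℝ) :
    volterraConv (integratedKernel a₀ a) f X
      = ∫ t in Set.Ioc 0 X, (a₀ • f t + volterraConv a f t) := by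
  have hcont : ∀ {g : ℝ → F}, Continuous g → IntegrableOn g (Set.Ioc 0 X) := fun hg =>
    (hg.continuousOn.integrableOn_compact isCompact_Icc).mono_set Set.Ioc_subset_Icc_self
  -- After the two triangle swaps the inner integrals differ only by the reflection `t ↦ X + r - t`.
  have hrefl : ∀ r, ∫ t in Set.Ioc r X, f (X - t) = ∫ t in Set.Ioc r X, f (t - r) := by
    intro r
    rcases le_total r X with h | h
    · rw [← intervalIntegral.integral_of_le h, ← intervalIntegral.integral_of_le h,
        intervalIntegral.integral_comp_sub_left, intervalIntegral.integral_comp_sub_right]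
      simp
    · simp [Set.Ioc_eq_empty (not_lt.2 h)]
  have h1 : ∀ s ∈ Set.Ioc 0 X, integratedKernel a₀ a s • f (X - s)
      = a₀ • f (X - s) + ∫ r in Set.Ioc 0 s, a r • f (X - s) := by
    intro s hs
    rw [integral_smul_const, integratedKernel, add_smul, intervalIntegral.integral_of_le hs.1.le]
  rw [volterraConv, setIntegral_congr_fun measurableSet_Ioc h1, integral_add, integral_add,
    integral_smul, integral_smul]
  · congr 1
    · rcases le_total 0 X with h | h
      · have := hrefl 0
        simp only [sub_zero] at this
        rw [this]
      · simp [Set.Ioc_eq_empty (not_lt.2 h)]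
    · rw [integral_triangle_swap (ha X) (g := fun _ t => f (X - t)) (by fun_prop)]
      simp only [volterraConv]
      rw [integral_triangle_swap (ha X) (g := fun r t => f (t - r)) (by fun_prop)]
      simp_rw [hrefl]
  · exact (hcont hf).smul a₀
  · exact hcont (continuous_volterraConv ha hf)
  · exact (hcont (by fun_prop : Continuous fun s => f (X - s))).smul a₀
  · have hc : Continuous fun s => volterraConv a (fun _ => (1 : ℝ)) s • f (X - s) :=
      (continuous_volterraConv ha continuous_const).smul (by fun_prop)
    refine (hcont hc).congr_fun (fun s _ => ?_) measurableSet_Ioc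
    rw [integral_smul_const]
    simp [volterraConv]

end Primitive

/-! ### The cosine transform of `(1 + r²)⁻²`. -/

section PoissonSquareKernel

theorem integrableOn_one_add_mul_exp_neg :
    IntegrableOn (fun v : ℝ => (1 + v) * Real.exp (-v)) (Set.Ioi 0) := by
  have h1 := Real.GammaIntegral_convergent (s := 1) one_pos
  have h2 := Real.GammaIntegral_convergent (s := 2) two_pos
  refine (h1.add h2).congr_fun (fun v hv => ?_) measurableSet_Ioi
  have hv' : (v : ℝ) ^ ((2 : ℝ) - 1) = v := by norm_num
  simp only [Pi.add_apply, sub_self, Real.rpow_zero, hv']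
  ring

theorem norm_one_add_mul_cexp {c : ℂ} (hc : c.re = 1) {v : ℝ} (hv : 0 < v) :
    ‖((1 + v : ℝ) : ℂ) * Complex.exp (-(c * v))‖ = (1 + v) * Real.exp (-v) := by
  rw [norm_mul, Complex.norm_real, Complex.norm_exp, Real.norm_of_nonneg (by positivity)]
  simp [hc]

theorem integrableOn_one_add_mul_cexp {c : ℂ} (hc : c.re = 1) :
    IntegrableOn (fun v : ℝ => ((1 + v : ℝ) : ℂ) * Complex.exp (-(c * v))) (Set.Ioi 0) := by
  refine Integrable.mono' integrableOn_one_add_mul_exp_neg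
    (Continuous.aestronglyMeasurable (by fun_prop)) ?_
  filter_upwards [ae_restrict_mem measurableSet_Ioi] with v hv
  exact (norm_one_add_mul_cexp hc hv).le

theorem integral_one_add_mul_cexp {c : ℂ} (hc : c.re = 1) :
    ∫ v in Set.Ioi (0 : ℝ), ((1 + v : ℝ) : ℂ) * Complex.exp (-(c * v)) = 1 / c + 1 / c ^ 2 := by
  have hc0 : c ≠ 0 := by
    rintro rfl
    simp at hc
  let G : ℝ → ℂ := fun v => -(((v : ℂ) / c + 1 / c + 1 / c ^ 2) * Complex.exp (-(c * v)))
  have hderiv : ∀ v ∈ Set.Ici (0 : ℝ),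
      HasDerivAt G (((1 + v : ℝ) : ℂ) * Complex.exp (-(c * v))) v := by
    intro v _
    have h1 : HasDerivAt (fun v : ℝ => (v : ℂ)) 1 v := Complex.ofRealCLM.hasDerivAt
    have h2 := (((h1.div_const c).add_const (1 / c)).add_const (1 / c ^ 2)).mul
      ((h1.const_mul c).neg.cexp)
    convert! h2.neg using 1
    simp only [Pi.neg_apply]
    push_cast
    field_simp
    ring
  have hlim : Tendsto G atTop (𝓝 0) := by
    have hb : Tendsto (fun v : ℝ => (‖1 / c‖ + ‖1 / c‖ + ‖1 / c ^ 2‖) * (v ^ 1 * Real.exp (-v)))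
        atTop (𝓝 ((‖1 / c‖ + ‖1 / c‖ + ‖1 / c ^ 2‖) * 0)) :=
      (Real.tendsto_pow_mul_exp_neg_atTop_nhds_zero 1).const_mul _
    rw [mul_zero] at hb
    refine squeeze_zero_norm' ?_ hb
    filter_upwards [eventually_ge_atTop 1] with v hv
    have hexp : ‖Complex.exp (-(c * v))‖ = Real.exp (-v) := by
      rw [Complex.norm_exp]; simp [hc]
    rw [norm_neg, norm_mul, hexp, pow_one, ← mul_assoc]
    refine mul_le_mul_of_nonneg_right ?_ (Real.exp_pos _).le
    refine (norm_add₃_le).trans ?_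
    have h1 : ‖(v : ℂ) / c‖ = ‖1 / c‖ * v := by
      rw [div_eq_mul_one_div, norm_mul, Complex.norm_real, Real.norm_of_nonneg (by linarith),
        mul_comm]
    rw [h1]
    nlinarith [norm_nonneg (1 / c), norm_nonneg (1 / c ^ 2)]
  rw [integral_Ioi_of_hasDerivAt_of_tendsto' hderiv (integrableOn_one_add_mul_cexp hc) hlim]
  simp [G]

/-- The function `(1 + |v|) e^{-|v|}`, whose Fourier transform is `4 (1 + 4π²ξ²)⁻²`. -/
def expTent (v : ℝ) : ℂ := ((1 + |v| : ℝ) : ℂ) * Complex.exp (-(|v| : ℝ))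

theorem continuous_expTent : Continuous expTent := by
  unfold expTent
  fun_prop

theorem expTent_mul_cexp_pos (ξ : ℝ) : Set.EqOn
    (fun v : ℝ => Complex.exp (↑(-2 * Real.pi * v * ξ) * Complex.I) • expTent v)
    (fun v : ℝ => ((1 + v : ℝ) : ℂ) * Complex.exp (-((1 + 2 * Real.pi * ξ * Complex.I) * v)))
    (Set.Ioi 0) := by
  intro v hv
  simp only [expTent, smul_eq_mul, abs_of_pos (Set.mem_Ioi.1 hv)]
  rw [mul_left_comm, ← Complex.exp_add]
  congr 2
  push_cast
  ring

theorem expTent_mul_cexp_neg (ξ : ℝ) : Set.EqOn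
    (fun v : ℝ => Complex.exp (↑(-2 * Real.pi * (-v) * ξ) * Complex.I) • expTent (-v))
    (fun v : ℝ => ((1 + v : ℝ) : ℂ) * Complex.exp (-((1 - 2 * Real.pi * ξ * Complex.I) * v)))
    (Set.Ioi 0) := by
  intro v hv
  simp only [expTent, smul_eq_mul, abs_neg, abs_of_pos (Set.mem_Ioi.1 hv)]
  rw [mul_left_comm, ← Complex.exp_add]
  congr 2
  push_cast
  ring

theorem integrable_expTent_mul_cexp (ξ : ℝ) : Integrable
    (fun v : ℝ => Complex.exp (↑(-2 * Real.pi * v * ξ) * Complex.I) • expTent v) := by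
  rw [← integrableOn_univ, ← Set.Iic_union_Ioi (a := (0 : ℝ)), integrableOn_union]
  constructor
  · rw [integrableOn_Iic_iff_integrableOn_Iio,
      ← (Measure.measurePreserving_neg volume).integrableOn_comp_preimage
        (MeasurableEquiv.neg ℝ).measurableEmbedding, Set.neg_preimage, Set.neg_Iio, neg_zero]
    exact (integrableOn_one_add_mul_cexp (by simp)).congr_fun (expTent_mul_cexp_neg ξ).symm
      measurableSet_Ioi
  · exact (integrableOn_one_add_mul_cexp (by simp)).congr_fun (expTent_mul_cexp_pos ξ).symm
      measurableSet_Ioi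

theorem integrable_expTent : Integrable expTent := by
  simpa using integrable_expTent_mul_cexp 0

/-- The half-lines contribute `1/c + 1/c²` with `c = 1 ± 2πiξ`. These two values of `c` have sum
`2`, so the total collapses to `4` over the square of their product. -/
theorem fourier_expTent (ξ : ℝ) :
    𝓕 expTent ξ = ((4 / (1 + (2 * Real.pi * ξ) ^ 2) ^ 2 : ℝ) : ℂ) := by
  have hI := integrable_expTent_mul_cexp ξ
  rw [Real.fourier_real_eq_integral_exp_smul, ← setIntegral_univ,
    ← Set.Iic_union_Ioi (a := (0 : ℝ)),
    setIntegral_union (Set.Iic_disjoint_Ioi le_rfl) measurableSet_Ioi hI.integrableOn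
      hI.integrableOn, setIntegral_congr_fun measurableSet_Ioi (expTent_mul_cexp_pos ξ),
    integral_one_add_mul_cexp (by simp)]
  have h := integral_comp_neg_Ioi (0 : ℝ)
    (fun v : ℝ => Complex.exp (↑(-2 * Real.pi * v * ξ) * Complex.I) • expTent v)
  rw [neg_zero] at h
  rw [← h, setIntegral_congr_fun measurableSet_Ioi (expTent_mul_cexp_neg ξ),
    integral_one_add_mul_cexp (by simp)]
  set y : ℝ := 2 * Real.pi * ξ with hy
  have hy' : (2 * Real.pi * ξ * Complex.I : ℂ) = y * Complex.I := by rw [hy]; push_cast; ring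
  rw [hy']
  have h1 : (1 + y * Complex.I : ℂ) ≠ 0 := fun h => by
    have := congrArg Complex.re h
    simp at this
  have h2 : (1 - y * Complex.I : ℂ) ≠ 0 := fun h => by
    have := congrArg Complex.re h
    simp at this
  have h3 : ((1 + y ^ 2 : ℝ) : ℂ) = (1 + y * Complex.I) * (1 - y * Complex.I) := by
    push_cast
    linear_combination ((y : ℂ) ^ 2) * Complex.I_sq
  push_cast at h3 ⊢
  rw [h3]
  field_simp
  ring

theorem inv_one_add_sq_sq_le (r : ℝ) : ((1 + r ^ 2) ^ 2)⁻¹ ≤ (1 + r ^ 2)⁻¹ := by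
  have : 1 ≤ 1 + r ^ 2 := by nlinarith [sq_nonneg r]
  gcongr
  nlinarith

theorem integrable_inv_one_add_sq_sq : Integrable fun r : ℝ => ((1 + r ^ 2) ^ 2)⁻¹ := by
  refine integrable_inv_one_add_sq.mono' (Continuous.aestronglyMeasurable ?_) ?_
  · exact Continuous.inv₀ (by fun_prop) fun r => by positivity
  · filter_upwards with r
    rw [Real.norm_of_nonneg (by positivity)]
    exact inv_one_add_sq_sq_le r

/-- The real part of Fourier inversion for `expTent`, after the substitution `r = 2πv`. -/
theorem integral_cos_mul_inv_one_add_sq_sq (x : ℝ) :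
    ∫ r : ℝ, Real.cos (x * r) * ((1 + r ^ 2) ^ 2)⁻¹
      = Real.pi / 2 * ((1 + |x|) * Real.exp (-|x|)) := by
  have hpi : (2 * Real.pi) ≠ 0 := by positivity
  have hF : Integrable (𝓕 expTent) := by
    have h1 := (integrable_inv_one_add_sq_sq.comp_mul_left' hpi).const_mul 4
    have h2 := h1.ofReal (𝕜 := ℂ)
    refine h2.congr ?_
    filter_upwards with ξ
    rw [fourier_expTent]
    rfl
  have hinv := integrable_expTent.fourierInv_fourier_eq hF (v := x) continuous_expTent.continuousAt
  rw [Real.fourierInv_eq' ] at hinv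
  have hre := congrArg Complex.re hinv
  have hint : Integrable fun v : ℝ => Complex.exp (↑(2 * Real.pi * inner ℝ v x) * Complex.I)
      • 𝓕 expTent v := by
    refine hF.norm.mono' ?_ ?_
    · have hc : Continuous fun v : ℝ => Complex.exp (↑(2 * Real.pi * inner ℝ v x) * Complex.I) := by
        fun_prop
      exact hc.aestronglyMeasurable.smul hF.aestronglyMeasurable
    · filter_upwards with v
      rw [norm_smul, Complex.norm_exp_ofReal_mul_I, one_mul]
  have h1 : (∫ v : ℝ, Complex.exp (↑(2 * Real.pi * inner ℝ v x) * Complex.I) • 𝓕 expTent v).re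
      = ∫ v : ℝ, (fun r => 4 * (Real.cos (x * r) * ((1 + r ^ 2) ^ 2)⁻¹)) (2 * Real.pi * v) := by
    have := integral_re (𝕜 := ℂ) hint
    simp only [RCLike.re_eq_complex_re] at this
    rw [← this]
    refine integral_congr_ae (Eventually.of_forall fun v => ?_)
    simp only [fourier_expTent, smul_eq_mul, Complex.re_mul_ofReal, Complex.exp_ofReal_mul_I_re]
    have : (2 * Real.pi * inner ℝ v x) = x * (2 * Real.pi * v) := by
      simp; ring
    rw [this]
    ring
  rw [h1, Measure.integral_comp_mul_left (fun r => 4 * (Real.cos (x * r) * ((1 + r ^ 2) ^ 2)⁻¹)),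
    integral_const_mul] at hre
  have hexp : (expTent x).re = (1 + |x|) * Real.exp (-|x|) := by
    rw [expTent, Complex.re_ofReal_mul, ← Complex.ofReal_neg, Complex.exp_ofReal_re]
  rw [hexp, abs_of_pos (by positivity), smul_eq_mul] at hre
  rw [← hre]
  field_simp
  ring

theorem integrable_cos_mul_inv_one_add_sq_sq (x : ℝ) :
    Integrable fun r : ℝ => Real.cos (x * r) * ((1 + r ^ 2) ^ 2)⁻¹ := by
  refine integrable_inv_one_add_sq_sq.mono' (Continuous.aestronglyMeasurable ?_) ?_
  · exact Continuous.mul (by fun_prop) (Continuous.inv₀ (by fun_prop) fun r => by positivity)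
  · filter_upwards with r
    rw [norm_mul, Real.norm_of_nonneg (by positivity : 0 ≤ ((1 + r ^ 2) ^ 2)⁻¹)]
    exact mul_le_of_le_one_left (by positivity) (Real.abs_cos_le_one _)

theorem integral_inv_one_add_sq_sq : ∫ r : ℝ, ((1 + r ^ 2) ^ 2)⁻¹ = Real.pi / 2 := by
  simpa using integral_cos_mul_inv_one_add_sq_sq 0

theorem sq_mul_inv_one_add_sq_sq (r : ℝ) :
    r ^ 2 * ((1 + r ^ 2) ^ 2)⁻¹ = (1 + r ^ 2)⁻¹ - ((1 + r ^ 2) ^ 2)⁻¹ := by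
  have : 1 + r ^ 2 ≠ 0 := by positivity
  field_simp
  ring

theorem integrable_sq_mul_inv_one_add_sq_sq :
    Integrable fun r : ℝ => r ^ 2 * ((1 + r ^ 2) ^ 2)⁻¹ := by
  simp_rw [sq_mul_inv_one_add_sq_sq]
  exact integrable_inv_one_add_sq.sub integrable_inv_one_add_sq_sq

theorem integral_sq_mul_inv_one_add_sq_sq :
    ∫ r : ℝ, r ^ 2 * ((1 + r ^ 2) ^ 2)⁻¹ = Real.pi / 2 := by
  simp_rw [sq_mul_inv_one_add_sq_sq]
  rw [integral_sub integrable_inv_one_add_sq integrable_inv_one_add_sq_sq,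
    integral_inv_one_add_sq_sq, integral_univ_inv_one_add_sq]
  ring

end PoissonSquareKernel

/-! ### Second differences against Abel means. -/

section AbelSummability

theorem aestronglyMeasurable_of_div_one_add_sq {α : ℝ → ℝ}
    (hα : IntegrableOn (fun t => α t / (1 + t ^ 2)) (Set.Ioi 0)) :
    AEStronglyMeasurable α (volume.restrict (Set.Ioi 0)) := by
  have hc : Continuous fun t : ℝ => 1 + t ^ 2 := by fun_prop
  refine (hα.aestronglyMeasurable.mul hc.aestronglyMeasurable).congr ?_
  filter_upwards with t
  have : 1 + t ^ 2 ≠ 0 := by positivity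
  simp only [Pi.mul_apply]
  field_simp

theorem integrableOn_mul_of_abs_le {α g : ℝ → ℝ} {C : ℝ}
    (hα : IntegrableOn (fun t => α t / (1 + t ^ 2)) (Set.Ioi 0))
    (hg : AEStronglyMeasurable g (volume.restrict (Set.Ioi 0)))
    (hC : ∀ t, 0 < t → |g t| ≤ C / (1 + t ^ 2)) :
    IntegrableOn (fun t => α t * g t) (Set.Ioi 0) := by
  refine Integrable.mono' (hα.norm.mul_const C)
    ((aestronglyMeasurable_of_div_one_add_sq hα).mul hg) ?_
  filter_upwards [ae_restrict_mem measurableSet_Ioi] with t ht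
  have hpos : (0 : ℝ) < 1 + t ^ 2 := by positivity
  rw [norm_mul, norm_div, Real.norm_of_nonneg hpos.le, div_mul_eq_mul_div, ← mul_div_assoc']
  exact mul_le_mul_of_nonneg_left (hC t ht) (norm_nonneg _)

theorem abs_integral_mul_le {α g : ℝ → ℝ} {C : ℝ}
    (hα : IntegrableOn (fun t => α t / (1 + t ^ 2)) (Set.Ioi 0))
    (hC : ∀ t, 0 < t → |g t| ≤ C / (1 + t ^ 2)) :
    |∫ t in Set.Ioi 0, α t * g t| ≤ C * ∫ t in Set.Ioi 0, |α t / (1 + t ^ 2)| := by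
  rw [mul_comm, ← integral_mul_const, ← Real.norm_eq_abs]
  refine norm_integral_le_of_norm_le (hα.abs.mul_const C) ?_
  filter_upwards [ae_restrict_mem measurableSet_Ioi] with t ht
  have hpos : (0 : ℝ) < 1 + t ^ 2 := by positivity
  rw [norm_mul, abs_div, abs_of_pos hpos, div_mul_eq_mul_div, ← mul_div_assoc']
  exact mul_le_mul_of_nonneg_left (hC t ht) (norm_nonneg _)

theorem one_sub_cos_div_sq_nonneg (r t : ℝ) : 0 ≤ (1 - Real.cos (r * t)) / t ^ 2 :=
  div_nonneg (by linarith [Real.cos_le_one (r * t)]) (sq_nonneg _)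

theorem one_sub_cos_div_sq_le (r : ℝ) {t : ℝ} (ht : 0 < t) :
    (1 - Real.cos (r * t)) / t ^ 2 ≤ (r ^ 2 / 2 + 2) / (1 + t ^ 2) := by
  rw [div_le_div_iff₀ (by positivity) (by positivity)]
  have h1 := Real.one_sub_sq_div_two_le_cos (x := r * t)
  have h2 := Real.neg_one_le_cos (r * t)
  have : (1 - Real.cos (r * t)) * t ^ 2 ≤ 2 * t ^ 2 := by
    apply mul_le_mul_of_nonneg_right _ (sq_nonneg _)
    linarith
  nlinarith

theorem measurable_one_sub_cos_div_sq (r : ℝ) :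
    Measurable fun t : ℝ => (1 - Real.cos (r * t)) / t ^ 2 := by fun_prop

theorem abs_one_sub_cos_div_sq_le (r : ℝ) (t : ℝ) (ht : 0 < t) :
    |(1 - Real.cos (r * t)) / t ^ 2| ≤ (r ^ 2 / 2 + 2) / (1 + t ^ 2) := by
  rw [abs_of_nonneg (one_sub_cos_div_sq_nonneg r t)]
  exact one_sub_cos_div_sq_le r ht

theorem integrableOn_mul_one_sub_cos {α : ℝ → ℝ}
    (hα : IntegrableOn (fun t => α t / (1 + t ^ 2)) (Set.Ioi 0)) (r : ℝ) :
    IntegrableOn (fun t => α t * ((1 - Real.cos (r * t)) / t ^ 2)) (Set.Ioi 0) :=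
  integrableOn_mul_of_abs_le hα (measurable_one_sub_cos_div_sq r).aestronglyMeasurable
    (abs_one_sub_cos_div_sq_le r)

/-- The symmetric second difference with step `r`, at the origin, of the second primitive of
`ω ↦ a₀ + ∫₀^∞ α(t) cos(ω t) dt`. -/
def secondDiff (a₀ : ℝ) (α : ℝ → ℝ) (r : ℝ) : ℝ :=
  a₀ * r ^ 2 + 2 * ∫ t in Set.Ioi 0, α t * ((1 - Real.cos (r * t)) / t ^ 2)

theorem abs_secondDiff_le (a₀ : ℝ) {α : ℝ → ℝ}
    (hα : IntegrableOn (fun t => α t / (1 + t ^ 2)) (Set.Ioi 0)) (r : ℝ) :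
    |secondDiff a₀ α r|
      ≤ |a₀| * r ^ 2 + (r ^ 2 + 4) * ∫ t in Set.Ioi 0, |α t / (1 + t ^ 2)| := by
  have := abs_integral_mul_le hα (abs_one_sub_cos_div_sq_le r)
  rw [secondDiff]
  refine (abs_add_le _ _).trans ?_
  rw [abs_mul, abs_mul, abs_of_nonneg (sq_nonneg r), abs_two]
  linarith

/-- `∫₀^h η e^{-ηt} dη` in closed form. -/
theorem integral_mul_exp_neg {t : ℝ} (ht : 0 < t) (h : ℝ) :
    ∫ η in (0 : ℝ)..h, η * Real.exp (-(η * t))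
      = (1 - (1 + h * t) * Real.exp (-(h * t))) / t ^ 2 := by
  have hd : ∀ η ∈ Set.uIcc 0 h, HasDerivAt
      (fun η : ℝ => -((1 + η * t) * Real.exp (-(η * t)) / t ^ 2)) (η * Real.exp (-(η * t))) η := by
    intro η _
    have h1 : HasDerivAt (fun η : ℝ => η * t) t η := by
      simpa using (hasDerivAt_id η).mul_const t
    convert! (((h1.const_add 1).mul h1.neg.exp).div_const (t ^ 2)).neg using 1
    simp only [Pi.neg_apply]
    field_simp
    ring
  rw [intervalIntegral.integral_eq_sub_of_hasDerivAt hd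
    (Continuous.intervalIntegrable (by fun_prop) _ _)]
  simp
  ring

theorem integrable_prod_secondDiff {α : ℝ → ℝ}
    (hα : IntegrableOn (fun t => α t / (1 + t ^ 2)) (Set.Ioi 0)) (h : ℝ) :
    Integrable (fun p : ℝ × ℝ => ((1 + p.1 ^ 2) ^ 2)⁻¹ *
      (α p.2 * ((1 - Real.cos (h * p.1 * p.2)) / p.2 ^ 2)))
      (volume.prod (volume.restrict (Set.Ioi 0))) := by
  have h1 : Integrable fun r : ℝ =>
      h ^ 2 / 2 * (r ^ 2 * ((1 + r ^ 2) ^ 2)⁻¹) + 2 * ((1 + r ^ 2) ^ 2)⁻¹ :=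
    (integrable_sq_mul_inv_one_add_sq_sq.const_mul _).add
      (integrable_inv_one_add_sq_sq.const_mul _)
  refine (h1.mul_prod hα.abs).mono' ?_ ?_
  · refine AEStronglyMeasurable.mul (Measurable.aestronglyMeasurable (by fun_prop)) ?_
    refine AEStronglyMeasurable.mul ?_ (Measurable.aestronglyMeasurable (by fun_prop))
    exact (aestronglyMeasurable_of_div_one_add_sq hα).comp_snd
  · have : ∀ᵐ p : ℝ × ℝ ∂(volume.prod (volume.restrict (Set.Ioi 0))), 0 < p.2 :=
      Measure.quasiMeasurePreserving_snd.ae (ae_restrict_mem measurableSet_Ioi)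
    filter_upwards [this] with p hp
    have hpos : (0 : ℝ) < 1 + p.2 ^ 2 := by positivity
    rw [norm_mul, norm_mul, Real.norm_of_nonneg (by positivity : 0 ≤ ((1 + p.1 ^ 2) ^ 2)⁻¹),
      Real.norm_eq_abs, Real.norm_eq_abs, abs_div (α p.2), abs_of_pos hpos]
    calc ((1 + p.1 ^ 2) ^ 2)⁻¹ * (|α p.2| * |(1 - Real.cos (h * p.1 * p.2)) / p.2 ^ 2|)
        ≤ ((1 + p.1 ^ 2) ^ 2)⁻¹ * (|α p.2| * (((h * p.1) ^ 2 / 2 + 2) / (1 + p.2 ^ 2))) := by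
          gcongr
          exact abs_one_sub_cos_div_sq_le _ _ hp
      _ = _ := by ring

/-- Fubini and the cosine transform replace `(1 - cos hrt)/t²` by `(1 - (1 + ht)e^{-ht})/t²`, which
is the integral of `η e^{-ηt}` over `(0, h)`. The weight `(1 + r²)⁻²` is chosen for this: the
average of second differences becomes an average of Abel means over `η`, with the positive weight
`η`. -/
theorem integral_secondDiff_mul (a₀ : ℝ) {α : ℝ → ℝ}
    (hα : IntegrableOn (fun t => α t / (1 + t ^ 2)) (Set.Ioi 0)) {h : ℝ} (hh : 0 < h) :
    Integrable (fun r => secondDiff a₀ α (h * r) * ((1 + r ^ 2) ^ 2)⁻¹) ∧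
    ∫ r : ℝ, secondDiff a₀ α (h * r) * ((1 + r ^ 2) ^ 2)⁻¹
      = Real.pi * (a₀ * h ^ 2 / 2
        + ∫ t in Set.Ioi 0, α t * ((1 - (1 + h * t) * Real.exp (-(h * t))) / t ^ 2)) := by
  have hF := integrable_prod_secondDiff hα h
  have h1 : ∀ r, secondDiff a₀ α (h * r) * ((1 + r ^ 2) ^ 2)⁻¹
      = a₀ * h ^ 2 * (r ^ 2 * ((1 + r ^ 2) ^ 2)⁻¹) + 2 * ∫ t in Set.Ioi 0, ((1 + r ^ 2) ^ 2)⁻¹ *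
        (α t * ((1 - Real.cos (h * r * t)) / t ^ 2)) := by
    intro r
    rw [integral_const_mul, secondDiff]
    ring
  simp_rw [h1]
  have hI1 := integrable_sq_mul_inv_one_add_sq_sq.const_mul (a₀ * h ^ 2)
  have hI2 := hF.integral_prod_left.const_mul 2
  refine ⟨hI1.add hI2, ?_⟩
  rw [integral_add hI1 hI2, integral_const_mul, integral_const_mul,
    integral_sq_mul_inv_one_add_sq_sq, integral_integral_swap hF]
  have h2 : ∀ t ∈ Set.Ioi (0 : ℝ), ∫ r : ℝ, ((1 + r ^ 2) ^ 2)⁻¹ *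
      (α t * ((1 - Real.cos (h * r * t)) / t ^ 2))
      = Real.pi / 2 * (α t * ((1 - (1 + h * t) * Real.exp (-(h * t))) / t ^ 2)) := by
    intro t ht
    have ht' : 0 < h * t := mul_pos hh ht
    have : ∀ r, ((1 + r ^ 2) ^ 2)⁻¹ * (α t * ((1 - Real.cos (h * r * t)) / t ^ 2))
        = (α t / t ^ 2) * (((1 + r ^ 2) ^ 2)⁻¹ - Real.cos (h * t * r) * ((1 + r ^ 2) ^ 2)⁻¹) := by
      intro r
      rw [mul_right_comm h r t]
      ring
    simp_rw [this]
    rw [integral_const_mul, integral_sub integrable_inv_one_add_sq_sq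
      (integrable_cos_mul_inv_one_add_sq_sq _), integral_inv_one_add_sq_sq,
      integral_cos_mul_inv_one_add_sq_sq, abs_of_pos ht']
    ring
  rw [setIntegral_congr_fun measurableSet_Ioi h2, integral_const_mul]
  ring

theorem one_sub_exp_div_sq_nonneg {h : ℝ} (hh : 0 < h) {t : ℝ} (ht : 0 < t) :
    0 ≤ (1 - (1 + h * t) * Real.exp (-(h * t))) / t ^ 2 := by
  rw [← integral_mul_exp_neg ht]
  exact intervalIntegral.integral_nonneg hh.le fun η hη => mul_nonneg hη.1 (Real.exp_pos _).le

theorem abs_one_sub_exp_div_sq_le {h : ℝ} (hh : 0 < h) (t : ℝ) (ht : 0 < t) :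
    |(1 - (1 + h * t) * Real.exp (-(h * t))) / t ^ 2| ≤ (h ^ 2 / 2 + 1) / (1 + t ^ 2) := by
  have h0 := one_sub_exp_div_sq_nonneg hh ht
  have h1 : (1 - (1 + h * t) * Real.exp (-(h * t))) / t ^ 2 ≤ h ^ 2 / 2 := by
    rw [← integral_mul_exp_neg ht]
    calc ∫ η in (0 : ℝ)..h, η * Real.exp (-(η * t)) ≤ ∫ η in (0 : ℝ)..h, η := by
          refine intervalIntegral.integral_mono_on hh.le
            (Continuous.intervalIntegrable (by fun_prop) _ _)
            (Continuous.intervalIntegrable (by fun_prop) _ _) fun η hη => ?_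
          refine mul_le_of_le_one_right hη.1 (Real.exp_le_one_iff.2 ?_)
          have := mul_nonneg hη.1 ht.le
          linarith
      _ = h ^ 2 / 2 := by simp
  rw [abs_of_nonneg h0]
  have h2 : (1 - (1 + h * t) * Real.exp (-(h * t))) ≤ 1 := by
    have : 0 ≤ (1 + h * t) * Real.exp (-(h * t)) := by positivity
    linarith
  rw [div_le_iff₀ (by positivity)] at h1
  rw [div_le_div_iff₀ (by positivity) (by positivity)]
  nlinarith

theorem integrable_prod_laplace {α : ℝ → ℝ}
    (hα : IntegrableOn (fun t => α t / (1 + t ^ 2)) (Set.Ioi 0)) {h : ℝ} (hh : 0 < h) :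
    Integrable (fun p : ℝ × ℝ => α p.1 * (p.2 * Real.exp (-(p.2 * p.1))))
      ((volume.restrict (Set.Ioi 0)).prod (volume.restrict (Set.Ioc 0 h))) := by
  rw [integrable_prod_iff]
  · constructor
    · filter_upwards with t
      have : Continuous fun η : ℝ => α t * (η * Real.exp (-(η * t))) := by fun_prop
      exact (this.integrableOn_Icc (a := 0) (b := h)).mono_set Set.Ioc_subset_Icc_self
    · have h1 := (integrableOn_mul_of_abs_le hα (C := h ^ 2 / 2 + 1)
        (g := fun t => (1 - (1 + h * t) * Real.exp (-(h * t))) / t ^ 2)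
        (Measurable.aestronglyMeasurable (by fun_prop)) (abs_one_sub_exp_div_sq_le hh)).norm
      refine h1.congr ?_
      filter_upwards [ae_restrict_mem measurableSet_Ioi] with t ht
      rw [norm_mul, Real.norm_of_nonneg (one_sub_exp_div_sq_nonneg hh ht),
        ← integral_mul_exp_neg ht, intervalIntegral.integral_of_le hh.le, ← integral_const_mul]
      refine setIntegral_congr_fun measurableSet_Ioc fun η hη => ?_
      simp only [norm_mul, Real.norm_eq_abs, abs_of_pos hη.1, abs_of_pos (Real.exp_pos _)]
  · refine AEStronglyMeasurable.mul ?_ (Continuous.aestronglyMeasurable (by fun_prop))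
    exact (aestronglyMeasurable_of_div_one_add_sq hα).comp_fst

theorem integral_mul_laplace {α : ℝ → ℝ}
    (hα : IntegrableOn (fun t => α t / (1 + t ^ 2)) (Set.Ioi 0)) {h : ℝ} (hh : 0 < h) :
    IntegrableOn (fun η => η * ∫ t in Set.Ioi 0, Real.exp (-(η * t)) * α t) (Set.Ioc 0 h) ∧
    ∫ η in Set.Ioc 0 h, η * ∫ t in Set.Ioi 0, Real.exp (-(η * t)) * α t
      = ∫ t in Set.Ioi 0, α t * ((1 - (1 + h * t) * Real.exp (-(h * t))) / t ^ 2) := by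
  have hF := integrable_prod_laplace hα hh
  have h1 : ∀ η : ℝ, ∫ t in Set.Ioi 0, α t * (η * Real.exp (-(η * t)))
      = η * ∫ t in Set.Ioi 0, Real.exp (-(η * t)) * α t := fun η => by
    rw [← integral_const_mul]
    congr 1
    ext t
    ring
  have h2 := hF.integral_prod_right
  simp_rw [h1] at h2
  refine ⟨h2, ?_⟩
  simp_rw [← h1]
  rw [← integral_integral_swap hF]
  refine setIntegral_congr_fun measurableSet_Ioi fun t ht => ?_
  rw [integral_const_mul, ← integral_mul_exp_neg ht, intervalIntegral.integral_of_le hh.le]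

theorem tendsto_integral_inv_one_add_sq_tail {δ : ℝ} (hδ : 0 < δ) :
    Tendsto (fun h : ℝ => ∫ r : ℝ, {r : ℝ | δ < |h * r|}.indicator
      (fun r => r ^ 2 * ((1 + r ^ 2) ^ 2)⁻¹) r) (𝓝[>] 0) (𝓝 0) := by
  have h0 : (0 : ℝ) = ∫ r : ℝ, (0 : ℝ) := by simp
  conv in 𝓝 0 => rw [h0]
  refine tendsto_integral_filter_of_dominated_convergence
    (fun r : ℝ => r ^ 2 * ((1 + r ^ 2) ^ 2)⁻¹) ?_ ?_ integrable_sq_mul_inv_one_add_sq_sq ?_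
  · filter_upwards with h
    exact (integrable_sq_mul_inv_one_add_sq_sq.indicator
      (measurableSet_lt (by fun_prop) (by fun_prop))).aestronglyMeasurable
  · filter_upwards with h
    filter_upwards with r
    have hn : 0 ≤ r ^ 2 * ((1 + r ^ 2) ^ 2)⁻¹ := by positivity
    refine (norm_indicator_le_norm_self _ _).trans (le_of_eq ?_)
    rw [Real.norm_of_nonneg hn]
  · filter_upwards with r
    refine tendsto_const_nhds.congr' ?_
    have hc : ContinuousAt (fun h : ℝ => |h * r|) 0 := by fun_prop
    have : ∀ᶠ h in 𝓝 (0 : ℝ), |h * r| < δ := by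
      apply hc.eventually_lt continuousAt_const
      simpa using hδ
    filter_upwards [this.filter_mono nhdsWithin_le_nhds] with h hh
    rw [Set.indicator_of_notMem]
    simpa using hh.le

/-- A one-sided Riemann uniqueness principle for Abel summation: if the Abel means
`a₀ + ∫₀^∞ e^{-ηt} α(t) dt` have a nonnegative lower limit as `η ↓ 0`, then the second difference
of the second primitive cannot be bounded above by a strictly concave parabola near `0`. -/
theorem not_secondDiff_le_of_abel (a₀ : ℝ) {α : ℝ → ℝ}
    (hα : IntegrableOn (fun t => α t / (1 + t ^ 2)) (Set.Ioi 0))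
    (hU : ∀ c < 0, ∀ᶠ η in 𝓝[>] (0 : ℝ),
      c ≤ a₀ + ∫ t in Set.Ioi 0, Real.exp (-(η * t)) * α t)
    {ε δ : ℝ} (hε : 0 < ε) (hδ : 0 < δ) :
    ¬ ∀ r, |r| ≤ δ → secondDiff a₀ α r ≤ -(2 * ε * r ^ 2) := by
  intro hD
  set N := ∫ t in Set.Ioi 0, |α t / (1 + t ^ 2)| with hN
  have hN0 : 0 ≤ N := integral_nonneg fun _ => abs_nonneg _
  -- Beyond `δ` one has `4 ≤ (4/δ²) r²`, so the crude bound of the second difference is a multiple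
  -- of `r²`; the term `2ε` pays for the parabola carried along in `hfar`.
  set C := |a₀| + (1 + 4 / δ ^ 2) * N + 2 * ε with hC
  have hfar : ∀ r, δ < |r| → secondDiff a₀ α r ≤ -(2 * ε * r ^ 2) + C * r ^ 2 := by
    intro r hr
    have h1 := (le_abs_self _).trans (abs_secondDiff_le a₀ hα r)
    have h2 : δ ^ 2 ≤ r ^ 2 := by
      rw [← sq_abs r]
      gcongr
    have h3 : 4 ≤ 4 / δ ^ 2 * r ^ 2 := by
      rw [div_mul_eq_mul_div, le_div_iff₀ (by positivity)]
      linarith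
    have h4 : 4 * N ≤ 4 / δ ^ 2 * r ^ 2 * N := mul_le_mul_of_nonneg_right h3 hN0
    rw [hC]
    linarith
  -- The parabola averages to `-πεh²`, because `r² (1 + r²)⁻²` has integral `π/2`; the far region
  -- only adds a tail that vanishes with `h`.
  have hupper : ∀ h : ℝ, 0 < h →
      Real.pi * (a₀ * h ^ 2 / 2
        + ∫ t in Set.Ioi 0, α t * ((1 - (1 + h * t) * Real.exp (-(h * t))) / t ^ 2))
      ≤ h ^ 2 * (-(Real.pi * ε) + C * ∫ r : ℝ, {r : ℝ | δ < |h * r|}.indicator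
        (fun r => r ^ 2 * ((1 + r ^ 2) ^ 2)⁻¹) r) := by
    intro h hh
    obtain ⟨hi, he⟩ := integral_secondDiff_mul a₀ hα hh
    rw [← he]
    have hiT := integrable_sq_mul_inv_one_add_sq_sq.indicator
      (measurableSet_lt (by fun_prop) (by fun_prop) : MeasurableSet {r : ℝ | δ < |h * r|})
    calc ∫ r : ℝ, secondDiff a₀ α (h * r) * ((1 + r ^ 2) ^ 2)⁻¹
        ≤ ∫ r : ℝ, (-(2 * ε * h ^ 2) * (r ^ 2 * ((1 + r ^ 2) ^ 2)⁻¹)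
          + C * h ^ 2 * {r : ℝ | δ < |h * r|}.indicator
            (fun r => r ^ 2 * ((1 + r ^ 2) ^ 2)⁻¹) r) := by
          refine integral_mono hi
            ((integrable_sq_mul_inv_one_add_sq_sq.const_mul _).add (hiT.const_mul _)) fun r => ?_
          have hk : 0 ≤ ((1 + r ^ 2) ^ 2)⁻¹ := by positivity
          rcases le_or_gt |h * r| δ with hr | hr
          · have := mul_le_mul_of_nonneg_right (hD _ hr) hk
            simp only [Set.indicator, Set.mem_ofPred_eq, not_lt.2 hr, if_false]
            calc _ ≤ _ := this
              _ = _ := by ring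
          · have := mul_le_mul_of_nonneg_right (hfar _ hr) hk
            simp only [Set.indicator, Set.mem_ofPred_eq, hr, if_true]
            calc _ ≤ _ := this
              _ = _ := by ring
      _ = _ := by
          rw [integral_add (integrable_sq_mul_inv_one_add_sq_sq.const_mul _) (hiT.const_mul _),
            integral_const_mul, integral_const_mul, integral_sq_mul_inv_one_add_sq_sq]
          ring
  have hlim : Tendsto (fun h : ℝ => -(Real.pi * ε) + C * ∫ r : ℝ,
      {r : ℝ | δ < |h * r|}.indicator (fun r => r ^ 2 * ((1 + r ^ 2) ^ 2)⁻¹) r) (𝓝[>] 0)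
      (𝓝 (-(Real.pi * ε) + C * 0)) :=
    ((tendsto_integral_inv_one_add_sq_tail hδ).const_mul C).const_add _
  have hpi := Real.pi_pos
  have hpe : 0 < Real.pi * ε := mul_pos hpi hε
  have hev1 := hlim.eventually_lt_const (by linarith : -(Real.pi * ε) + C * 0 < -(Real.pi * ε) / 2)
  -- Abel means above `-ε/2` bound the average below by `-πεh²/4`, whereas the upper bound has
  -- dropped below `-πεh²/2`.
  obtain ⟨h₀, hh₀, hlow⟩ := (mem_nhdsGT_iff_exists_Ioo_subset).1
    (hU (-(ε / 2)) (by linarith))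
  obtain ⟨h, hh1, hh2⟩ := (hev1.and (Ioo_mem_nhdsGT (Set.mem_Ioi.1 hh₀))).exists
  obtain ⟨hi, he⟩ := integral_mul_laplace hα hh2.1
  have hlower : -(ε / 2) * (h ^ 2 / 2) - a₀ * h ^ 2 / 2
      ≤ ∫ t in Set.Ioi 0, α t * ((1 - (1 + h * t) * Real.exp (-(h * t))) / t ^ 2) := by
    rw [← he]
    have h1 : ∫ η in Set.Ioc 0 h, (-(ε / 2) - a₀) * η = (-(ε / 2) - a₀) * (h ^ 2 / 2) := by
      rw [integral_const_mul, ← intervalIntegral.integral_of_le hh2.1.le, integral_id]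
      ring
    calc _ = ∫ η in Set.Ioc 0 h, (-(ε / 2) - a₀) * η := by rw [h1]; ring
      _ ≤ _ := by
        refine setIntegral_mono_on
          ((Continuous.integrableOn_Icc (by fun_prop)).mono_set Set.Ioc_subset_Icc_self) hi
          measurableSet_Ioc fun η hη => ?_
        have := hlow ⟨hη.1, hη.2.trans_lt hh2.2⟩
        rw [mul_comm]
        refine mul_le_mul_of_nonneg_left ?_ hη.1.le
        simp only [Set.mem_ofPred_eq] at this
        linarith
  have h2 := hupper h hh2.1
  have hhsq : 0 < h ^ 2 := pow_pos hh2.1 2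
  have h3 := mul_lt_mul_of_pos_left hh1 hhsq
  have h4 := mul_le_mul_of_nonneg_left hlower hpi.le
  have h5 : 0 < Real.pi * ε * h ^ 2 := by positivity
  nlinarith

end AbelSummability

/-! ### Convexity of the second primitive and Fejér-damped symbols. -/

section Convexity

theorem integrableOn_mul_cos_div {a : ℝ → ℝ}
    (ha : IntegrableOn (fun t => a t / (1 + t ^ 2)) (Set.Ioi 0)) (y : ℝ) :
    IntegrableOn (fun t => a t * Real.cos (y * t) / (1 + t ^ 2)) (Set.Ioi 0) := by
  refine Integrable.mono' ha.norm ?_ ?_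
  · have hc : Continuous fun t : ℝ => Real.cos (y * t) := by fun_prop
    refine (ha.aestronglyMeasurable.mul hc.aestronglyMeasurable).congr ?_
    filter_upwards with t
    simp only [Pi.mul_apply]
    ring
  · filter_upwards with t
    rw [norm_div, norm_mul, norm_div]
    gcongr
    exact mul_le_of_le_one_right (norm_nonneg _) (Real.abs_cos_le_one _)

/-- The second primitive `a₀ x²/2 + ∫₀^∞ a(t) (1 - cos xt)/t² dt` of the symbol
`a₀ + ∫₀^∞ a(t) cos(xt) dt`. -/
def secondPrimitive (a₀ : ℝ) (a : ℝ → ℝ) (x : ℝ) : ℝ :=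
  a₀ * x ^ 2 / 2 + ∫ t in Set.Ioi 0, a t * ((1 - Real.cos (x * t)) / t ^ 2)

theorem continuous_secondPrimitive (a₀ : ℝ) {a : ℝ → ℝ}
    (ha : IntegrableOn (fun t => a t / (1 + t ^ 2)) (Set.Ioi 0)) :
    Continuous (secondPrimitive a₀ a) := by
  refine Continuous.add (by fun_prop) ?_
  rw [continuous_iff_continuousAt]
  intro x₀
  refine continuousAt_of_dominated
    (bound := fun t => ‖a t / (1 + t ^ 2)‖ * ((|x₀| + 1) ^ 2 / 2 + 2)) ?_ ?_
    (ha.norm.mul_const _) ?_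
  · filter_upwards with x
    exact (integrableOn_mul_one_sub_cos ha x).aestronglyMeasurable
  · have hc : ContinuousAt (fun x : ℝ => |x|) x₀ := by fun_prop
    filter_upwards [hc.eventually_lt continuousAt_const (lt_add_one |x₀|)] with x hx
    filter_upwards [ae_restrict_mem measurableSet_Ioi] with t ht
    have hpos : (0 : ℝ) < 1 + t ^ 2 := by positivity
    rw [norm_mul, norm_div (a t), Real.norm_of_nonneg hpos.le, div_mul_eq_mul_div, ← mul_div_assoc']
    refine mul_le_mul_of_nonneg_left ((abs_one_sub_cos_div_sq_le x t ht).trans ?_) (norm_nonneg _)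
    gcongr ?_ / _
    have : x ^ 2 ≤ (|x₀| + 1) ^ 2 := by
      rw [← sq_abs]
      gcongr
    linarith
  · filter_upwards with t
    fun_prop

/-- The addition theorem for the cosine: moving the base point to `x` amounts to modulating the
kernel by `cos xt`. Hence an argument at the origin serves at every point. -/
theorem secondPrimitive_symm_diff (a₀ : ℝ) {a : ℝ → ℝ}
    (ha : IntegrableOn (fun t => a t / (1 + t ^ 2)) (Set.Ioi 0)) (x r : ℝ) :
    secondPrimitive a₀ a (x + r) + secondPrimitive a₀ a (x - r) - 2 * secondPrimitive a₀ a x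
      = secondDiff a₀ (fun t => a t * Real.cos (x * t)) r := by
  have h1 := integrableOn_mul_one_sub_cos ha (x + r)
  have h2 := integrableOn_mul_one_sub_cos ha (x - r)
  have h3 := integrableOn_mul_one_sub_cos ha x
  have h : ∀ t, a t * Real.cos (x * t) * ((1 - Real.cos (r * t)) / t ^ 2)
      = 1 / 2 * (a t * ((1 - Real.cos ((x + r) * t)) / t ^ 2)
        + a t * ((1 - Real.cos ((x - r) * t)) / t ^ 2)
        - 2 * (a t * ((1 - Real.cos (x * t)) / t ^ 2))) := by
    intro t
    rw [add_mul, sub_mul, Real.cos_add, Real.cos_sub]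
    ring
  simp only [secondDiff, secondPrimitive, h]
  have h12 : IntegrableOn (fun t => a t * ((1 - Real.cos ((x + r) * t)) / t ^ 2)
      + a t * ((1 - Real.cos ((x - r) * t)) / t ^ 2)) (Set.Ioi 0) := h1.add h2
  rw [integral_const_mul, integral_sub h12 (h3.const_mul 2), integral_add h1 h2,
    integral_const_mul]
  ring

/-- If the Abel means of `a₀ + ∫₀^∞ a(t) cos(yt) dt` have a nonnegative lower limit at every `y`,
then its second primitive is convex. -/
theorem secondDiff_nonneg_of_abel (a₀ : ℝ) {a : ℝ → ℝ}
    (ha : IntegrableOn (fun t => a t / (1 + t ^ 2)) (Set.Ioi 0))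
    (hU : ∀ y, ∀ c < 0, ∀ᶠ η in 𝓝[>] (0 : ℝ),
      c ≤ a₀ + ∫ t in Set.Ioi 0, Real.exp (-(η * t)) * (a t * Real.cos (y * t)))
    (y : ℝ) {s : ℝ} (hs : 0 < s) :
    0 ≤ secondDiff a₀ (fun t => a t * Real.cos (y * t)) s := by
  by_contra! hneg
  set G := secondPrimitive a₀ a with hG
  have hGc : Continuous G := continuous_secondPrimitive a₀ ha
  have hsd := secondPrimitive_symm_diff a₀ ha
  set D := secondDiff a₀ (fun t => a t * Real.cos (y * t)) s with hD
  -- With this `ε`, and `l` the slope of the chord, `H(y ± s) - H(y) = D/4 < 0`, so the maximum of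
  -- `H` is attained in the interior.
  set ε := -D / (4 * s ^ 2) with hε
  have hε0 : 0 < ε := div_pos (by linarith) (by positivity)
  set l := (G (y + s) - G (y - s)) / (2 * s) with hl
  let H : ℝ → ℝ := fun x => G x + ε * (x - y) ^ 2 - l * (x - y)
  have hHc : Continuous H := by fun_prop
  obtain ⟨x₀, hx₀, hmax⟩ := (isCompact_Icc (a := y - s) (b := y + s)).exists_isMaxOn
    ⟨y, by constructor <;> linarith⟩ hHc.continuousOn
  have hy := hmax (a := y) ⟨by linarith, by linarith⟩
  simp only [Set.mem_ofPred_eq, H] at hy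
  have hls : l * s = (G (y + s) - G (y - s)) / 2 := by
    rw [hl]
    field_simp
  have hεs : ε * s ^ 2 = -D / 4 := by
    rw [hε]
    field_simp
  have hDs := hsd y s
  rw [← hD] at hDs
  have hne1 : x₀ ≠ y - s := by
    rintro rfl
    have : y - s - y = -s := by ring
    rw [this] at hy
    nlinarith
  have hne2 : x₀ ≠ y + s := by
    rintro rfl
    have : y + s - y = s := by ring
    rw [this] at hy
    nlinarith
  have hlt1 : y - s < x₀ := lt_of_le_of_ne hx₀.1 hne1.symm
  have hlt2 : x₀ < y + s := lt_of_le_of_ne hx₀.2 hne2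
  have hδ : 0 < min (x₀ - (y - s)) (y + s - x₀) := lt_min (by linarith) (by linarith)
  -- At the maximum the second differences of `H` are nonpositive, and those of the added parabola
  -- are `2εr²`.
  refine not_secondDiff_le_of_abel a₀ (integrableOn_mul_cos_div ha x₀) (hU x₀) hε0 hδ ?_
  intro r hr
  have hr1 := hr.trans (min_le_left _ _)
  have hr2 := hr.trans (min_le_right _ _)
  rw [abs_le] at hr1 hr2
  have h1 := hmax (a := x₀ + r) ⟨by linarith, by linarith⟩
  have h2 := hmax (a := x₀ - r) ⟨by linarith, by linarith⟩
  simp only [Set.mem_ofPred_eq, H] at h1 h2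
  rw [← hsd x₀ r]
  nlinarith

/-- The Fejér factor `2 (1 - cos x) / x²`. -/
def fejer (x : ℝ) : ℝ := 2 * (1 - Real.cos x) / x ^ 2

theorem measurable_fejer : Measurable fejer := by
  unfold fejer
  fun_prop

theorem abs_fejer_le_one (x : ℝ) : |fejer x| ≤ 1 := by
  have h1 := Real.one_sub_sq_div_two_le_cos (x := x)
  have h2 := Real.cos_le_one x
  rw [fejer, abs_of_nonneg (div_nonneg (by linarith) (sq_nonneg x))]
  exact div_le_one_of_le₀ (by linarith) (sq_nonneg x)

theorem tendsto_fejer : Tendsto fejer (𝓝[≠] 0) (𝓝 1) := by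
  have h : ∀ x : ℝ, x ≠ 0 → fejer x = Real.sinc (x / 2) ^ 2 := by
    intro x hx
    rw [Real.sinc_of_ne_zero (by simpa using hx), fejer, div_pow]
    have := Real.cos_sq' (x / 2)
    have h2 := Real.cos_two_mul (x / 2)
    rw [mul_div_cancel₀ x two_ne_zero] at h2
    rw [h2, this]
    field_simp
    ring
  have hc : Continuous fun x : ℝ => Real.sinc (x / 2) ^ 2 :=
    (Real.continuous_sinc.comp (by fun_prop)).pow 2
  have h0 : Tendsto (fun x : ℝ => Real.sinc (x / 2) ^ 2) (𝓝 0) (𝓝 1) := by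
    have := hc.tendsto 0
    simpa using this
  refine (h0.mono_left nhdsWithin_le_nhds).congr' ?_
  filter_upwards [self_mem_nhdsWithin] with x hx
  exact (h x hx).symm

theorem integrableOn_mul_fejer {a : ℝ → ℝ}
    (ha : IntegrableOn (fun t => a t / (1 + t ^ 2)) (Set.Ioi 0)) {s : ℝ} (hs : 0 < s) :
    IntegrableOn (fun t => a t * fejer (s * t)) (Set.Ioi 0) := by
  refine ((integrableOn_mul_one_sub_cos ha s).const_mul (2 / s ^ 2)).congr ?_
  filter_upwards with t
  rw [fejer, mul_pow]
  field_simp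

/-- The second difference divided by `s²` is the symbol of the damped kernel. Unlike `a` itself,
that kernel is integrable on `(0, ∞)` under the present assumption, so its cosine transform is an
honest integral. -/
theorem fejer_symbol_nonneg (a₀ : ℝ) {a : ℝ → ℝ}
    (ha : IntegrableOn (fun t => a t / (1 + t ^ 2)) (Set.Ioi 0))
    (hU : ∀ y, ∀ c < 0, ∀ᶠ η in 𝓝[>] (0 : ℝ),
      c ≤ a₀ + ∫ t in Set.Ioi 0, Real.exp (-(η * t)) * (a t * Real.cos (y * t)))
    (y : ℝ) {s : ℝ} (hs : 0 < s) :
    0 ≤ a₀ + ∫ t in Set.Ioi 0, a t * fejer (s * t) * Real.cos (y * t) := by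
  have h := secondDiff_nonneg_of_abel a₀ ha hU y hs
  have h1 : ∀ t, a t * fejer (s * t) * Real.cos (y * t)
      = 2 / s ^ 2 * (a t * Real.cos (y * t) * ((1 - Real.cos (s * t)) / t ^ 2)) := by
    intro t
    rw [fejer, mul_pow]
    field_simp
  simp_rw [h1]
  rw [integral_const_mul]
  have h2 : a₀ + 2 / s ^ 2 * ∫ t in Set.Ioi 0,
      a t * Real.cos (y * t) * ((1 - Real.cos (s * t)) / t ^ 2)
      = secondDiff a₀ (fun t => a t * Real.cos (y * t)) s / s ^ 2 := by
    rw [secondDiff]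
    field_simp
  rw [h2]
  positivity

end Convexity

/-! ### From a nonnegative symbol to a kernel of positive type. -/

section PositiveDefinite

/-- Plancherel: translation by `r` is multiplication by a character, whose real part is the cosine.
-/
theorem re_integral_inner_translate (f : 𝓢(ℝ, ℂ)) (r : ℝ) :
    (∫ t, inner ℂ (f (t - r)) (f t)).re
      = ∫ y, Real.cos (2 * Real.pi * r * y) * ‖𝓕 f y‖ ^ 2 := by
  have h := SchwartzMap.integral_inner_fourier_fourier (f.compSubConstCLM ℂ r) f
  simp only [SchwartzMap.compSubConstCLM_apply] at h
  rw [← h]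
  have hF : ∀ y, 𝓕 (f.compSubConstCLM ℂ r) y
      = Complex.exp (↑(-(2 * Real.pi * r * y)) * Complex.I) * 𝓕 f y := by
    intro y
    have h1 := VectorFourier.fourierIntegral_comp_add_right (E := ℂ) Real.fourierChar volume
      (innerₗ ℝ) (f : ℝ → ℂ) (-r)
    have h2 := congrFun h1 y
    rw [SchwartzMap.fourier_coe, SchwartzMap.fourier_coe, Real.fourier_eq, Real.fourier_eq]
    simp only [VectorFourier.fourierIntegral, Function.comp_def, innerₗ_apply_apply,
      ← sub_eq_add_neg] at h2
    simp only [SchwartzMap.compSubConstCLM_apply]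
    rw [h2, Circle.smul_def, Real.fourierChar_apply, smul_eq_mul]
    congr 3
    simp
    ring
  have hint : Integrable fun y => inner ℂ (𝓕 (f.compSubConstCLM ℂ r) y) (𝓕 f y) := by
    have := L2.integrable_inner (𝕜 := ℂ) ((𝓕 (f.compSubConstCLM ℂ r)).toLp 2) ((𝓕 f).toLp 2)
    refine this.congr ?_
    filter_upwards [(𝓕 (f.compSubConstCLM ℂ r)).coeFn_toLp 2, (𝓕 f).coeFn_toLp 2] with y h1 h2
    rw [h1, h2]
  have := integral_re (𝕜 := ℂ) hint
  simp only [RCLike.re_eq_complex_re] at this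
  rw [← this]
  refine integral_congr_ae (Eventually.of_forall fun y => ?_)
  simp only [hF, RCLike.inner_apply, map_mul]
  have h3 : 𝓕 f y * ((starRingEnd ℂ) (Complex.exp (↑(-(2 * Real.pi * r * y)) * Complex.I))
      * (starRingEnd ℂ) (𝓕 f y))
      = ((‖𝓕 f y‖ ^ 2 : ℝ) : ℂ) * Complex.exp (↑(2 * Real.pi * r * y) * Complex.I) := by
    rw [← Complex.exp_conj, mul_left_comm, Complex.mul_conj, Complex.normSq_eq_norm_sq, map_mul,
      Complex.conj_ofReal, Complex.conj_I, mul_comm]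
    congr 2
    push_cast
    ring
  rw [h3, Complex.re_ofReal_mul, Complex.exp_ofReal_mul_I_re, mul_comm]

theorem integrable_norm_sq_fourier (f : 𝓢(ℝ, ℂ)) : Integrable fun y => ‖𝓕 f y‖ ^ 2 :=
  ((𝓕 f).memLp 2).integrable_norm_pow two_ne_zero

/-- By Fubini the form is the integral of `‖𝓕 f y‖²` against the symbol at `2πy`. -/
theorem schwartz_form_nonneg {a₀ : ℝ} {k : ℝ → ℝ} (hk : IntegrableOn k (Set.Ioi 0))
    (hQ : ∀ y, 0 ≤ a₀ + ∫ t in Set.Ioi 0, k t * Real.cos (y * t)) (f : 𝓢(ℝ, ℂ)) :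
    0 ≤ a₀ * (∫ y, ‖𝓕 f y‖ ^ 2)
      + ∫ r in Set.Ioi 0, k r * ∫ y, Real.cos (2 * Real.pi * r * y) * ‖𝓕 f y‖ ^ 2 := by
  have hf := integrable_norm_sq_fourier f
  have hF : Integrable (fun p : ℝ × ℝ =>
      (k p.1 * ‖𝓕 f p.2‖ ^ 2) * Real.cos (2 * Real.pi * p.1 * p.2))
      ((volume.restrict (Set.Ioi 0)).prod volume) := by
    refine (hk.mul_prod hf).mul_bdd (c := 1) (Continuous.aestronglyMeasurable (by fun_prop)) ?_
    filter_upwards with p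
    exact Real.abs_cos_le_one _
  have h1 : ∀ r, k r * ∫ y, Real.cos (2 * Real.pi * r * y) * ‖𝓕 f y‖ ^ 2
      = ∫ y, (k r * ‖𝓕 f y‖ ^ 2) * Real.cos (2 * Real.pi * r * y) := fun r => by
    rw [← integral_const_mul]
    congr 1
    ext y
    ring
  simp_rw [h1]
  rw [integral_integral_swap hF, ← integral_const_mul,
    ← integral_add (hf.const_mul _) hF.integral_prod_right]
  refine integral_nonneg fun y => ?_
  have h2 : ∀ r, (k r * ‖𝓕 f y‖ ^ 2) * Real.cos (2 * Real.pi * r * y)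
      = (k r * Real.cos (2 * Real.pi * y * r)) * ‖𝓕 f y‖ ^ 2 := fun r => by
    rw [mul_right_comm (2 * Real.pi) r y]
    ring
  simp_rw [h2]
  rw [integral_mul_const, ← add_mul]
  exact mul_nonneg (hQ _) (by positivity)

/-- Translation on `L²`. -/
def translateL2 (r : ℝ) : Lp ℂ 2 (volume : Measure ℝ) →ₗᵢ[ℂ] Lp ℂ 2 (volume : Measure ℝ) :=
  Lp.compMeasurePreservingₗᵢ ℂ (fun t => t - r) (measurePreserving_sub_right volume r)

theorem inner_translateL2 (g : Lp ℂ 2 (volume : Measure ℝ)) (r : ℝ) :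
    inner ℂ (translateL2 r g) g = ∫ t, inner ℂ (g (t - r)) (g t) := by
  rw [L2.inner_def]
  refine integral_congr_ae ?_
  filter_upwards [Lp.coeFn_compMeasurePreserving g (measurePreserving_sub_right volume r)]
    with t ht
  have : (translateL2 r g : ℝ → ℂ) t = g (t - r) := ht
  rw [this]

theorem inner_translateL2_toLp (f : 𝓢(ℝ, ℂ)) (r : ℝ) :
    (inner ℂ (translateL2 r (f.toLp 2)) (f.toLp 2)).re
      = ∫ y, Real.cos (2 * Real.pi * r * y) * ‖𝓕 f y‖ ^ 2 := by
  rw [inner_translateL2, ← re_integral_inner_translate]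
  congr 1
  refine integral_congr_ae ?_
  have h := f.coeFn_toLp 2 (volume : Measure ℝ)
  filter_upwards [h, (measurePreserving_sub_right volume r).quasiMeasurePreserving.ae h]
    with t h1 h2
  rw [h1, h2]

theorem norm_sq_toLp (f : 𝓢(ℝ, ℂ)) :
    ‖f.toLp 2 (volume : Measure ℝ)‖ ^ 2 = ∫ y, ‖𝓕 f y‖ ^ 2 := by
  have h := inner_translateL2_toLp f 0
  have h0 : translateL2 0 (f.toLp 2) = f.toLp 2 := by
    refine Lp.ext ?_
    have := Lp.coeFn_compMeasurePreserving (f.toLp 2 (volume : Measure ℝ))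
      (measurePreserving_sub_right volume 0)
    filter_upwards [this] with t ht
    have h2 : (translateL2 0 (f.toLp 2) : ℝ → ℂ) t = f.toLp 2 (volume : Measure ℝ) (t - 0) := ht
    rw [h2, sub_zero]
  rw [h0, inner_self_eq_norm_sq_to_K] at h
  simp only [mul_zero, zero_mul, Real.cos_zero, one_mul] at h
  rw [← h]
  exact (Complex.ofReal_re _).symm.trans (by push_cast; rfl)

/-- Density of Schwartz functions, with the Cauchy-Schwarz bound as majorant. The extension to `L²`
is needed because the form will be applied to functions cut off sharply at `0` and `X`. -/
theorem l2_form_nonneg {a₀ : ℝ} {k : ℝ → ℝ} (hk : IntegrableOn k (Set.Ioi 0))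
    (hQ : ∀ y, 0 ≤ a₀ + ∫ t in Set.Ioi 0, k t * Real.cos (y * t))
    (g : Lp ℂ 2 (volume : Measure ℝ)) :
    0 ≤ a₀ * ‖g‖ ^ 2 + ∫ r in Set.Ioi 0, k r * (inner ℂ (translateL2 r g) g).re := by
  have hd := (SchwartzMap.denseRange_toLpCLM (F := ℂ) (E := ℝ) (p := 2) (μ := volume)
    ENNReal.ofNat_ne_top) g
  obtain ⟨x, hx, hlim⟩ := mem_closure_iff_seq_limit.1 hd
  choose f hf using hx
  have hf' : ∀ n, (f n).toLp 2 = x n := fun n => hf n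
  obtain ⟨C, hC⟩ := hlim.norm.bddAbove_range
  have hC' : ∀ n, ‖x n‖ ≤ C := fun n => hC ⟨n, rfl⟩
  have hlim2 : Tendsto (fun n => ∫ r in Set.Ioi 0, k r * (inner ℂ (translateL2 r (x n)) (x n)).re)
      atTop (𝓝 (∫ r in Set.Ioi 0, k r * (inner ℂ (translateL2 r g) g).re)) := by
    refine tendsto_integral_of_dominated_convergence (fun r => ‖k r‖ * (C * C)) (fun n => ?_)
      (hk.norm.mul_const _) (fun n => ?_) ?_
    · refine hk.aestronglyMeasurable.mul ?_
      -- Measurability in `r` is read off the Fourier side, where the expression is continuous.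
      simp_rw [← hf' n, inner_translateL2_toLp]
      refine (Continuous.aestronglyMeasurable ?_)
      refine continuous_of_dominated (bound := fun y => ‖𝓕 (f n) y‖ ^ 2) (fun r => ?_) (fun r => ?_)
        (integrable_norm_sq_fourier _) ?_
      · exact (Continuous.aestronglyMeasurable (by fun_prop))
      · filter_upwards with y
        rw [norm_mul, Real.norm_of_nonneg (by positivity : 0 ≤ ‖𝓕 (f n) y‖ ^ 2)]
        exact mul_le_of_le_one_left (by positivity) (Real.abs_cos_le_one _)
      · filter_upwards with y
        fun_prop
    · filter_upwards with r
      rw [norm_mul]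
      refine mul_le_mul_of_nonneg_left ?_ (norm_nonneg _)
      refine (Complex.abs_re_le_norm _).trans ((norm_inner_le_norm _ _).trans ?_)
      rw [LinearIsometry.norm_map]
      exact mul_le_mul (hC' n) (hC' n) (norm_nonneg _) ((norm_nonneg _).trans (hC' n))
    · filter_upwards with r
      refine Tendsto.const_mul _ ?_
      refine (Complex.continuous_re.tendsto _).comp ?_
      exact (((translateL2 r).continuous.tendsto g).comp hlim).inner hlim
  have hlim3 := ((hlim.norm.pow 2).const_mul a₀).add hlim2
  refine ge_of_tendsto' hlim3 fun n => ?_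
  have := schwartz_form_nonneg hk hQ (f n)
  simp_rw [← inner_translateL2_toLp, ← norm_sq_toLp, hf' n] at this
  exact this

/-- The truncated autocorrelation `∫_r^X w(t) w(t - r) dt`. -/
def autocorr (w : ℝ → ℝ) (X r : ℝ) : ℝ := ∫ t in Set.Ioc r X, w t * w (t - r)

/-- The form is evaluated at `w` restricted to `(0, X]`. Its inner products with its own translates
are the truncated autocorrelations, which vanish for `r ≥ X`. -/
theorem autocorr_form_nonneg {a₀ : ℝ} {k : ℝ → ℝ} (hk : IntegrableOn k (Set.Ioi 0))
    (hQ : ∀ y, 0 ≤ a₀ + ∫ t in Set.Ioi 0, k t * Real.cos (y * t))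
    {w : ℝ → ℝ} (hw : Continuous w) (X : ℝ) :
    0 ≤ a₀ * autocorr w X 0 + ∫ r in Set.Ioc 0 X, k r * autocorr w X r := by
  obtain ⟨C, hC⟩ := (isCompact_Icc (a := (0 : ℝ)) (b := X)).exists_bound_of_continuousOn
    hw.continuousOn
  have hmem : MemLp ((Set.Ioc 0 X).indicator fun t => (w t : ℂ)) 2 volume := by
    rw [memLp_indicator_iff_restrict measurableSet_Ioc]
    refine MemLp.of_bound (Continuous.aestronglyMeasurable (by fun_prop)) C ?_
    filter_upwards [ae_restrict_mem measurableSet_Ioc] with t ht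
    rw [Complex.norm_real]
    exact hC t ⟨ht.1.le, ht.2⟩
  set g := hmem.toLp with hg
  have hgc := hmem.coeFn_toLp
  have hinner : ∀ r, 0 ≤ r → (inner ℂ (translateL2 r g) g).re = autocorr w X r := by
    intro r hr
    have h1 : ∫ t, inner ℂ (g (t - r)) (g t)
        = ∫ t, (Set.Ioc r X).indicator (fun t => ((w t * w (t - r) : ℝ) : ℂ)) t := by
      refine integral_congr_ae ?_
      filter_upwards [hgc, (measurePreserving_sub_right volume r).quasiMeasurePreserving.ae hgc]
        with t h1 h2
      rw [h1, h2]
      by_cases ht : t ∈ Set.Ioc r X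
      · have ha : t ∈ Set.Ioc 0 X := ⟨hr.trans_lt ht.1, ht.2⟩
        have hb : t - r ∈ Set.Ioc 0 X := ⟨sub_pos.2 ht.1, by linarith [ht.2]⟩
        rw [Set.indicator_of_mem ha, Set.indicator_of_mem hb, Set.indicator_of_mem ht]
        simp
      · rw [Set.indicator_of_notMem ht]
        by_cases ha : t ∈ Set.Ioc 0 X
        · have hb : t - r ∉ Set.Ioc 0 X := fun hb => ht ⟨sub_pos.1 hb.1, ha.2⟩
          rw [Set.indicator_of_notMem hb, inner_zero_left]
        · rw [Set.indicator_of_notMem ha, inner_zero_right]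
    rw [inner_translateL2, h1, integral_indicator measurableSet_Ioc, autocorr]
    exact (congrArg Complex.re (integral_ofReal (𝕜 := ℂ))).trans (Complex.ofReal_re _)
  have hnorm : ‖g‖ ^ 2 = autocorr w X 0 := by
    have h0 : translateL2 0 g = g := by
      refine Lp.ext ?_
      have := Lp.coeFn_compMeasurePreserving g (measurePreserving_sub_right volume 0)
      filter_upwards [this] with t ht
      have h2 : (translateL2 0 g : ℝ → ℂ) t = g (t - 0) := ht
      rw [h2, sub_zero]
    rw [← hinner 0 le_rfl, h0, inner_self_eq_norm_sq_to_K]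
    exact (Complex.ofReal_re _).symm.trans (by push_cast; rfl)
  have h := l2_form_nonneg hk hQ g
  rw [hnorm, setIntegral_congr_fun measurableSet_Ioi
    (g := fun r => k r * autocorr w X r) (fun r hr => by
      simp only [hinner r (Set.mem_Ioi.1 hr).le])] at h
  rw [setIntegral_eq_of_subset_of_forall_sdiff_eq_zero measurableSet_Ioi
    (Set.Ioc_subset_Ioi_self : Set.Ioc 0 X ⊆ Set.Ioi 0)] at h
  · exact h
  · intro r hr
    have : X ≤ r := by
      by_contra! hlt
      exact hr.2 ⟨hr.1, hlt.le⟩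
    rw [autocorr, Set.Ioc_eq_empty (not_lt.2 this)]
    simp

theorem continuous_autocorr {w : ℝ → ℝ} (hw : Continuous w) (X : ℝ) :
    ContinuousOn (autocorr w X) (Set.Iic X) := by
  have h : Continuous fun p : ℝ × ℝ => ∫ t in p.1..X, w t * w (t - p.2) := by
    have h1 : ∀ p : ℝ × ℝ, ∫ t in p.1..X, w t * w (t - p.2)
        = -∫ t in X..p.1, w t * w (t - p.2) := fun p => intervalIntegral.integral_symm _ _
    simp_rw [h1]
    exact (intervalIntegral.continuous_parametric_intervalIntegral_of_continuous
      (f := fun (p : ℝ × ℝ) t => w t * w (t - p.2)) (by fun_prop) continuous_fst).neg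
  have h2 : Continuous fun r : ℝ => ∫ t in r..X, w t * w (t - r) :=
    h.comp (continuous_id.prodMk continuous_id)
  refine h2.continuousOn.congr fun r hr => ?_
  exact (intervalIntegral.integral_of_le hr).symm

/-- A kernel whose Abel means have nonnegative lower limits is of positive type. -/
theorem energy_nonneg {a₀ : ℝ} {a : ℝ → ℝ}
    (ha : IntegrableOn (fun t => a t / (1 + t ^ 2)) (Set.Ioi 0))
    (ha' : ∀ X, IntegrableOn a (Set.Ioc 0 X))
    (hU : ∀ y, ∀ c < 0, ∀ᶠ η in 𝓝[>] (0 : ℝ),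
      c ≤ a₀ + ∫ t in Set.Ioi 0, Real.exp (-(η * t)) * (a t * Real.cos (y * t)))
    {w : ℝ → ℝ} (hw : Continuous w) (X : ℝ) :
    0 ≤ ∫ t in Set.Ioc 0 X, w t * (a₀ * w t + volterraConv a w t) := by
  have hR : IntegrableOn (fun r => a r * autocorr w X r) (Set.Ioc 0 X) := by
    obtain ⟨C, hC⟩ := (isCompact_Icc (a := (0 : ℝ)) (b := X)).exists_bound_of_continuousOn
      ((continuous_autocorr hw X).mono fun r hr => hr.2)
    refine (ha' X).mul_bdd (c := C) ?_ ?_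
    · exact ((continuous_autocorr hw X).mono fun r hr => hr.2).aestronglyMeasurable
        measurableSet_Ioc
    · filter_upwards [ae_restrict_mem measurableSet_Ioc] with r hr
      exact hC r ⟨hr.1.le, hr.2⟩
  -- Exchanging the order of integration turns the energy into the pairing of the kernel with the
  -- autocorrelation.
  have heq : ∫ t in Set.Ioc 0 X, w t * (a₀ * w t + volterraConv a w t)
      = a₀ * autocorr w X 0 + ∫ r in Set.Ioc 0 X, a r * autocorr w X r := by
    have hcont : ∀ {g : ℝ → ℝ}, Continuous g → IntegrableOn g (Set.Ioc 0 X) := fun hg =>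
      (hg.continuousOn.integrableOn_compact isCompact_Icc).mono_set Set.Ioc_subset_Icc_self
    have hsw := integral_triangle_swap (ha' X) (g := fun r t => w t * w (t - r)) (by fun_prop)
    simp only [smul_eq_mul] at hsw
    simp only [autocorr, sub_zero]
    rw [← hsw, ← integral_const_mul, ← integral_add]
    · refine setIntegral_congr_fun measurableSet_Ioc fun t _ => ?_
      simp only [volterraConv, smul_eq_mul]
      rw [mul_add, ← integral_const_mul]
      congr 1
      · ring
      · congr 1
        ext r
        ring
    · exact hcont (by fun_prop)
    · have := hcont (hw.mul (continuous_volterraConv ha' hw))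
      refine this.congr_fun (fun t _ => ?_) measurableSet_Ioc
      simp only [Pi.mul_apply, volterraConv, smul_eq_mul]
      rw [← integral_const_mul (w t)]
      congr 1
      ext r
      ring
  rw [heq]
  -- The Fejér factors are bounded by one and tend to one, and only the values of `a` on `(0, X]`
  -- matter; so the damping can be removed even if `a` is not integrable at infinity.
  have hlim : Tendsto (fun s : ℝ => a₀ * autocorr w X 0
      + ∫ r in Set.Ioc 0 X, (a r * fejer (s * r)) * autocorr w X r) (𝓝[>] 0)
      (𝓝 (a₀ * autocorr w X 0 + ∫ r in Set.Ioc 0 X, a r * autocorr w X r)) := by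
    refine Tendsto.const_add _ ?_
    have hmul : ∀ s r, (a r * fejer (s * r)) * autocorr w X r
        = (a r * autocorr w X r) * fejer (s * r) := fun s r => by ring
    simp_rw [hmul]
    refine tendsto_integral_filter_of_dominated_convergence (fun r => ‖a r * autocorr w X r‖)
      ?_ ?_ hR.norm ?_
    · filter_upwards with s
      exact hR.aestronglyMeasurable.mul
        (measurable_fejer.comp (by fun_prop)).aestronglyMeasurable
    · filter_upwards with s
      filter_upwards with r
      rw [norm_mul]
      exact mul_le_of_le_one_right (norm_nonneg _) (abs_fejer_le_one _)
    · filter_upwards [ae_restrict_mem measurableSet_Ioc] with r hr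
      have h1 : Tendsto (fun s : ℝ => s * r) (𝓝[>] 0) (𝓝[≠] 0) := by
        refine tendsto_nhdsWithin_iff.2 ⟨?_, ?_⟩
        · have : ContinuousAt (fun s : ℝ => s * r) 0 := by fun_prop
          have := this.tendsto
          rw [zero_mul] at this
          exact this.mono_left nhdsWithin_le_nhds
        · filter_upwards [self_mem_nhdsWithin] with s hs
          exact (mul_pos hs hr.1).ne'
      simpa using (tendsto_fejer.comp h1).const_mul (a r * autocorr w X r)
  refine ge_of_tendsto hlim ?_
  filter_upwards [self_mem_nhdsWithin] with s hs
  exact autocorr_form_nonneg (integrableOn_mul_fejer ha hs)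
    (fun y => fejer_symbol_nonneg a₀ ha hU y hs) hw X

end PositiveDefinite

/-! ### Consequences of the hypotheses on the kernel; the bound `|w| ≤ 1`. -/

section KernelAssumptions

theorem integrableOn_Ioc_of_kernel {a : ℝ → ℝ} (ha_int : IntegrableOn a (Set.Ioo 0 1))
    (ha_bdd : ∀ ε : ℝ, 0 < ε → MemLp a ⊤ (volume.restrict (Set.Ici ε))) (X : ℝ) :
    IntegrableOn a (Set.Ioc 0 X) := by
  have h1 : IntegrableOn a (Set.Icc 1 X) := by
    have h := (ha_bdd 1 one_pos).mono_measure (Measure.restrict_mono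
      (Set.Icc_subset_Ici_self : Set.Icc 1 X ⊆ Set.Ici 1) (le_refl volume))
    have : IsFiniteMeasure (volume.restrict (Set.Icc (1 : ℝ) X)) := inferInstance
    exact h.integrable le_top
  refine (ha_int.union h1).mono_set fun t ht => ?_
  rcases lt_or_ge t 1 with h | h
  · exact Or.inl ⟨ht.1, h⟩
  · exact Or.inr ⟨h, ht.2⟩

theorem integrableOn_div_one_add_sq_of_kernel {a : ℝ → ℝ}
    (ha_int : IntegrableOn a (Set.Ioo 0 1))
    (ha_bdd : ∀ ε : ℝ, 0 < ε → MemLp a ⊤ (volume.restrict (Set.Ici ε))) :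
    IntegrableOn (fun t => a t / (1 + t ^ 2)) (Set.Ioi 0) := by
  have hc : Continuous fun t : ℝ => (1 + t ^ 2)⁻¹ :=
    Continuous.inv₀ (by fun_prop) fun t => by positivity
  have hb : ∀ t : ℝ, ‖(1 + t ^ 2)⁻¹‖ ≤ 1 := fun t => by
    rw [Real.norm_of_nonneg (by positivity)]
    exact inv_le_one_of_one_le₀ (by nlinarith [sq_nonneg t])
  have h1 : IntegrableOn (fun t => a t / (1 + t ^ 2)) (Set.Ioo 0 1) := by
    simp_rw [div_eq_mul_inv]
    exact ha_int.mul_bdd hc.aestronglyMeasurable (Eventually.of_forall hb)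
  have h2 : IntegrableOn (fun t => a t / (1 + t ^ 2)) (Set.Ici 1) := by
    simp_rw [div_eq_mul_inv]
    have hfin := (ha_bdd 1 one_pos).2
    rw [eLpNorm_exponent_top] at hfin
    refine integrable_inv_one_add_sq.integrableOn.bdd_mul
      (c := (eLpNormEssSup a (volume.restrict (Set.Ici 1))).toReal) (ha_bdd 1 one_pos).1 ?_
    filter_upwards [ae_le_eLpNormEssSup (f := a) (μ := volume.restrict (Set.Ici 1))] with t ht
    rw [← toReal_enorm]
    exact ENNReal.toReal_mono hfin.ne ht
  refine (h1.union h2).mono_set fun t ht => ?_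
  rcases lt_or_ge t 1 with h | h
  · exact Or.inl ⟨ht, h⟩
  · exact Or.inr h

theorem exp_neg_mul_le {h : ℝ} (hh : 0 < h) (t : ℝ) (ht : 0 < t) :
    Real.exp (-(h * t)) ≤ (1 + 2 / h ^ 2) / (1 + t ^ 2) := by
  have h1 := Real.quadratic_le_exp_of_nonneg (mul_pos hh ht).le
  have h2 : 0 < h * t := mul_pos hh ht
  rw [Real.exp_neg, ← one_div, div_le_div_iff₀ (Real.exp_pos _) (by positivity), one_mul]
  calc 1 + t ^ 2 ≤ (1 + 2 / h ^ 2) * (1 + (h * t) ^ 2 / 2) := by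
        have h3 : 2 / h ^ 2 * ((h * t) ^ 2 / 2) = t ^ 2 := by
          field_simp
        have h4 : 0 ≤ 2 / h ^ 2 := by positivity
        nlinarith [sq_nonneg (h * t)]
    _ ≤ (1 + 2 / h ^ 2) * Real.exp (h * t) := by
        gcongr
        linarith

theorem re_laplaceTransform {a : ℝ → ℝ}
    (ha : IntegrableOn (fun t => a t / (1 + t ^ 2)) (Set.Ioi 0)) (y : ℝ) {h : ℝ} (hh : 0 < h) :
    (laplaceTransform a (Complex.I * (y : ℂ) + (h : ℂ))).re
      = ∫ t in Set.Ioi 0, Real.exp (-(h * t)) * (a t * Real.cos (y * t)) := by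
  have h0 : IntegrableOn (fun t => a t * Real.exp (-(h * t))) (Set.Ioi 0) := by
    refine integrableOn_mul_of_abs_le ha (C := 1 + 2 / h ^ 2)
      (Continuous.aestronglyMeasurable (by fun_prop)) fun t ht => ?_
    rw [abs_of_pos (Real.exp_pos _)]
    exact exp_neg_mul_le hh t ht
  have hint : IntegrableOn (fun t : ℝ =>
      Complex.exp (-((Complex.I * (y : ℂ) + (h : ℂ)) * (t : ℂ))) * (a t : ℂ)) (Set.Ioi 0) := by
    refine h0.norm.mono' ?_ ?_
    · refine AEStronglyMeasurable.mul (Continuous.aestronglyMeasurable (by fun_prop)) ?_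
      exact Complex.continuous_ofReal.comp_aestronglyMeasurable
        (aestronglyMeasurable_of_div_one_add_sq ha)
    · filter_upwards with t
      rw [norm_mul, norm_mul, Complex.norm_exp, Complex.norm_real, mul_comm,
        Real.norm_of_nonneg (Real.exp_pos _).le]
      simp
  have := integral_re (𝕜 := ℂ) hint
  simp only [RCLike.re_eq_complex_re] at this
  rw [laplaceTransform, ← this]
  refine setIntegral_congr_fun measurableSet_Ioi fun t _ => ?_
  simp only [Complex.re_mul_ofReal, Complex.exp_re]
  simp
  ring

/-- The lower limit is taken in `EReal`, so Abel means tending to `+∞` are covered as well. -/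
theorem abel_of_liminf {a₀ : ℝ} {a : ℝ → ℝ}
    (ha : IntegrableOn (fun t => a t / (1 + t ^ 2)) (Set.Ioi 0))
    (hpos : ∀ y : ℝ, 0 ≤ liminf
      (fun h : ℝ => ((a₀ + (laplaceTransform a
        (Complex.I * (y : ℂ) + (h : ℂ))).re : ℝ) : EReal)) (𝓝[>] (0 : ℝ))) :
    ∀ y, ∀ c < 0, ∀ᶠ η in 𝓝[>] (0 : ℝ),
      c ≤ a₀ + ∫ t in Set.Ioi 0, Real.exp (-(η * t)) * (a t * Real.cos (y * t)) := by
  intro y c hc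
  have h1 : (c : EReal) < liminf (fun h : ℝ => ((a₀ + (laplaceTransform a
        (Complex.I * (y : ℂ) + (h : ℂ))).re : ℝ) : EReal)) (𝓝[>] (0 : ℝ)) :=
    lt_of_lt_of_le (by exact_mod_cast hc) (hpos y)
  filter_upwards [eventually_lt_of_lt_liminf h1, self_mem_nhdsWithin] with h hlt hh
  rw [← re_laplaceTransform ha y hh]
  exact (EReal.coe_lt_coe_iff.1 hlt).le

/-- For a kernel of positive type, the scalar solutions are bounded by one. -/
theorem abs_volterraSol_le_one {a₀ : ℝ} {a : ℝ → ℝ}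
    (ha : ∀ X, IntegrableOn a (Set.Ioc 0 X))
    (henergy : ∀ w : ℝ → ℝ, Continuous w → ∀ X,
      0 ≤ ∫ t in Set.Ioc 0 X, w t * (a₀ * w t + volterraConv a w t))
    {z : ℝ} (hz : 0 ≤ z) (t : ℝ) : |volterraSol (integratedKernel a₀ a) z t| ≤ 1 := by
  have hA := integrableOn_integratedKernel a₀ ha
  set w := volterraSol (integratedKernel a₀ a) z with hw
  have hwc : Continuous w := continuous_volterraSol_right hA z
  have heq : ∀ s, w s = 1 - z * volterraConv (integratedKernel a₀ a) w s := volterraSol_eq hA z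
  rcases le_total t 0 with ht | ht
  · rw [heq, volterraConv_of_nonpos _ _ ht]
    simp
  set v : ℝ → ℝ := fun s => a₀ * w s + volterraConv a w s with hv
  have hvc : Continuous v := (continuous_const.mul hwc).add (continuous_volterraConv ha hwc)
  have heq2 : ∀ s, 0 ≤ s → w s = 1 - z * ∫ r in (0 : ℝ)..s, v r := by
    intro s hs
    rw [heq, volterraConv_integratedKernel a₀ ha hwc, intervalIntegral.integral_of_le hs]
    simp [hv]
  -- `f` equals `w` on `[0, ∞)` and is differentiable on the whole line, which avoids one-sided
  -- derivatives at `0`. Its square has derivative `-2z f v`, and the integral of `f v` is the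
  -- energy.
  let f : ℝ → ℝ := fun s => 1 - z * ∫ r in (0 : ℝ)..s, v r
  have hd : ∀ s, HasDerivAt f (-(z * v s)) s := fun s => by
    have := ((intervalIntegral.integral_hasDerivAt_right (hvc.intervalIntegrable 0 s)
      (hvc.stronglyMeasurableAtFilter _ _) hvc.continuousAt).const_mul z).const_sub 1
    exact this
  have hfc : Continuous f := continuous_iff_continuousAt.2 fun s => (hd s).continuousAt
  have hint := intervalIntegral.integral_eq_sub_of_hasDerivAt (a := 0) (b := t)
    (f := fun s => f s ^ 2) (f' := fun s => (-2 * z) * (f s * v s)) (fun s _ => by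
      have := (hd s).pow 2
      convert! this using 1
      push_cast
      ring) (Continuous.intervalIntegrable (by fun_prop) _ _)
  rw [intervalIntegral.integral_const_mul, intervalIntegral.integral_of_le ht] at hint
  have hE : ∫ s in Set.Ioc 0 t, f s * v s
      = ∫ s in Set.Ioc 0 t, w s * (a₀ * w s + volterraConv a w s) :=
    setIntegral_congr_fun measurableSet_Ioc fun s hs => by
      simp only [hv, f]
      rw [← heq2 s hs.1.le]
  rw [hE] at hint
  have h1 := mul_nonneg hz (henergy w hwc t)
  have hf0 : f 0 = 1 := by simp [f]
  have hft : w t = f t := heq2 t ht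
  rw [hft, ← sq_le_one_iff_abs_le_one]
  rw [hf0] at hint
  linarith

end KernelAssumptions

/-! ### Potter's bounds and convergence of the rescaled kernels. -/

section RegularVariation

/-- Local boundedness of the increments of a function whose increments converge at infinity
(a consequence of Baire's theorem). -/
theorem exists_local_bound_increments {f : ℝ → ℝ} {β N₀ : ℝ} (hf : ContinuousOn f (Set.Ioi N₀))
    (hlim : ∀ u, Tendsto (fun x => f (x + u) - f x) atTop (𝓝 (β * u))) :
    ∃ M N, ∀ x, N ≤ x → ∀ u ∈ Set.Icc (0 : ℝ) 1, |f (x + u) - f x| ≤ M := by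
  -- These closed sets exhaust the line, so by Baire one of them contains a ball. Both `x` and `x +
  -- u` must exceed `N₀ + n`, since `f` is controlled only to the right of `N₀`.
  let S : ℕ → Set ℝ := fun n => {u | ∀ x, N₀ + n < x → N₀ + n < x + u →
    |f (x + u) - f x - β * u| ≤ 1}
  have hclosed : ∀ n, IsClosed (S n) := by
    intro n
    have : S n = ⋂ x ∈ Set.Ioi (N₀ + n), {u | N₀ + n < x + u ∧ 1 < |f (x + u) - f x - β * u|}ᶜ := by
      ext u
      simp [S]
    rw [this]
    refine isClosed_biInter fun x _ => (IsOpen.isClosed_compl ?_)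
    have hopen : IsOpen {u : ℝ | N₀ + n < x + u} := isOpen_lt (by fun_prop) (by fun_prop)
    have hmaps : Set.MapsTo (fun u => x + u) {u : ℝ | N₀ + n < x + u} (Set.Ioi N₀) := by
      intro u hu
      have hu' : N₀ + n < x + u := hu
      have : (0 : ℝ) ≤ n := n.cast_nonneg
      exact Set.mem_Ioi.2 (by linarith)
    have hc : ContinuousOn (fun u => |f (x + u) - f x - β * u|) {u : ℝ | N₀ + n < x + u} :=
      (((hf.comp (by fun_prop) hmaps).sub continuousOn_const).sub (by fun_prop)).abs
    exact hc.isOpen_inter_preimage hopen (isOpen_Ioi (a := (1 : ℝ)))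
  have hunion : ⋃ n, S n = Set.univ := by
    rw [Set.eq_univ_iff_forall]
    intro u
    have h1 := (hlim u).sub_const (β * u)
    rw [sub_self] at h1
    have h2 := h1.abs
    rw [abs_zero] at h2
    obtain ⟨N, hN⟩ := eventually_atTop.1 (h2.eventually_le_const one_pos)
    obtain ⟨n, hn⟩ := exists_nat_ge (N - N₀)
    exact Set.mem_iUnion.2 ⟨n, fun x hx _ => hN x (by linarith)⟩
  obtain ⟨n, p, hp⟩ := nonempty_interior_of_iUnion_of_closed hclosed hunion
  obtain ⟨r, hr, hball⟩ := Metric.mem_nhds_iff.1 (mem_interior_iff_mem_nhds.1 hp)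
  set N := N₀ + n + |p| + 1 with hN
  -- Both `p` and `p + v` lie in the ball; subtracting their increments from the base point `x - p`
  -- leaves the increment of `f` over the short step `v`.
  have hstep : ∀ x, N ≤ x → ∀ v, 0 ≤ v → v < r → |f (x + v) - f x| ≤ 2 + |β| * r := by
    intro x hx v hv hvr
    have hp1 := le_abs_self p
    have hp2 := neg_abs_le p
    have h1 := hball (Metric.mem_ball_self hr) (x - p) (by linarith) (by linarith)
    have hm : p + v ∈ Metric.ball p r := by
      rw [Metric.mem_ball, Real.dist_eq, add_sub_cancel_left, abs_of_nonneg hv]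
      exact hvr
    have h2 := hball hm (x - p) (by linarith) (by linarith)
    rw [sub_add_cancel] at h1
    have he : x - p + (p + v) = x + v := by ring
    rw [he] at h2
    have h3 : |β * v| ≤ |β| * r := by
      rw [abs_mul, abs_of_nonneg hv]
      exact mul_le_mul_of_nonneg_left hvr.le (abs_nonneg _)
    rw [abs_le] at h1 h2 h3 ⊢
    constructor <;> nlinarith
  have hmany : ∀ x, N ≤ x → ∀ v, 0 ≤ v → v < r → ∀ j : ℕ,
      |f (x + j * v) - f x| ≤ j * (2 + |β| * r) := by
    intro x hx v hv hvr j
    induction j with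
    | zero => simp
    | succ j ih =>
      have hj : N ≤ x + j * v := by
        have : 0 ≤ j * v := by positivity
        linarith
      have h1 := hstep _ hj v hv hvr
      have he : x + j * v + v = x + ((j + 1 : ℕ) : ℝ) * v := by push_cast; ring
      rw [he] at h1
      rw [abs_le] at h1 ih ⊢
      push_cast at *
      constructor <;> nlinarith
  -- A step of length at most one is cut into `K` steps shorter than `r`.
  obtain ⟨K, hK⟩ := exists_nat_gt (1 / r)
  have hK0 : (0 : ℝ) < K := (div_pos one_pos hr).trans hK
  refine ⟨K * (2 + |β| * r), N, fun x hx u hu => ?_⟩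
  have h := hmany x hx (u / K) (div_nonneg hu.1 hK0.le) (by
    rw [div_lt_iff₀ hK0]
    rw [div_lt_iff₀ hr] at hK
    nlinarith [hu.2]) K
  rwa [mul_div_cancel₀ u hK0.ne'] at h

/-- Far out, every unit step deviates from `β` by at most `δ`, so integer steps accumulate an error
linear in `u`; the fractional part costs a constant by `exists_local_bound_increments`.
Exponentiated, this is Potter's bound. -/
theorem exists_linear_bound_increments {f : ℝ → ℝ} {β N₀ : ℝ} (hf : ContinuousOn f (Set.Ioi N₀))
    (hlim : ∀ u, Tendsto (fun x => f (x + u) - f x) atTop (𝓝 (β * u))) {δ : ℝ} (hδ : 0 < δ) :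
    ∃ M N, ∀ x, N ≤ x → ∀ u, 0 ≤ u → |f (x + u) - f x - β * u| ≤ δ * u + M := by
  obtain ⟨M, N, hMN⟩ := exists_local_bound_increments hf hlim
  have h1 := (hlim 1).sub_const (β * 1)
  rw [sub_self, mul_one] at h1
  have h2 := h1.abs
  rw [abs_zero] at h2
  obtain ⟨N', hN'⟩ := eventually_atTop.1 (h2.eventually_le_const hδ)
  refine ⟨M + |β|, max N N', fun x hx u hu => ?_⟩
  have hint : ∀ j : ℕ, |f (x + j) - f x - β * j| ≤ δ * j := by
    intro j
    induction j with
    | zero => simp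
    | succ j ih =>
      have h3 := hN' (x + j) (by
        have : (0 : ℝ) ≤ j := j.cast_nonneg
        linarith [(le_max_right N N').trans hx])
      rw [add_assoc] at h3
      rw [abs_le] at *
      push_cast
      constructor <;> linarith
  have hj := hint ⌊u⌋₊
  have hfl := Nat.floor_le hu
  have hlt := (Nat.lt_floor_add_one u).le
  have h3 := hMN (x + ⌊u⌋₊) (by
    have : (0 : ℝ) ≤ ⌊u⌋₊ := Nat.cast_nonneg _
    linarith [(le_max_left N N').trans hx]) (u - ⌊u⌋₊) ⟨by linarith, by linarith⟩
  have he : x + ⌊u⌋₊ + (u - ⌊u⌋₊) = x + u := by ring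
  rw [he] at h3
  have h4 : |β * (u - ⌊u⌋₊)| ≤ |β| := by
    rw [abs_mul, abs_of_nonneg (by linarith : (0 : ℝ) ≤ u - ⌊u⌋₊)]
    exact mul_le_of_le_one_right (abs_nonneg _) (by linarith)
  have h5 : δ * ⌊u⌋₊ ≤ δ * u := mul_le_mul_of_nonneg_left hfl hδ.le
  rw [abs_le] at *
  constructor <;> nlinarith

/-- Potter's bounds for continuous regularly varying functions. -/
theorem RegularlyVarying.potter {A : ℝ → ℝ} {β : ℝ} (hA : RegularlyVarying A β)
    (hc : ContinuousOn A (Set.Ici 0)) {δ : ℝ} (hδ : 0 < δ) :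
    ∃ C X, 0 < C ∧ 0 < X ∧ (∀ t, X ≤ t → 0 < A t) ∧ ∀ s T, X ≤ s → X ≤ T →
      A s / A T ≤ C * max ((s / T) ^ (β - δ)) ((s / T) ^ (β + δ)) := by
  obtain ⟨T₀, hT₀⟩ := eventually_atTop.1 hA.1
  set T₁ := max T₀ 1 with hT₁
  have hT₁0 : 0 < T₁ := lt_max_of_lt_right one_pos
  have hpos : ∀ t, T₁ ≤ t → 0 < A t := fun t ht => hT₀ t ((le_max_left _ _).trans ht)
  have hposexp : ∀ x, Real.log T₁ ≤ x → 0 < A (Real.exp x) := fun x hx =>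
    hpos _ ((Real.log_le_iff_le_exp hT₁0).1 hx)
  -- In logarithmic coordinates regular variation becomes convergence of increments.
  have hf : ContinuousOn (fun x => Real.log (A (Real.exp x))) (Set.Ioi (Real.log T₁)) := by
    refine ContinuousOn.log ?_ fun x hx => (hposexp x (Set.mem_Ioi.1 hx).le).ne'
    exact hc.comp (by fun_prop) fun x _ => (Real.exp_pos x).le
  have hlim : ∀ u, Tendsto (fun x => Real.log (A (Real.exp (x + u))) - Real.log (A (Real.exp x)))
      atTop (𝓝 (β * u)) := by
    intro u
    have h1 := (hA.2 (Real.exp u) (Real.exp_pos u)).comp Real.tendsto_exp_atTop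
    have h2 := h1.log (Real.rpow_pos_of_pos (Real.exp_pos u) β).ne'
    rw [Real.log_rpow (Real.exp_pos u), Real.log_exp] at h2
    refine h2.congr' ?_
    filter_upwards [eventually_ge_atTop (Real.log T₁), eventually_ge_atTop (Real.log T₁ - u)]
      with x hx hxu
    simp only [Function.comp]
    rw [← Real.exp_add, Real.log_div (hposexp _ (by linarith)).ne' (hposexp _ hx).ne']
  obtain ⟨M, N, hMN⟩ := exists_linear_bound_increments hf hlim hδ
  refine ⟨Real.exp M, max T₁ (Real.exp N), Real.exp_pos _, hT₁0.trans_le (le_max_left _ _),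
    fun t ht => hpos t ((le_max_left _ _).trans ht), fun s T hs hT => ?_⟩
  have hs0 : 0 < s := hT₁0.trans_le ((le_max_left _ _).trans hs)
  have hT0 : 0 < T := hT₁0.trans_le ((le_max_left _ _).trans hT)
  have hAs : 0 < A s := hpos s ((le_max_left _ _).trans hs)
  have hAT : 0 < A T := hpos T ((le_max_left _ _).trans hT)
  have hst : 0 < s / T := div_pos hs0 hT0
  have hNs : N ≤ Real.log s := (Real.le_log_iff_exp_le hs0).2 ((le_max_right _ _).trans hs)
  have hNT : N ≤ Real.log T := (Real.le_log_iff_exp_le hT0).2 ((le_max_right _ _).trans hT)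
  have hlogst : Real.log (s / T) = Real.log s - Real.log T := Real.log_div hs0.ne' hT0.ne'
  have key : ∀ γ, Real.log (A s) - Real.log (A T) ≤ M + Real.log (s / T) * γ →
      A s / A T ≤ Real.exp M * (s / T) ^ γ := by
    intro γ hγ
    rw [Real.rpow_def_of_pos hst, ← Real.exp_add, ← Real.exp_log (div_pos hAs hAT),
      Real.log_div hAs.ne' hAT.ne']
    exact Real.exp_le_exp.2 hγ
  rcases le_total s T with hle | hle
  · have hu : 0 ≤ Real.log T - Real.log s := sub_nonneg.2 (Real.log_le_log hs0 hle)
    have h := hMN (Real.log s) hNs _ hu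
    rw [add_sub_cancel, Real.exp_log hs0, Real.exp_log hT0, abs_le] at h
    refine (key (β - δ) ?_).trans (mul_le_mul_of_nonneg_left (le_max_left _ _) (Real.exp_pos _).le)
    rw [hlogst]
    linarith [h.1]
  · have hu : 0 ≤ Real.log s - Real.log T := sub_nonneg.2 (Real.log_le_log hT0 hle)
    have h := hMN (Real.log T) hNT _ hu
    rw [add_sub_cancel, Real.exp_log hs0, Real.exp_log hT0, abs_le] at h
    refine (key (β + δ) ?_).trans (mul_le_mul_of_nonneg_left (le_max_right _ _) (Real.exp_pos _).le)
    rw [hlogst]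
    linarith [h.2]

/-- Potter's bound between a fixed `X` and `T`, with `δ = (1 + β)/2`, shows that `T A(T)` grows at
least like `T^δ`. Hence `k(T) → ∞`. -/
theorem RegularlyVarying.tendsto_mul_self {A : ℝ → ℝ} {β : ℝ} (hA : RegularlyVarying A β)
    (hc : ContinuousOn A (Set.Ici 0)) (hβ : -1 < β) :
    Tendsto (fun T => T * A T) atTop atTop := by
  set δ := (1 + β) / 2 with hδ
  have hδ0 : 0 < δ := by rw [hδ]; linarith
  obtain ⟨C, X, hC, hX, hpos, hpot⟩ := hA.potter hc hδ0
  have hAX := hpos X le_rfl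
  have hlim : Tendsto (fun T : ℝ => X * A X / C * (T / X) ^ δ) atTop atTop :=
    ((tendsto_rpow_atTop hδ0).comp (tendsto_id.atTop_div_const hX)).const_mul_atTop
      (by positivity)
  refine tendsto_atTop_mono' _ ?_ hlim
  filter_upwards [eventually_ge_atTop X] with T hT
  have hT0 : 0 < T := hX.trans_le hT
  have hAT := hpos T hT
  have h := hpot X T le_rfl hT
  have hXT : 0 < X / T := div_pos hX hT0
  have hmax : max ((X / T) ^ (β - δ)) ((X / T) ^ (β + δ)) = (X / T) ^ (β - δ) := by
    refine max_eq_left (Real.rpow_le_rpow_of_exponent_ge hXT ((div_le_one hT0).2 hT) ?_)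
    linarith
  have hβδ : β - δ = δ - 1 := by rw [hδ]; ring
  rw [hmax, hβδ, Real.rpow_sub_one hXT.ne', div_le_iff₀ hAT] at h
  have hinv : (X / T) ^ δ = ((T / X) ^ δ)⁻¹ := by
    rw [← Real.inv_rpow (by positivity), inv_div]
  rw [hinv] at h
  have hp : 0 < (T / X) ^ δ := Real.rpow_pos_of_pos (div_pos hT0 hX) _
  have h2 : C * (((T / X) ^ δ)⁻¹ / (X / T)) * A T = C * T * A T / (X * (T / X) ^ δ) := by
    field_simp
  rw [h2, le_div_iff₀ (by positivity)] at h
  rw [div_mul_eq_mul_div, div_le_iff₀ hC]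
  linarith

theorem integrableOn_rpow {γ : ℝ} (hγ : -1 < γ) (d : ℝ) :
    IntegrableOn (fun τ : ℝ => τ ^ γ) (Set.Ioc 0 d) := by
  rcases le_total 0 d with h | h
  · exact (intervalIntegrable_iff_integrableOn_Ioc_of_le h).1
      (intervalIntegral.intervalIntegrable_rpow' hγ)
  · simp [Set.Ioc_eq_empty (not_lt.2 h)]

/-- The rescaled kernels `A(Tτ)/A(T)` converge to `τ^β` in `L¹(0, d)`. -/
theorem RegularlyVarying.tendsto_integral {A : ℝ → ℝ} {β : ℝ} (hA : RegularlyVarying A β)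
    (hc : ContinuousOn A (Set.Ici 0)) (hβ : -1 < β) (d : ℝ) :
    Tendsto (fun T => ∫ τ in Set.Ioc 0 d, |A (T * τ) / A T - τ ^ β|) atTop (𝓝 0) := by
  set δ := (1 + β) / 2 with hδ
  have hδ0 : 0 < δ := by rw [hδ]; linarith
  have hγ : -1 < β - δ := by rw [hδ]; linarith
  obtain ⟨C, X, hC, hX, hpos, hpot⟩ := hA.potter hc hδ0
  -- For `τ ≤ d` the factor `D ^ (2δ)` absorbs the exponent `β + δ` into `β - δ`, which is still
  -- above `-1` and hence integrable at zero.
  set D := max d 1 with hD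
  have hD1 : 1 ≤ D := le_max_right _ _
  have hscaled : ∀ T, 0 < T → IntegrableOn (fun τ => A (T * τ) / A T) (Set.Ioc 0 d) := by
    intro T hT
    have : ContinuousOn (fun τ => A (T * τ) / A T) (Set.Icc 0 d) :=
      (hc.comp (by fun_prop) fun τ hτ => mul_nonneg hT.le hτ.1).div_const _
    exact (this.integrableOn_compact isCompact_Icc).mono_set Set.Ioc_subset_Icc_self
  -- Potter's bounds apply only where `Tτ` is at least `X`. On the rest `H` keeps the limit kernel
  -- alone; there `A` is merely bounded by some `M`, and its contribution is at most `MX / (T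
  -- A(T))`.
  let H : ℝ → ℝ → ℝ := fun T τ => {τ | X < T * τ}.indicator (fun τ => |A (T * τ) / A T - τ ^ β|) τ
    + {τ | X < T * τ}ᶜ.indicator (fun τ => τ ^ β) τ
  have hmeas : ∀ T, MeasurableSet {τ : ℝ | X < T * τ} := fun T =>
    measurableSet_lt (by fun_prop) (by fun_prop)
  have hHint : ∀ T, 0 < T → IntegrableOn (H T) (Set.Ioc 0 d) := fun T hT =>
    (((hscaled T hT).sub (integrableOn_rpow hβ d)).abs.indicator (hmeas T)).add
      ((integrableOn_rpow hβ d).indicator (hmeas T).compl)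
  have hH : Tendsto (fun T => ∫ τ in Set.Ioc 0 d, H T τ) atTop (𝓝 0) := by
    suffices h : Tendsto (fun T => ∫ τ in Set.Ioc 0 d, H T τ) atTop
        (𝓝 (∫ τ in Set.Ioc 0 d, (0 : ℝ))) by simpa using h
    refine tendsto_integral_filter_of_dominated_convergence
      (fun τ => C * D ^ (2 * δ) * τ ^ (β - δ) + τ ^ β) ?_ ?_
      (((integrableOn_rpow hγ d).const_mul _).add (integrableOn_rpow hβ d)) ?_
    · filter_upwards [eventually_gt_atTop 0] with T hT
      exact (hHint T hT).aestronglyMeasurable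
    · filter_upwards [eventually_ge_atTop X] with T hT
      filter_upwards [ae_restrict_mem measurableSet_Ioc] with τ hτ
      have hτ0 : 0 < τ := hτ.1
      have hp1 : 0 < τ ^ β := Real.rpow_pos_of_pos hτ0 _
      have hp2 : 0 < τ ^ (β - δ) := Real.rpow_pos_of_pos hτ0 _
      have hp3 : 0 < D ^ (2 * δ) := Real.rpow_pos_of_pos (by linarith) _
      by_cases hXT : X < T * τ
      · simp only [H, Set.indicator, Set.mem_ofPred_eq, Set.mem_compl_iff, hXT, if_true,
          not_true_eq_false, if_false, add_zero]
        rw [Real.norm_of_nonneg (abs_nonneg _)]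
        have hT0 : 0 < T := hX.trans_le hT
        have hq : 0 < A (T * τ) / A T := div_pos (hpos _ hXT.le) (hpos T hT)
        refine (abs_sub _ _).trans ?_
        rw [abs_of_pos hq, abs_of_pos hp1]
        gcongr
        refine (hpot (T * τ) T hXT.le hT).trans ?_
        rw [mul_div_cancel_left₀ τ hT0.ne', mul_assoc]
        refine mul_le_mul_of_nonneg_left (max_le ?_ ?_) hC.le
        · exact le_mul_of_one_le_left hp2.le (Real.one_le_rpow hD1 (by linarith))
        · have : β + δ = 2 * δ + (β - δ) := by ring
          rw [this, Real.rpow_add hτ0]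
          gcongr
          exact hτ.2.trans (le_max_left _ _)
      · simp only [H, Set.indicator, Set.mem_ofPred_eq, Set.mem_compl_iff, hXT, if_true,
          not_false_eq_true, if_false, zero_add]
        rw [Real.norm_of_nonneg hp1.le]
        have : 0 ≤ C * D ^ (2 * δ) * τ ^ (β - δ) := by positivity
        linarith
    · filter_upwards [ae_restrict_mem measurableSet_Ioc] with τ hτ
      have h1 := ((hA.2 τ hτ.1).sub_const (τ ^ β)).abs
      rw [sub_self, abs_zero] at h1
      refine h1.congr' ?_
      filter_upwards [eventually_gt_atTop (X / τ)] with T hT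
      have hXT : X < T * τ := by rwa [div_lt_iff₀ hτ.1] at hT
      simp [H, Set.indicator, hXT]
  obtain ⟨M, hM⟩ := (isCompact_Icc (a := (0 : ℝ)) (b := X)).exists_bound_of_continuousOn
    (hc.mono Set.Icc_subset_Ici_self)
  have hM0 : 0 ≤ M := (norm_nonneg _).trans (hM 0 ⟨le_rfl, hX.le⟩)
  have hsmall : Tendsto (fun T => M * X / (T * A T)) atTop (𝓝 0) :=
    tendsto_const_nhds.div_atTop (hA.tendsto_mul_self hc hβ)
  have hsum := hH.add hsmall
  rw [add_zero] at hsum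
  refine tendsto_of_tendsto_of_tendsto_of_le_of_le' tendsto_const_nhds hsum
    (Eventually.of_forall fun T => integral_nonneg fun _ => abs_nonneg _) ?_
  filter_upwards [eventually_ge_atTop X] with T hT
  have hT0 : 0 < T := hX.trans_le hT
  have hAT := hpos T hT
  have hconst : IntegrableOn (fun _ : ℝ => M / A T) (Set.Ioc 0 (X / T)) := by simp
  have hind : IntegrableOn ((Set.Ioc 0 (X / T)).indicator fun _ : ℝ => M / A T) (Set.Ioc 0 d) :=
    (hconst.integrable_indicator measurableSet_Ioc).integrableOn
  calc ∫ τ in Set.Ioc 0 d, |A (T * τ) / A T - τ ^ β|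
      ≤ ∫ τ in Set.Ioc 0 d, (H T τ + (Set.Ioc 0 (X / T)).indicator (fun _ : ℝ => M / A T) τ) := by
        refine setIntegral_mono_on ((hscaled T hT0).sub (integrableOn_rpow hβ d)).abs
          ((hHint T hT0).add hind) measurableSet_Ioc fun τ hτ => ?_
        have hp1 : 0 < τ ^ β := Real.rpow_pos_of_pos hτ.1 _
        by_cases hXT : X < T * τ
        · have hn : 0 ≤ (Set.Ioc 0 (X / T)).indicator (fun _ : ℝ => M / A T) τ :=
            Set.indicator_nonneg (fun _ _ => by positivity) _
          simp only [H, Set.indicator_of_mem (s := {τ | X < T * τ}) (a := τ) hXT,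
            Set.indicator_of_notMem (s := {τ | X < T * τ}ᶜ) (a := τ) (fun h => h hXT)]
          linarith
        · have hmem : τ ∈ Set.Ioc 0 (X / T) := by
            refine ⟨hτ.1, ?_⟩
            rw [le_div_iff₀ hT0, mul_comm]
            exact not_lt.1 hXT
          simp only [H, Set.indicator_of_notMem (s := {τ | X < T * τ}) (a := τ) hXT,
            Set.indicator_of_mem (s := {τ | X < T * τ}ᶜ) (a := τ) hXT,
            Set.indicator_of_mem hmem]
          refine (abs_sub _ _).trans ?_
          rw [abs_of_pos hp1, abs_div, abs_of_pos hAT]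
          have := hM (T * τ) ⟨mul_nonneg hT0.le hτ.1.le, not_lt.1 hXT⟩
          rw [Real.norm_eq_abs] at this
          have h2 : |A (T * τ)| / A T ≤ M / A T := by gcongr
          linarith
    _ = (∫ τ in Set.Ioc 0 d, H T τ)
        + ∫ τ in Set.Ioc 0 d, (Set.Ioc 0 (X / T)).indicator (fun _ : ℝ => M / A T) τ :=
        integral_add (hHint T hT0) hind
    _ ≤ (∫ τ in Set.Ioc 0 d, H T τ) + M * X / (T * A T) := by
        gcongr
        calc _ ≤ ∫ τ, (Set.Ioc 0 (X / T)).indicator (fun _ : ℝ => M / A T) τ :=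
              setIntegral_le_integral (hconst.integrable_indicator measurableSet_Ioc)
                (Eventually.of_forall fun τ =>
                  Set.indicator_nonneg (fun _ _ => by positivity) _)
          _ = M * X / (T * A T) := by
              rw [integral_indicator measurableSet_Ioc]
              simp [(div_pos hX hT0).le]
              field_simp

end RegularVariation

/-! ### The limiting Volterra equation and convergence of scalar solutions. -/

section MittagLeffler

theorem integral_rpow_mul_sub_rpow {p q t : ℝ} (hp : 0 < p) (hq : 0 < q) (ht : 0 < t) :
    ∫ s in Set.Ioc 0 t, s ^ (p - 1) * (t - s) ^ (q - 1)
      = t ^ (p + q - 1) * (Real.Gamma p * Real.Gamma q / Real.Gamma (p + q)) := by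
  apply Complex.ofReal_injective
  have h1 := Complex.betaIntegral_scaled (p : ℂ) (q : ℂ) ht
  have h2 := Complex.betaIntegral_eq_Gamma_mul_div (p : ℂ) (q : ℂ) (by simpa) (by simpa)
  rw [h2, intervalIntegral.integral_of_le ht.le] at h1
  have h3 : ∫ s in Set.Ioc 0 t, (s : ℂ) ^ ((p : ℂ) - 1) * ((t : ℂ) - s) ^ ((q : ℂ) - 1)
      = ∫ s in Set.Ioc 0 t, ((s ^ (p - 1) * (t - s) ^ (q - 1) : ℝ) : ℂ) := by
    refine setIntegral_congr_fun measurableSet_Ioc fun s hs => ?_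
    rw [Complex.ofReal_mul, Complex.ofReal_cpow hs.1.le, Complex.ofReal_cpow (sub_nonneg.2 hs.2)]
    push_cast
    rfl
  have h4 := (integral_ofReal (𝕜 := ℂ) (μ := volume.restrict (Set.Ioc 0 t))
    (f := fun s => s ^ (p - 1) * (t - s) ^ (q - 1)))
  rw [h3] at h1
  refine h4.symm.trans (h1.trans ?_)
  rw [Complex.ofReal_mul, Complex.ofReal_cpow ht.le]
  push_cast [← Complex.Gamma_ofReal]
  rfl

/-- The kernel `τ^β / Γ(1 + β)`, whose Volterra solution is the Mittag-Leffler function. -/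
def powerKernel (β τ : ℝ) : ℝ := τ ^ β / Real.Gamma (1 + β)

theorem integrableOn_powerKernel {β : ℝ} (hβ : -1 < β) (X : ℝ) :
    IntegrableOn (powerKernel β) (Set.Ioc 0 X) :=
  (integrableOn_rpow hβ X).div_const _

/-- The semigroup law of the Riemann-Liouville kernels, by induction from the Beta integral. It
identifies the Neumann series with the Mittag-Leffler series. -/
theorem volterraTerm_powerKernel {β : ℝ} (hβ : -1 < β) (k : ℕ) :
    ∀ t, 0 ≤ t → volterraTerm (powerKernel β) k t
      = t ^ ((1 + β) * k) / Real.Gamma (1 + (1 + β) * k) := by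
  have hα : 0 < 1 + β := by linarith
  induction k with
  | zero => simp [volterraTerm]
  | succ k ih =>
    intro t ht
    have hq : 0 < 1 + (1 + β) * k := by positivity
    rcases ht.eq_or_lt with rfl | ht
    · rw [volterraTerm, volterraConv_of_nonpos _ _ le_rfl,
        Real.zero_rpow (by positivity), zero_div]
    rw [volterraTerm, volterraConv]
    have h1 : ∀ s ∈ Set.Ioc 0 t, powerKernel β s • volterraTerm (powerKernel β) k (t - s)
        = (Real.Gamma (1 + β) * Real.Gamma (1 + (1 + β) * k))⁻¹
          * (s ^ ((1 + β) - 1) * (t - s) ^ ((1 + (1 + β) * k) - 1)) := by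
      intro s hs
      rw [ih _ (sub_nonneg.2 hs.2), powerKernel, smul_eq_mul, add_sub_cancel_left,
        add_sub_cancel_left, mul_inv]
      ring
    have hg1 := (Real.Gamma_pos_of_pos hα).ne'
    have hg2 := (Real.Gamma_pos_of_pos hq).ne'
    have e1 : 1 + (1 + β) * ((k + 1 : ℕ) : ℝ) = (1 + β) + (1 + (1 + β) * k) := by push_cast; ring
    have e2 : (1 + β) * ((k + 1 : ℕ) : ℝ) = (1 + β) + (1 + (1 + β) * k) - 1 := by push_cast; ring
    rw [setIntegral_congr_fun measurableSet_Ioc h1, integral_const_mul,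
      integral_rpow_mul_sub_rpow hα hq ht, e1, e2]
    field_simp

theorem mittagLeffler_eq_volterraSol {β : ℝ} (hβ : -1 < β) (z : ℝ) {t : ℝ} (ht : 0 ≤ t) :
    mittagLeffler (1 + β) ((-(z * t ^ (1 + β)) : ℝ) : ℂ)
      = (volterraSol (powerKernel β) z t : ℂ) := by
  rw [mittagLeffler, volterraSol, Complex.ofReal_tsum]
  refine tsum_congr fun k => ?_
  rw [volterraTerm_powerKernel hβ k t ht, Real.rpow_mul_natCast ht]
  have : (1 + ((1 + β : ℝ) : ℂ) * (k : ℂ)) = ((1 + (1 + β) * k : ℝ) : ℂ) := by push_cast; rfl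
  rw [this, Complex.Gamma_ofReal]
  push_cast
  rw [neg_mul_eq_neg_mul, mul_pow]
  ring

theorem volterraConv_comp_mul (b f : ℝ → ℝ) {T : ℝ} (hT : 0 < T) (t : ℝ) :
    volterraConv b f (T * t)
      = T * volterraConv (fun τ => b (T * τ)) (fun s => f (T * s)) t := by
  rcases le_total t 0 with ht | ht
  · rw [volterraConv_of_nonpos _ _ ht, volterraConv_of_nonpos _ _
      (mul_nonpos_of_nonneg_of_nonpos hT.le ht), mul_zero]
  · rw [volterraConv, volterraConv, ← intervalIntegral.integral_of_le ht,
      ← intervalIntegral.integral_of_le (mul_nonneg hT.le ht)]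
    have := intervalIntegral.mul_integral_comp_mul_left (a := 0) (b := t)
      (f := fun s => b s • f (T * t - s)) T
    rw [mul_zero] at this
    rw [← this]
    simp_rw [mul_sub]

/-- The scalar solutions, suitably rescaled, converge to the Mittag-Leffler function, locally
uniformly in the parameter and in time. -/
theorem tendsto_volterraSol_rescaled {A : ℝ → ℝ} {β : ℝ} (hA : RegularlyVarying A β)
    (hc : ContinuousOn A (Set.Ici 0)) (hβ : -1 < β)
    (hbound : ∀ z, 0 ≤ z → ∀ t, |volterraSol A z t| ≤ 1) {Z d ε : ℝ} (hZ : 0 ≤ Z)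
    (hε : 0 < ε) :
    ∀ᶠ T in atTop, ∀ z ∈ Set.Icc 0 Z, ∀ t ∈ Set.Icc 0 d,
      |volterraSol A (z / (T * A T * Real.Gamma (1 + β))) (T * t)
        - volterraSol (powerKernel β) z t| ≤ ε := by
  have hg : 0 < Real.Gamma (1 + β) := Real.Gamma_pos_of_pos (by linarith)
  have hAint : ∀ X, IntegrableOn A (Set.Ioc 0 X) := fun X =>
    ((hc.mono Set.Icc_subset_Ici_self).integrableOn_compact isCompact_Icc).mono_set
      Set.Ioc_subset_Icc_self
  have hBint := integrableOn_powerKernel hβ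
  have hlimμ : Tendsto (fun μ => Z * weightedMass (powerKernel β) d μ) atTop (𝓝 (Z * 0)) :=
    (tendsto_weightedMass (hBint d)).const_mul Z
  rw [mul_zero] at hlimμ
  -- The contraction is arranged for the limit kernel, so one `μ` serves all `T` and all `z ≤ Z`.
  obtain ⟨μ, hμ, hμ0⟩ := ((hlimμ.eventually_le_const (by norm_num : (0 : ℝ) < 1 / 2)).and
    (eventually_ge_atTop 0)).exists
  have hη : Tendsto (fun T => 2 * (Z * ((Real.Gamma (1 + β))⁻¹ *
      ∫ τ in Set.Ioc 0 d, |A (T * τ) / A T - τ ^ β|)) * Real.exp (μ * d)) atTop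
      (𝓝 (2 * (Z * ((Real.Gamma (1 + β))⁻¹ * 0)) * Real.exp (μ * d))) :=
    ((((hA.tendsto_integral hc hβ d).const_mul _).const_mul _).const_mul _).mul_const _
  simp only [mul_zero, zero_mul] at hη
  filter_upwards [hη.eventually_le_const hε, hA.1, eventually_gt_atTop 0]
    with T hTη hAT hT z hz t ht
  set y := z / (T * A T * Real.Gamma (1 + β)) with hy
  have hy0 : 0 ≤ y := div_nonneg hz.1 (by positivity)
  set wT : ℝ → ℝ := fun s => volterraSol A y (T * s) with hwT
  set w : ℝ → ℝ := volterraSol (powerKernel β) z with hw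
  have hwTc : Continuous wT := (continuous_volterraSol_right hAint y).comp (by fun_prop)
  have hwc : Continuous w := continuous_volterraSol_right hBint z
  set bT : ℝ → ℝ := fun τ => A (T * τ) / A T / Real.Gamma (1 + β) with hbT
  have hbTint : ∀ X, IntegrableOn bT (Set.Ioc 0 X) := by
    intro X
    have : ContinuousOn bT (Set.Icc 0 X) :=
      ((hc.comp (by fun_prop) fun τ hτ => mul_nonneg hT.le hτ.1).div_const _).div_const _
    exact (this.integrableOn_compact isCompact_Icc).mono_set Set.Ioc_subset_Icc_self
  -- The time change produces a factor `T`, which cancels against the denominator of `y`; the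
  -- parameter is `z` again and all dependence on `T` sits in the kernel `bT`.
  have heqT : ∀ s, wT s = 1 - z * volterraConv bT wT s := by
    intro s
    simp only [hwT]
    rw [volterraSol_eq hAint, volterraConv_comp_mul A _ hT]
    congr 1
    have : volterraConv bT (fun s => volterraSol A y (T * s)) s
        = (A T * Real.Gamma (1 + β))⁻¹ * volterraConv (fun τ => A (T * τ))
          (fun s => volterraSol A y (T * s)) s := by
      simp only [volterraConv, hbT, smul_eq_mul]
      rw [← integral_const_mul]
      congr 1
      ext τ
      rw [mul_inv]
      ring
    rw [this, hy]
    field_simp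
  have heq : ∀ s, w s = 1 - z * volterraConv (powerKernel β) w s := volterraSol_eq hBint z
  set η := (Real.Gamma (1 + β))⁻¹ * ∫ τ in Set.Ioc 0 d, |A (T * τ) / A T - τ ^ β| with hηdef
  have hη0 : 0 ≤ η := mul_nonneg (by positivity) (integral_nonneg fun _ => abs_nonneg _)
  have hdiff : ∀ s ∈ Set.Icc 0 d,
      |volterraConv (fun τ => bT τ - powerKernel β τ) wT s| ≤ η := by
    intro s hs
    have hi : IntegrableOn (fun τ => |bT τ - powerKernel β τ|) (Set.Ioc 0 d) :=
      ((hbTint d).sub (hBint d)).abs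
    calc |volterraConv (fun τ => bT τ - powerKernel β τ) wT s|
        ≤ ∫ τ in Set.Ioc 0 s, |bT τ - powerKernel β τ| := by
          rw [← Real.norm_eq_abs, volterraConv]
          refine norm_integral_le_of_norm_le (hi.mono_set (Set.Ioc_subset_Ioc_right hs.2)) ?_
          filter_upwards with τ
          rw [norm_smul, Real.norm_eq_abs, Real.norm_eq_abs]
          exact mul_le_of_le_one_right (abs_nonneg _) (hbound y hy0 _)
      _ ≤ ∫ τ in Set.Ioc 0 d, |bT τ - powerKernel β τ| :=
          setIntegral_mono_set hi (Eventually.of_forall fun _ => abs_nonneg _)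
            (Set.Ioc_subset_Ioc_right hs.2).eventuallyLE
      _ = η := by
          rw [hηdef, ← integral_const_mul]
          congr 1
          ext τ
          rw [hbT, powerKernel, ← sub_div, abs_div, abs_of_pos hg]
          ring
  -- The difference solves the limit equation with the forcing `(bT - powerKernel β) * wT`, which is
  -- at most `η` because `|wT| ≤ 1`.
  have hsplit : ∀ s, wT s - w s = -(z * (volterraConv (fun τ => bT τ - powerKernel β τ) wT s
      + volterraConv (powerKernel β) (fun r => wT r - w r) s)) := by
    intro s
    have h1 := integrableOn_volterra_sub (hbTint s) hwTc
    have h2 := integrableOn_volterra_sub (hBint s) hwTc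
    have h3 := integrableOn_volterra_sub (hBint s) hwc
    have e1 : volterraConv (fun τ => bT τ - powerKernel β τ) wT s
        = volterraConv bT wT s - volterraConv (powerKernel β) wT s := by
      simp only [volterraConv, sub_smul]
      exact integral_sub h1 h2
    have e2 : volterraConv (powerKernel β) (fun r => wT r - w r) s
        = volterraConv (powerKernel β) wT s - volterraConv (powerKernel β) w s := by
      simp only [volterraConv, smul_sub]
      exact integral_sub h2 h3
    rw [e1, e2, heqT s, heq s]
    ring
  obtain ⟨M, hM⟩ := (isCompact_Icc (a := (0 : ℝ)) (b := d)).exists_bound_of_continuousOn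
    (f := fun s => |wT s - w s| * Real.exp (-(μ * s))) (by fun_prop)
  have key := le_two_mul_of_half_contraction (ι := Set.Icc 0 d)
    (e := fun s => |wT s - w s| * Real.exp (-(μ * s))) (M := M) (ρ := Z * η)
    (fun s => (le_abs_self _).trans (hM s s.2)) (fun S hS s => by
      have hS' : ∀ r ∈ Set.Icc 0 d, ‖wT r - w r‖ ≤ S * Real.exp (μ * r) := by
        intro r hr
        have := hS ⟨r, hr⟩
        simp only at this
        rw [Real.exp_neg, ← div_eq_mul_inv, div_le_iff₀ (Real.exp_pos _)] at this
        exact this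
      have h1 := norm_volterraConv_le (hBint d) μ hS' s.2
      have h2 := hdiff s s.2
      have hS0 : 0 ≤ S := by
        have := hS s
        exact (by positivity : 0 ≤ |wT s - w s| * Real.exp (-(μ * s))).trans this
      have h3 : |wT s - w s| ≤ Z * (η + weightedMass (powerKernel β) d μ * S
          * Real.exp (μ * s)) := by
        rw [hsplit, abs_neg, abs_mul, abs_of_nonneg hz.1]
        refine mul_le_mul hz.2 ((abs_add_le _ _).trans (add_le_add h2 h1)) (abs_nonneg _) hZ
      rw [Real.exp_neg, ← div_eq_mul_inv, div_le_iff₀ (Real.exp_pos _)]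
      refine h3.trans ?_
      have h4 : Z * weightedMass (powerKernel β) d μ * (S * Real.exp (μ * s))
          ≤ 1 / 2 * (S * Real.exp (μ * s)) := by gcongr
      have h5 : Z * η * 1 ≤ Z * η * Real.exp (μ * s) :=
        mul_le_mul_of_nonneg_left (Real.one_le_exp (mul_nonneg hμ0 s.2.1)) (mul_nonneg hZ hη0)
      linarith) ⟨t, ht⟩
  simp only at key
  rw [Real.exp_neg, ← div_eq_mul_inv, div_le_iff₀ (Real.exp_pos _)] at key
  refine key.trans (le_trans ?_ hTη)
  have : Real.exp (μ * t) ≤ Real.exp (μ * d) :=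
    Real.exp_le_exp.2 (mul_le_mul_of_nonneg_left ht.2 hμ0)
  exact mul_le_mul_of_nonneg_left this (by positivity)

/-- The bound is inherited from the approximating solutions; no positivity of the limit kernel has
to be checked. -/
theorem abs_volterraSol_powerKernel_le_one {A : ℝ → ℝ} {β : ℝ} (hA : RegularlyVarying A β)
    (hc : ContinuousOn A (Set.Ici 0)) (hβ : -1 < β)
    (hbound : ∀ z, 0 ≤ z → ∀ t, |volterraSol A z t| ≤ 1) {z t : ℝ} (hz : 0 ≤ z) (ht : 0 ≤ t) :
    |volterraSol (powerKernel β) z t| ≤ 1 := by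
  refine le_of_forall_pos_le_add fun ε hε => ?_
  obtain ⟨T, hT, hAT, hT0⟩ := ((tendsto_volterraSol_rescaled hA hc hβ hbound hz hε
    (d := t)).and (hA.1.and (eventually_gt_atTop 0))).exists
  have h1 := hT z ⟨hz, le_rfl⟩ t ⟨ht, le_rfl⟩
  have hg : 0 < Real.Gamma (1 + β) := Real.Gamma_pos_of_pos (by linarith)
  have h2 := hbound (z / (T * A T * Real.Gamma (1 + β))) (by positivity) (T * t)
  rw [abs_le] at *
  constructor <;> linarith

end MittagLeffler

/-! ### Compactly supported test functions; the Laplacian as a multiplier. -/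

section CutoffDensity

variable {E : Type*} [NormedAddCommGroup E] [InnerProductSpace ℝ E] [FiniteDimensional ℝ E]

/-- The derivatives of `1 - χ(ε ·)`, for a cutoff `χ` near the origin, are `O(ε ‖x‖)`. -/
theorem norm_iteratedFDeriv_cutoff_le (χ : ContDiffBump (0 : E)) (i : ℕ) :
    ∃ B : ℝ, 0 ≤ B ∧ ∀ ε : ℝ, 0 < ε → ε ≤ 1 → ∀ x : E,
      ‖iteratedFDeriv ℝ i (fun y : E => 1 - χ (ε • y)) x‖ ≤ B * (ε * ‖x‖) := by
  have hsm : ContDiff ℝ ∞ (fun y : E => 1 - χ y) := contDiff_const.sub χ.contDiff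
  obtain ⟨B, hB⟩ : ∃ B : ℝ, ∀ x : E, ‖iteratedFDeriv ℝ i (fun y : E => 1 - χ y) x‖ ≤ B := by
    have hb : ∃ B : ℝ, ∀ x : E, ‖iteratedFDeriv ℝ i (fun y : E => χ y) x‖ ≤ B := by
      have hc : Continuous (iteratedFDeriv ℝ i (fun y : E => χ y)) :=
        (χ.contDiff (n := i)).continuous_iteratedFDeriv le_rfl
      exact (χ.hasCompactSupport.iteratedFDeriv i).exists_bound_of_continuous hc
    obtain ⟨B, hB⟩ := hb
    refine ⟨1 + B, fun x => ?_⟩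
    have h1 : iteratedFDeriv ℝ i (fun y : E => 1 - χ y) x
        = iteratedFDeriv ℝ i (fun _ : E => (1 : ℝ)) x
          - iteratedFDeriv ℝ i (fun y : E => χ y) x := by
      exact fun_iteratedFDeriv_sub_apply contDiff_const.contDiffAt (χ.contDiff (n := i)).contDiffAt
    rw [h1]
    refine (norm_sub_le _ _).trans (add_le_add ?_ (hB x))
    rcases i with _ | i
    · simp
    · rw [iteratedFDeriv_const_of_ne (by simp)]; simp
  have hB0 : 0 ≤ B := (norm_nonneg _).trans (hB 0)
  have hr := χ.rIn_pos
  refine ⟨B / χ.rIn, by positivity, fun ε hε hε1 x => ?_⟩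
  have hcomp : iteratedFDeriv ℝ i (fun y : E => 1 - χ (ε • y)) x
      = ε ^ i • iteratedFDeriv ℝ i (fun y : E => 1 - χ y) (ε • x) := by
    have := congrFun (iteratedFDeriv_comp_const_smul (i := i) (f := fun y : E => 1 - χ y) ε
      (hsm.of_le (by exact_mod_cast le_top))) x
    simpa using this
  rw [hcomp, norm_smul, norm_pow, Real.norm_of_nonneg hε.le]
  by_cases hx : ‖ε • x‖ < χ.rIn
  · have hev : (fun y : E => 1 - χ y) =ᶠ[𝓝 (ε • x)] fun _ => (0 : ℝ) := by
      have : Metric.ball (0 : E) χ.rIn ∈ 𝓝 (ε • x) :=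
        Metric.isOpen_ball.mem_nhds (by simpa using hx)
      filter_upwards [this] with y hy
      rw [χ.one_of_mem_closedBall (Metric.ball_subset_closedBall hy), sub_self]
    rw [hev.iteratedFDeriv ℝ i |>.self_of_nhds]
    simp only [iteratedFDeriv_fun_zero, Pi.zero_apply, norm_zero, mul_zero]
    positivity
  · push Not at hx
    rw [norm_smul, Real.norm_of_nonneg hε.le] at hx
    calc ε ^ i * ‖iteratedFDeriv ℝ i (fun y : E => 1 - χ y) (ε • x)‖ ≤ 1 * B :=
          mul_le_mul (pow_le_one₀ hε.le hε1) (hB _) (norm_nonneg _) zero_le_one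
      _ = B / χ.rIn * χ.rIn := by field_simp
      _ ≤ B / χ.rIn * (ε * ‖x‖) := by gcongr

/-- Multiply by `χ(ε ·)` with `ε → 0`. The error is `O(ε)` in every Schwartz seminorm at the price
of one more power of `‖x‖`. The passage is needed because the distributional equation admits only
compactly supported test functions. -/
theorem exists_seq_hasCompactSupport_tendsto (φ : 𝓢(E, ℂ)) :
    ∃ φs : ℕ → 𝓢(E, ℂ), (∀ n, HasCompactSupport (φs n)) ∧ Tendsto φs atTop (𝓝 φ) := by
  let χ : ContDiffBump (0 : E) := ⟨1, 2, one_pos, one_lt_two⟩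
  let ε : ℕ → ℝ := fun n => 1 / ((n : ℝ) + 1)
  have hε : ∀ n, 0 < ε n := fun n => by positivity
  have hε1 : ∀ n, ε n ≤ 1 := fun n => by
    rw [div_le_one (by positivity)]; linarith [(n.cast_nonneg : (0 : ℝ) ≤ n)]
  have hcs : ∀ n, HasCompactSupport fun x : E => χ (ε n • x) := fun n =>
    χ.hasCompactSupport.comp_homeomorph (Homeomorph.smulOfNeZero (ε n) (hε n).ne')
  have hsm : ∀ n, ContDiff ℝ ∞ fun x : E => χ (ε n • x) := fun n =>
    χ.contDiff.comp (contDiff_const_smul _)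
  have htg : ∀ n, Function.HasTemperateGrowth fun x : E => χ (ε n • x) := fun n =>
    (hcs n).hasTemperateGrowth (hsm n)
  refine ⟨fun n => SchwartzMap.smulLeftCLM ℂ (fun x : E => χ (ε n • x)) φ, fun n => ?_, ?_⟩
  · exact (hcs n).of_isClosed_subset (isClosed_tsupport _)
      ((SchwartzMap.tsupport_smulLeftCLM_subset _ φ).trans Set.inter_subset_right)
  · rw [(schwartz_withSeminorms ℝ E ℂ).tendsto_nhds]
    rintro ⟨k, m⟩ δ hδ
    choose B hB0 hB using fun i => norm_iteratedFDeriv_cutoff_le χ i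
    set C : ℝ := ∑ i ∈ Finset.range (m + 1),
      (m.choose i : ℝ) * B i * SchwartzMap.seminorm ℝ (k + 1) (m - i) φ with hC
    have hC0 : 0 ≤ C := Finset.sum_nonneg fun i _ => by
      have := hB0 i; positivity
    have key : ∀ n, schwartzSeminormFamily ℝ E ℂ (k, m)
        (SchwartzMap.smulLeftCLM ℂ (fun x : E => χ (ε n • x)) φ - φ) ≤ ε n * C := by
      intro n
      have hd : SchwartzMap.smulLeftCLM ℂ (fun x : E => χ (ε n • x)) φ - φ
          = -(SchwartzMap.smulLeftCLM ℂ (fun x : E => 1 - χ (ε n • x)) φ) := by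
        ext x
        have h1 : Function.HasTemperateGrowth fun x : E => 1 - χ (ε n • x) :=
          (Function.HasTemperateGrowth.const 1).sub (htg n)
        simp [SchwartzMap.smulLeftCLM_apply_apply (htg n), SchwartzMap.smulLeftCLM_apply_apply h1,
          sub_mul]
      rw [hd, map_neg_eq_map]
      refine SchwartzMap.seminorm_le_bound ℝ k m _ (mul_nonneg (hε n).le hC0) fun x => ?_
      have h1 : Function.HasTemperateGrowth fun x : E => 1 - χ (ε n • x) :=
        (Function.HasTemperateGrowth.const 1).sub (htg n)
      rw [SchwartzMap.smulLeftCLM_apply h1]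
      have h2 := norm_iteratedFDeriv_smul_le (𝕜 := ℝ) (N := ∞)
        (f := fun x : E => 1 - χ (ε n • x)) (g := φ) (contDiff_const.sub (hsm n)) (φ.smooth ⊤) x
        (n := m) (by exact_mod_cast le_top)
      calc ‖x‖ ^ k * ‖iteratedFDeriv ℝ m (fun y => (1 - χ (ε n • y)) • φ y) x‖
          ≤ ‖x‖ ^ k * ∑ i ∈ Finset.range (m + 1), (m.choose i : ℝ) *
            ‖iteratedFDeriv ℝ i (fun x : E => 1 - χ (ε n • x)) x‖
              * ‖iteratedFDeriv ℝ (m - i) φ x‖ := by gcongr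
        _ = ∑ i ∈ Finset.range (m + 1), ‖x‖ ^ k * ((m.choose i : ℝ) *
            ‖iteratedFDeriv ℝ i (fun x : E => 1 - χ (ε n • x)) x‖
              * ‖iteratedFDeriv ℝ (m - i) φ x‖) := by rw [Finset.mul_sum]
        _ ≤ ∑ i ∈ Finset.range (m + 1), ε n * ((m.choose i : ℝ) * B i *
              SchwartzMap.seminorm ℝ (k + 1) (m - i) φ) := by
            refine Finset.sum_le_sum fun i _ => ?_
            have h3 := SchwartzMap.le_seminorm ℝ (k + 1) (m - i) φ x
            have h4 := hB i (ε n) (hε n) (hε1 n) x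
            have h5 := hB0 i
            calc ‖x‖ ^ k * ((m.choose i : ℝ) *
                ‖iteratedFDeriv ℝ i (fun x : E => 1 - χ (ε n • x)) x‖
                  * ‖iteratedFDeriv ℝ (m - i) φ x‖)
                ≤ ‖x‖ ^ k * ((m.choose i : ℝ) * (B i * (ε n * ‖x‖))
                  * ‖iteratedFDeriv ℝ (m - i) φ x‖) := by gcongr
              _ = ε n * ((m.choose i : ℝ) * B i *
                  (‖x‖ ^ (k + 1) * ‖iteratedFDeriv ℝ (m - i) φ x‖)) := by ring
              _ ≤ _ := by
                  have := (hε n).le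
                  gcongr
        _ = ε n * C := by rw [hC, Finset.mul_sum]
    have hlim : Tendsto (fun n => ε n * C) atTop (𝓝 0) := by
      simpa [ε] using (tendsto_one_div_add_atTop_nhds_zero_nat (𝕜 := ℝ)).mul_const C
    filter_upwards [hlim.eventually_lt_const hδ] with n hn using (key n).trans_lt hn

variable [MeasurableSpace E] [BorelSpace E]

theorem apply_laplacian_fourier (v : 𝓢'(E, ℂ)) (ψ : 𝓢(E, ℂ)) :
    v (Δ (𝓕 ψ)) = v (𝓕 (SchwartzMap.smulLeftCLM ℂ
      (fun x : E => ((-(2 * Real.pi) ^ 2 * ‖x‖ ^ 2 : ℝ) : ℂ)) ψ)) := by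
  have h := TemperedDistribution.laplacian_eq_fourierMultiplierCLM v
  rw [← TemperedDistribution.laplacian_apply_apply, h,
    TemperedDistribution.fourierMultiplierCLM_apply]
  have h2 : (fun x : E => ((-(2 * Real.pi) ^ 2 * ‖x‖ ^ 2 : ℝ) : ℂ))
      = ((-(2 * Real.pi) ^ 2 : ℝ) : ℂ) • fun x : E => ((‖x‖ ^ 2 : ℝ) : ℂ) := by
    ext x; simp
  rw [h2, SchwartzMap.smulLeftCLM_smul (by fun_prop)]
  simp only [smul_apply, TemperedDistribution.fourierInv_apply,
    TemperedDistribution.smulLeftCLM_apply_apply, TemperedDistribution.fourier_apply]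
  rw [FourierTransform.fourierInv_fourier_eq, FourierTransform.fourier_smul, map_smul]
  simp only [Complex.real_smul, smul_eq_mul]

end CutoffDensity

/-! ### Pairing Sobolev distributions with test functions. -/

section SobolevPairing

variable {E : Type*} [NormedAddCommGroup E] [InnerProductSpace ℝ E]

/-- The pairing `t ↦ u(t) φ`, extended by a constant to negative times. -/
def pairing (u : ℝ → 𝓢'(E, ℂ)) (φ : 𝓢(E, ℂ)) (t : ℝ) : ℂ := u (max t 0) φ

theorem pairing_of_nonneg (u : ℝ → 𝓢'(E, ℂ)) (φ : 𝓢(E, ℂ)) {t : ℝ} (ht : 0 ≤ t) :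
    pairing u φ t = u t φ := by rw [pairing, max_eq_left ht]

variable [FiniteDimensional ℝ E] [MeasurableSpace E] [BorelSpace E]

/-- The `L²` norm of `(1 + ‖x‖²)^{-σ/2} ψ`, which controls `𝓕 v ψ` for `v ∈ H^σ`. -/
def dualNorm (σ : ℝ) (ψ : 𝓢(E, ℂ)) : ℝ :=
  ‖(SchwartzMap.smulLeftCLM ℂ (fun x : E => (((1 + ‖x‖ ^ 2) ^ (-σ / 2) : ℝ) : ℂ)) ψ).toLp 2
    (volume : Measure E)‖

theorem dualNorm_nonneg (σ : ℝ) (ψ : 𝓢(E, ℂ)) : 0 ≤ dualNorm σ ψ := norm_nonneg _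

theorem continuous_dualNorm (σ : ℝ) : Continuous (dualNorm σ : 𝓢(E, ℂ) → ℝ) :=
  (SchwartzMap.continuous_toLp.comp (ContinuousLinearMap.continuous _)).norm

theorem norm_toTemperedDistribution_apply_le (g : Lp ℂ 2 (volume : Measure E)) (ψ : 𝓢(E, ℂ)) :
    ‖(g : 𝓢'(E, ℂ)) ψ‖ ≤ ‖g‖ * ‖ψ.toLp 2 (volume : Measure E)‖ := by
  have h : (g : 𝓢'(E, ℂ)) ψ = inner ℂ (star (ψ.toLp 2 (volume : Measure E))) g := by
    rw [Lp.toTemperedDistribution_apply, L2.inner_def]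
    refine integral_congr_ae ?_
    filter_upwards [ψ.coeFn_toLp 2 (volume : Measure E),
      Lp.coeFn_star (ψ.toLp 2 (volume : Measure E))] with x h1 h2
    simp [h2, h1, mul_comm]
  rw [h, mul_comm]
  refine (norm_inner_le_norm _ _).trans_eq ?_
  rw [Lp.norm_def, Lp.norm_def, eLpNorm_congr_ae (Lp.coeFn_star _), eLpNorm_star, ← Lp.norm_def]

/-- Sobolev duality: the weight is moved from `v` to `ψ`, and Plancherel bounds what remains by the
`L²` norm of `g`. -/
theorem norm_apply_fourier_le {σ : ℝ} {v : 𝓢'(E, ℂ)} {g : Lp ℂ 2 (volume : Measure E)}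
    (h : TemperedDistribution.besselPotential E ℂ σ v = (g : 𝓢'(E, ℂ))) (ψ : 𝓢(E, ℂ)) :
    ‖v (𝓕 ψ)‖ ≤ ‖g‖ * dualNorm σ ψ := by
  set ψ' : 𝓢(E, ℂ) :=
    SchwartzMap.smulLeftCLM ℂ (fun x : E => (((1 + ‖x‖ ^ 2) ^ (-σ / 2) : ℝ) : ℂ)) ψ with hψ'
  have hψ : ψ = SchwartzMap.smulLeftCLM ℂ
      (fun x : E => (((1 + ‖x‖ ^ 2) ^ (σ / 2) : ℝ) : ℂ)) ψ' := by
    rw [hψ', SchwartzMap.smulLeftCLM_smulLeftCLM_apply (by fun_prop) (by fun_prop)]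
    have : ((fun x : E => (((1 + ‖x‖ ^ 2) ^ (σ / 2) : ℝ) : ℂ))
        * fun x : E => (((1 + ‖x‖ ^ 2) ^ (-σ / 2) : ℝ) : ℂ)) = fun _ => 1 := by
      ext x
      rw [Pi.mul_apply, ← Complex.ofReal_mul, ← Real.rpow_add (by positivity)]
      simp [neg_div]
    rw [this, SchwartzMap.smulLeftCLM_const]
    simp
  have h2 : v (𝓕 ψ) = ((𝓕 g : Lp ℂ 2 (volume : Measure E)) : 𝓢'(E, ℂ)) ψ' := by
    rw [← Lp.fourier_toTemperedDistribution_eq, ← h,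
      TemperedDistribution.fourier_besselPotential_eq_smulLeftCLM_fourier_apply,
      TemperedDistribution.smulLeftCLM_apply_apply, ← hψ, TemperedDistribution.fourier_apply]
  rw [h2]
  refine (norm_toTemperedDistribution_apply_le _ _).trans_eq ?_
  rw [Lp.norm_fourier_eq, dualNorm]

theorem norm_apply_fourier_le_of_sobolevENorm_lt {σ M : ℝ} {v : 𝓢'(E, ℂ)}
    (h : sobolevENorm σ v < ENNReal.ofReal M) (ψ : 𝓢(E, ℂ)) :
    ‖v (𝓕 ψ)‖ ≤ M * dualNorm σ ψ := by
  simp only [sobolevENorm, iInf_lt_iff] at h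
  obtain ⟨g, hg, hM⟩ := h
  refine (norm_apply_fourier_le hg ψ).trans ?_
  have hM' : ‖g‖ ≤ M := by
    rw [← ofReal_norm] at hM
    exact (ENNReal.ofReal_lt_ofReal_iff_of_nonneg (norm_nonneg _)).1 hM |>.le
  exact mul_le_mul_of_nonneg_right hM' (dualNorm_nonneg _ _)

/-- Local bounds from continuity, patched together by compactness. The constant is independent of
`ψ`, which the uniqueness argument requires. -/
theorem ContinuousInSobolev.exists_norm_le {σ : ℝ} {u : ℝ → 𝓢'(E, ℂ)}
    (hu : ContinuousInSobolev σ u) (X : ℝ) :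
    ∃ M : ℝ, 0 ≤ M ∧ ∀ t ∈ Set.Icc 0 X, ∀ ψ : 𝓢(E, ℂ), ‖u t (𝓕 ψ)‖ ≤ M * dualNorm σ ψ := by
  refine isCompact_Icc.induction_on (s := Set.Icc 0 X)
    (p := fun s => ∃ M : ℝ, 0 ≤ M ∧ ∀ t ∈ s, ∀ ψ : 𝓢(E, ℂ), ‖u t (𝓕 ψ)‖ ≤ M * dualNorm σ ψ)
    ⟨0, le_rfl, by simp⟩ ?_ ?_ ?_
  · rintro s s' hs ⟨M, hM, h⟩
    exact ⟨M, hM, fun t ht => h t (hs ht)⟩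
  · rintro s s' ⟨M, hM, h⟩ ⟨M', hM', h'⟩
    refine ⟨M + M', by positivity, ?_⟩
    rintro t (ht | ht) ψ
    · have := mul_nonneg hM' (dualNorm_nonneg σ ψ)
      linarith [h t ht ψ]
    · have := mul_nonneg hM (dualNorm_nonneg σ ψ)
      linarith [h' t ht ψ]
  · intro t ht
    obtain ⟨g, hg⟩ := hu.1 t ht.1
    have h1 := (hu.2 t ht.1).eventually_lt_const (u := ENNReal.ofReal 1) (by simp)
    have h2 : 𝓝[Set.Icc 0 X] t ≤ 𝓝[Set.Ici 0] t := nhdsWithin_mono _ fun x hx => hx.1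
    refine ⟨_, h2 h1, 1 + ‖g‖, by positivity, fun τ hτ ψ => ?_⟩
    have h3 := norm_apply_fourier_le_of_sobolevENorm_lt hτ ψ
    have h4 := norm_apply_fourier_le hg ψ
    have h5 : u τ (𝓕 ψ) = (u τ - u t) (𝓕 ψ) + u t (𝓕 ψ) := by
      rw [sub_apply, sub_add_cancel]
    rw [h5]
    exact (norm_add_le _ _).trans (by linarith)

theorem ContinuousInSobolev.continuousOn_apply {σ : ℝ} {u : ℝ → 𝓢'(E, ℂ)}
    (hu : ContinuousInSobolev σ u) (φ : 𝓢(E, ℂ)) : ContinuousOn (fun t => u t φ) (Set.Ici 0) := by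
  intro t ht
  rw [ContinuousWithinAt, Metric.tendsto_nhds]
  intro ε hε
  have hφ : 𝓕 (𝓕⁻ φ) = φ := FourierTransform.fourier_fourierInv_eq φ
  have hN := dualNorm_nonneg σ (𝓕⁻ φ)
  set N := dualNorm σ (𝓕⁻ φ)
  have h1 := (hu.2 t ht).eventually_lt_const (u := ENNReal.ofReal (ε / (N + 1)))
    (by rw [ENNReal.ofReal_pos]; positivity)
  filter_upwards [h1] with τ hτ
  have h3 := norm_apply_fourier_le_of_sobolevENorm_lt hτ (𝓕⁻ φ)
  rw [hφ, sub_apply] at h3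
  rw [dist_eq_norm]
  refine h3.trans_lt ?_
  change ε / (N + 1) * N < ε
  rw [div_mul_eq_mul_div, div_lt_iff₀ (by positivity)]
  nlinarith

theorem ContinuousInSobolev.continuous_pairing {σ : ℝ} {u : ℝ → 𝓢'(E, ℂ)}
    (hu : ContinuousInSobolev σ u) (φ : 𝓢(E, ℂ)) : Continuous (pairing u φ) :=
  (hu.continuousOn_apply φ).comp_continuous (continuous_id.max continuous_const)
    fun t => Set.mem_Ici.2 (le_max_right t 0)

end SobolevPairing

/-! ### From the weak equation in time to the integrated Volterra equation. -/

section WeakEquation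

/-- Both sides are the double integral of `a(r) θ(t) Y(t - r)` over the triangle: on `(0, S)` the
adjoint of causal convolution is its conjugate under `t ↦ S - t`. -/
theorem integral_volterraConv_reflect {a : ℝ → ℝ} {S : ℝ} (hS : 0 ≤ S)
    (ha : IntegrableOn a (Set.Ioc 0 S)) {θ : ℝ → ℝ} (hθ : Continuous θ) {Y : ℝ → ℂ}
    (hY : Continuous Y) :
    ∫ s in Set.Ioc 0 S, volterraConv a (fun q => θ (S - q)) (S - s) • Y s
      = ∫ t in Set.Ioc 0 S, θ t • volterraConv a Y t := by
  have h1 : ∀ t, θ t • volterraConv a Y t = ∫ r in Set.Ioc 0 t, a r • (θ t • Y (t - r)) := by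
    intro t
    rw [volterraConv, ← integral_smul]
    simp_rw [smul_comm (θ t)]
  have h2 : ∀ s, volterraConv a (fun q => θ (S - q)) s • Y (S - s)
      = ∫ r in Set.Ioc 0 s, a r • (θ (S - s + r) • Y (S - s)) := by
    intro s
    rw [volterraConv, ← integral_smul_const]
    refine integral_congr_ae (Eventually.of_forall fun r => ?_)
    simp only [smul_eq_mul]
    rw [mul_smul, show S - (s - r) = S - s + r by ring]
  have h3 : ∫ s in Set.Ioc 0 S, volterraConv a (fun q => θ (S - q)) (S - s) • Y s
      = ∫ s in Set.Ioc 0 S, volterraConv a (fun q => θ (S - q)) s • Y (S - s) := by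
    rw [← intervalIntegral.integral_of_le hS, ← intervalIntegral.integral_of_le hS]
    have := intervalIntegral.integral_comp_sub_left (a := 0) (b := S)
      (fun s => volterraConv a (fun q => θ (S - q)) s • Y (S - s)) S
    simpa using this
  rw [h3]
  simp_rw [h1, h2]
  rw [integral_triangle_swap ha (g := fun r t => θ t • Y (t - r)) (by fun_prop),
    integral_triangle_swap ha (g := fun r s => θ (S - s + r) • Y (S - s)) (by fun_prop)]
  refine setIntegral_congr_fun measurableSet_Ioc fun r hr => ?_
  congr 1
  rw [← intervalIntegral.integral_of_le hr.2, ← intervalIntegral.integral_of_le hr.2]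
  have := intervalIntegral.integral_comp_sub_left (a := r) (b := S)
      (fun t => θ t • Y (t - r)) (S + r)
  rw [show S + r - S = r by ring, show S + r - r = S by ring] at this
  rw [← this]
  refine intervalIntegral.integral_congr fun s _ => ?_
  rw [show S + r - s = S - s + r by ring, show S - s + r - r = S - s by ring]

/-- A continuous function is zero on `(0, ∞)` if it is orthogonal there to all derivatives of test
functions on `[0, ∞)`. -/
theorem eq_zero_of_integral_deriv_smul {z : ℝ → ℂ} (hz : Continuous z)
    (h : ∀ θ : ℝ → ℝ, ContDiff ℝ ∞ θ → HasCompactSupport θ →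
      ∀ S, 0 < S → (∀ t, S ≤ t → θ t = 0) → ∫ t in Set.Ioc 0 S, deriv θ t • z t = 0)
    {t : ℝ} (ht : 0 < t) : z t = 0 := by
  have hae : ∀ᵐ x : ℝ, x ∈ Set.Ioi (0 : ℝ) → z x = 0 := by
    refine isOpen_Ioi.ae_eq_zero_of_integral_contDiff_smul_eq_zero
      (hz.locallyIntegrable.locallyIntegrableOn _) fun η hη hηc hηs => ?_
    set c : ℝ := ∫ s, η s with hc
    obtain ⟨S, hS0, hS⟩ : ∃ S : ℝ, 0 < S ∧ ∀ t, S ≤ t → η t = 0 := by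
      obtain ⟨R, hR⟩ := hηc.isCompact.isBounded.subset_closedBall (0 : ℝ)
      refine ⟨max R 0 + 1, by positivity, fun t ht => ?_⟩
      by_contra hne
      have h1 := hR (subset_tsupport _ hne)
      rw [mem_closedBall_zero_iff, Real.norm_eq_abs] at h1
      linarith [le_abs_self t, le_max_left R 0]
    have hneg : ∀ t, t ≤ 0 → η t = 0 := fun t ht => by
      by_contra hne
      exact absurd (hηs (subset_tsupport _ hne)) (not_lt.2 ht)
    have hprim : ∀ t, HasDerivAt (fun t => ∫ s in (0 : ℝ)..t, η s) (η t) t := fun t =>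
      (hη.continuous.integral_hasStrictDerivAt 0 t).hasDerivAt
    have hprimS : ContDiff ℝ ∞ (fun t => ∫ s in (0 : ℝ)..t, η s) := by
      refine contDiff_infty_iff_deriv.2 ⟨fun t => (hprim t).differentiableAt, ?_⟩
      rw [show deriv (fun t => ∫ s in (0 : ℝ)..t, η s) = η from funext fun t => (hprim t).deriv]
      exact hη
    have hcS : ∀ t, S ≤ t → ∫ s in (0 : ℝ)..t, η s = c := by
      intro t ht
      rw [intervalIntegral.integral_of_le (hS0.le.trans ht), hc]
      refine setIntegral_eq_integral_of_forall_compl_eq_zero fun s hs => ?_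
      by_cases h0 : s ≤ 0
      · exact hneg s h0
      · exact hS s (by by_contra hlt; exact hs ⟨not_le.1 h0, (not_le.1 hlt).le.trans ht⟩)
    -- The primitive of `η` that vanishes beyond `S`. The smooth step equals one on `[0, ∞)` and
    -- only cuts off negative times, so `θ' = η` where it matters.
    set θ : ℝ → ℝ := fun t => Real.smoothTransition (t + 1) * ((∫ s in (0 : ℝ)..t, η s) - c)
      with hθ
    have hθS : ∀ t, S ≤ t → θ t = 0 := fun t ht => by simp [hθ, hcS t ht]
    have hθneg : ∀ t, t ≤ -1 → θ t = 0 := fun t ht => by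
      simp [hθ, Real.smoothTransition.zero_of_nonpos (show t + 1 ≤ 0 by linarith)]
    have h1 := h θ ((Real.smoothTransition.contDiff.comp (contDiff_id.add contDiff_const)).mul
      (hprimS.sub contDiff_const)) (HasCompactSupport.intro (isCompact_Icc (a := -1) (b := S))
        fun t ht => by
          rw [Set.mem_Icc, not_and_or, not_le, not_le] at ht
          exact ht.elim (fun h => hθneg t h.le) fun h => hθS t h.le) S hS0 hθS
    have h2 : ∀ t, 0 < t → deriv θ t = η t := by
      intro t ht
      have he : θ =ᶠ[𝓝 t] fun t => (∫ s in (0 : ℝ)..t, η s) - c := by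
        filter_upwards [lt_mem_nhds ht] with s hs
        simp [hθ, Real.smoothTransition.one_of_one_le (show 1 ≤ s + 1 by linarith)]
      rw [he.deriv_eq]
      exact ((hprim t).sub_const c).deriv
    have h3 : ∫ t in Set.Ioc 0 S, η t • z t = 0 := by
      rw [← h1]
      refine setIntegral_congr_fun measurableSet_Ioc fun t ht => ?_
      simp only [h2 t ht.1]
    rw [← h3, eq_comm]
    refine setIntegral_eq_integral_of_forall_compl_eq_zero fun s hs => ?_
    by_cases h0 : s ≤ 0
    · rw [hneg s h0, zero_smul]
    · rw [hS s (by by_contra hlt; exact hs ⟨not_le.1 h0, (not_le.1 hlt).le⟩), zero_smul]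
  have h4 : z =ᵐ[volume.restrict (Set.Ioi (0 : ℝ))] fun _ => 0 :=
    (ae_restrict_iff' measurableSet_Ioi).2 hae
  exact Measure.eqOn_open_of_ae_eq h4 isOpen_Ioi hz.continuousOn continuousOn_const ht

/-- With `V` the primitive of `a₀ Y + a * Y`, integration by parts shows that `y - y 0 - V` is
orthogonal to every `θ'`, hence zero; and `V` is the convolution of the integrated kernel with `Y`.
-/
theorem eq_add_volterraConv_of_weak {a₀ : ℝ} {a : ℝ → ℝ} (ha : ∀ X, IntegrableOn a (Set.Ioc 0 X))
    {y Y : ℝ → ℂ} (hy : Continuous y) (hY : Continuous Y)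
    (h : ∀ θ : ℝ → ℝ, ContDiff ℝ ∞ θ → HasCompactSupport θ →
      ∀ S, 0 < S → (∀ t, S ≤ t → θ t = 0) →
      (∫ s in Set.Ioc 0 S, (deriv θ s • y s + a₀ • θ s • Y s
        + volterraConv a (fun q => θ (S - q)) (S - s) • Y s)) + θ 0 • y 0 = 0)
    {t : ℝ} (ht : 0 ≤ t) :
    y t = y 0 + volterraConv (integratedKernel a₀ a) Y t := by
  set K : ℝ → ℂ := fun t => a₀ • Y t + volterraConv a Y t with hK
  have hKc : Continuous K := (hY.const_smul a₀).add (continuous_volterraConv ha hY)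
  set V : ℝ → ℂ := fun t => ∫ s in (0 : ℝ)..t, K s with hV
  have hVd : ∀ t, HasDerivAt V (K t) t := fun t =>
    (hKc.integral_hasStrictDerivAt 0 t).hasDerivAt
  have hVc : Continuous V := continuous_iff_continuousAt.2 fun t => (hVd t).continuousAt
  have hVt : V t = volterraConv (integratedKernel a₀ a) Y t := by
    rw [volterraConv_integratedKernel a₀ ha hY, hV, ← intervalIntegral.integral_of_le ht]
  suffices hz : y t - y 0 - V t = 0 by rw [← hVt]; linear_combination hz
  rcases ht.eq_or_lt with rfl | ht
  · simp [hV]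
  refine eq_zero_of_integral_deriv_smul (z := fun t => y t - y 0 - V t) (by fun_prop)
    (fun θ hθ hθc S hS hθS => ?_) ht
  have h1 := h θ hθ hθc S hS hθS
  have hθ' : Continuous (deriv θ) := hθ.continuous_deriv (by simp)
  have hθd : ∀ t, HasDerivAt θ (deriv θ t) t := fun t =>
    (hθ.differentiable (by simp) t).hasDerivAt
  have hc1 : Continuous fun s => deriv θ s • y s := by fun_prop
  have hc2 : Continuous fun s => a₀ • θ s • Y s := by have := hθ.continuous; fun_prop
  have hc3 : Continuous fun s => volterraConv a (fun q => θ (S - q)) (S - s) • Y s := by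
    have := continuous_volterraConv ha (f := fun q => θ (S - q))
      (hθ.continuous.comp (continuous_const.sub continuous_id))
    fun_prop
  have hc4 : Continuous fun s => θ s • volterraConv a Y s := 
    hθ.continuous.smul (continuous_volterraConv ha hY)
  have i1 : ∀ {f : ℝ → ℂ}, Continuous f → IntegrableOn f (Set.Ioc 0 S) := fun hf =>
    hf.integrableOn_Ioc
  have hadd : ∀ {f g : ℝ → ℂ}, Continuous f → Continuous g →
      ∫ s in Set.Ioc 0 S, (f s + g s) = (∫ s in Set.Ioc 0 S, f s) + ∫ s in Set.Ioc 0 S, g s :=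
    fun hf hg => integral_add (i1 hf) (i1 hg)
  rw [hadd (f := fun s => deriv θ s • y s + a₀ • θ s • Y s) (hc1.add hc2) hc3, hadd hc1 hc2,
    integral_volterraConv_reflect hS.le (ha S) hθ.continuous hY] at h1
  have h2 : ∫ s in Set.Ioc 0 S, (a₀ • θ s • Y s + θ s • volterraConv a Y s)
      = ∫ s in Set.Ioc 0 S, θ s • K s := by
    refine integral_congr_ae (Eventually.of_forall fun s => ?_)
    simp only [hK, smul_add, smul_comm a₀]
  have h3 : ∫ s in (0 : ℝ)..S, (θ s • K s + deriv θ s • V s) = θ S • V S - θ 0 • V 0 := by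
    refine intervalIntegral.integral_eq_sub_of_hasDerivAt (fun s _ => (hθd s).smul (hVd s)) ?_
    have := hθ.continuous
    exact Continuous.intervalIntegrable (by fun_prop) _ _
  have h4 : ∫ s in (0 : ℝ)..S, deriv θ s • y 0 = θ S • y 0 - θ 0 • y 0 := by
    refine intervalIntegral.integral_eq_sub_of_hasDerivAt (fun s _ => (hθd s).smul_const (y 0)) ?_
    exact Continuous.intervalIntegrable (by fun_prop) _ _
  have hV0 : V 0 = 0 := by simp [hV]
  rw [hθS S le_rfl, zero_smul, hV0, smul_zero, sub_zero, intervalIntegral.integral_of_le hS.le,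
    hadd (f := fun s => θ s • K s) (g := fun s => deriv θ s • V s) (hθ.continuous.smul hKc)
      (hθ'.smul hVc)] at h3
  rw [hθS S le_rfl, zero_smul, intervalIntegral.integral_of_le hS.le] at h4
  rw [hadd hc2 hc4] at h2
  simp only [smul_sub]
  rw [integral_sub (i1 (by fun_prop)) (i1 (by fun_prop)),
    integral_sub (i1 (by fun_prop)) (i1 (by fun_prop))]
  linear_combination h1 - h2 - h4 - h3

end WeakEquation

/-! ### The Volterra equation for pairings with a solution. -/

section PairingEquation

variable {E : Type*} [NormedAddCommGroup E] [InnerProductSpace ℝ E]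
  [FiniteDimensional ℝ E] [MeasurableSpace E] [BorelSpace E]

/-- The equation is tested with products `θ(t) φ(x)`, which reduces it to the scalar weak equation.
-/
theorem IsSolution.pairing_eq_of_hasCompactSupport {a₀ : ℝ} {a : ℝ → ℝ} {u₀ : E → ℂ} {σ : ℝ}
    {u : ℝ → 𝓢'(E, ℂ)} (hu : IsSolution a₀ a u₀ σ u) (ha : ∀ X, IntegrableOn a (Set.Ioc 0 X))
    {φ : 𝓢(E, ℂ)} (hφ : HasCompactSupport φ) {t : ℝ} (ht : 0 ≤ t) :
    pairing u φ t = pairing u φ 0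
      + volterraConv (integratedKernel a₀ a) (pairing u (Δ φ)) t := by
  refine eq_add_volterraConv_of_weak ha (hu.continuous.continuous_pairing φ)
    (hu.continuous.continuous_pairing (Δ φ)) (fun θ hθ hθc S hS hθS => ?_) ht
  have hθd : ∀ t, HasDerivAt θ (deriv θ t) t := fun t =>
    (hθ.differentiable (by simp) t).hasDerivAt
  have hlap : ∀ c : ℂ, Δ (c • φ) = c • Δ φ := fun c => by
    simp only [← SchwartzMap.laplacianCLM_eq (𝕜 := ℂ), map_smul]
  have hθS' : ∀ t, S ≤ t → deriv θ t = 0 := by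
    intro t ht
    rcases ht.eq_or_lt with rfl | ht
    · have h1 : deriv θ =ᶠ[𝓝[>] S] fun _ => 0 := by
        filter_upwards [self_mem_nhdsWithin] with s hs
        have : θ =ᶠ[𝓝 s] fun _ => 0 := by
          filter_upwards [lt_mem_nhds (Set.mem_Ioi.1 hs)] with r hr using hθS r hr.le
        rw [this.deriv_eq, deriv_const]
      have h2 : Tendsto (deriv θ) (𝓝[>] S) (𝓝 (deriv θ S)) :=
        ((hθ.continuous_deriv (by simp)).tendsto S).mono_left nhdsWithin_le_nhds
      exact tendsto_nhds_unique h2 (tendsto_const_nhds.congr' h1.symm)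
    · have : θ =ᶠ[𝓝 t] fun _ => 0 := by
        filter_upwards [lt_mem_nhds ht] with r hr using hθS r hr.le
      rw [this.deriv_eq, deriv_const]
  have key := hu.equation (fun t => (θ t : ℂ) • φ) (fun t => ((deriv θ t : ℝ) : ℂ) • φ) ?_ ?_ ?_
  · rw [setIntegral_eq_of_subset_of_forall_sdiff_eq_zero (s := Set.Ioc 0 S) measurableSet_Ioi
      Set.Ioc_subset_Ioi_self] at key
    · rw [← key]
      congr 1
      · refine setIntegral_congr_fun measurableSet_Ioc fun s hs => ?_
        have h1 : ∫ t in Set.Ioi s, (a (t - s) : ℂ) * u s (Δ ((θ t : ℂ) • φ))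
            = volterraConv a (fun q => θ (S - q)) (S - s) • pairing u (Δ φ) s := by
          rw [setIntegral_eq_of_subset_of_forall_sdiff_eq_zero (s := Set.Ioc s S) measurableSet_Ioi
            Set.Ioc_subset_Ioi_self]
          · rw [pairing_of_nonneg u _ hs.1.le, volterraConv, ← integral_smul_const,
              ← intervalIntegral.integral_of_le hs.2,
              ← intervalIntegral.integral_of_le (sub_nonneg.2 hs.2)]
            have := intervalIntegral.integral_comp_add_left (a := 0) (b := S - s)
              (fun t => (a (t - s) : ℂ) * u s (Δ ((θ t : ℂ) • φ))) s
            rw [add_zero, add_sub_cancel] at this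
            rw [← this]
            refine intervalIntegral.integral_congr fun r _ => ?_
            simp only [hlap, map_smul, smul_eq_mul, add_sub_cancel_left, Complex.real_smul]
            rw [show S - (S - s - r) = s + r by ring]
            push_cast
            ring
          · rintro t ⟨ht1, ht2⟩
            have : S ≤ t := by
              by_contra hlt
              exact ht2 ⟨ht1, (not_le.1 hlt).le⟩
            simp only [hlap, map_smul]
            simp only [hθS t this, Complex.ofReal_zero, zero_smul, mul_zero]
        rw [h1]
        simp only [hlap, map_smul, pairing_of_nonneg u _ hs.1.le, Complex.real_smul,
          smul_eq_mul]
      · simp only [pairing, max_self, map_smul, smul_eq_mul, Complex.real_smul]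
    · rintro s ⟨hs1, hs2⟩
      have hsS : S ≤ s := by
        by_contra hlt
        exact hs2 ⟨hs1, (not_le.1 hlt).le⟩
      have h0 : ∫ t in Set.Ioi s, (a (t - s) : ℂ) * u s (Δ ((θ t : ℂ) • φ)) = 0 := by
        rw [setIntegral_congr_fun measurableSet_Ioi (g := fun _ => 0)]
        · simp
        · intro t ht
          simp only [hlap, map_smul]
          simp only [hθS t (hsS.trans (Set.mem_Ioi.1 ht).le), Complex.ofReal_zero, zero_smul,
            mul_zero]
      rw [h0]
      simp only [hlap, map_smul]
      simp only [hθS s hsS, hθS' s hsS, Complex.ofReal_zero, zero_smul, mul_zero, add_zero]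
  · have h1 : ContDiff ℝ ∞ fun p : E × ℝ => (θ p.2 : ℂ) :=
      Complex.ofRealCLM.contDiff.comp (hθ.comp contDiff_snd)
    exact h1.mul ((φ.smooth ⊤).comp contDiff_fst)
  · refine HasCompactSupport.intro (hφ.isCompact.prod hθc.isCompact) fun p hp => ?_
    rw [Set.mem_prod, not_and_or] at hp
    rcases hp with hp | hp
    · simp [image_eq_zero_of_notMem_tsupport hp]
    · simp [image_eq_zero_of_notMem_tsupport hp]
  · intro t x
    exact ((hθd t).ofReal_comp).mul_const (φ x)

/-- Approximation of `φ` by compactly supported functions. The bound in `H^σ`, uniform on `[0, t]`,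
supplies the majorant for the convolution integral. -/
theorem IsSolution.pairing_eq {a₀ : ℝ} {a : ℝ → ℝ} {u₀ : E → ℂ} {σ : ℝ}
    {u : ℝ → 𝓢'(E, ℂ)} (hu : IsSolution a₀ a u₀ σ u) (ha : ∀ X, IntegrableOn a (Set.Ioc 0 X))
    (φ : 𝓢(E, ℂ)) {t : ℝ} (ht : 0 ≤ t) :
    pairing u φ t = pairing u φ 0
      + volterraConv (integratedKernel a₀ a) (pairing u (Δ φ)) t := by
  obtain ⟨φs, hφs, hlim⟩ := exists_seq_hasCompactSupport_tendsto φ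
  have hp : ∀ t, Tendsto (fun n => pairing u (φs n) t) atTop (𝓝 (pairing u φ t)) := fun t =>
    ((u (max t 0)).continuous.tendsto φ).comp hlim
  have hlimΔ : Tendsto (fun n => Δ (φs n)) atTop (𝓝 (Δ φ)) := by
    simp only [← SchwartzMap.laplacianCLM_eq (𝕜 := ℂ)]
    exact ((LineDeriv.laplacianCLM ℂ E 𝓢(E, ℂ)).continuous.tendsto φ).comp hlim
  refine tendsto_nhds_unique (hp t) ?_
  simp_rw [fun n => hu.pairing_eq_of_hasCompactSupport ha (hφs n) ht]
  refine (hp 0).add ?_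
  obtain ⟨M, hM0, hM⟩ := hu.continuous.exists_norm_le t
  have hd : Tendsto (fun n => dualNorm σ (𝓕⁻ (Δ (φs n)))) atTop (𝓝 (dualNorm σ (𝓕⁻ (Δ φ)))) :=
    ((continuous_dualNorm σ).comp (FourierTransform.fourierInvCLM ℂ 𝓢(E, ℂ)).continuous).tendsto _
      |>.comp hlimΔ
  obtain ⟨C, hC⟩ := hd.bddAbove_range
  have hA := integrableOn_integratedKernel a₀ ha t
  refine tendsto_integral_of_dominated_convergence
    (fun s => |integratedKernel a₀ a s| * (M * C)) (fun n => ?_) (hA.abs.mul_const _)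
    (fun n => ?_) ?_
  · exact (integrableOn_volterra_sub hA (hu.continuous.continuous_pairing _)).aestronglyMeasurable
  · refine (ae_restrict_iff' measurableSet_Ioc).2 (Eventually.of_forall fun s hs => ?_)
    rw [norm_smul, Real.norm_eq_abs]
    refine mul_le_mul_of_nonneg_left ?_ (abs_nonneg _)
    have h0 : 0 ≤ t - s := sub_nonneg.2 hs.2
    rw [pairing_of_nonneg u _ h0]
    have h1 := hM (t - s) ⟨h0, by linarith [hs.1]⟩ (𝓕⁻ (Δ (φs n)))
    rw [FourierTransform.fourier_fourierInv_eq] at h1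
    exact h1.trans (mul_le_mul_of_nonneg_left (hC ⟨n, rfl⟩) hM0)
  · refine Eventually.of_forall fun s => ?_
    exact (((u (max (t - s) 0)).continuous.tendsto (Δ φ)).comp hlimΔ).const_smul _

end PairingEquation

/-! ### Uniqueness on bounded sets of frequencies. -/

section FourierUniqueness

variable {E : Type*} [NormedAddCommGroup E] [InnerProductSpace ℝ E]

/-- Multiplication by `-(2π‖η‖)²`, the Fourier symbol of the Laplacian. -/
def laplaceSymbolCLM : 𝓢(E, ℂ) →L[ℂ] 𝓢(E, ℂ) :=
  SchwartzMap.smulLeftCLM ℂ (fun x : E => ((-(2 * Real.pi) ^ 2 * ‖x‖ ^ 2 : ℝ) : ℂ))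

theorem laplaceSymbolCLM_apply (ψ : 𝓢(E, ℂ)) (η : E) :
    laplaceSymbolCLM ψ η = ((-(2 * Real.pi) ^ 2 * ‖η‖ ^ 2 : ℝ) : ℂ) * ψ η := by
  rw [laplaceSymbolCLM, SchwartzMap.smulLeftCLM_apply_apply (by fun_prop), smul_eq_mul]

/-- Restricted to frequencies in a ball, the unbounded symbol acts as a bounded operator; this is
what makes a contraction possible. -/
theorem norm_laplaceSymbolCLM_apply_le {R : ℝ} {ψ : 𝓢(E, ℂ)} (hψ : ∀ η, R < ‖η‖ → ψ η = 0)
    (η : E) : ‖laplaceSymbolCLM ψ η‖ ≤ (2 * Real.pi * R) ^ 2 * ‖ψ η‖ := by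
  rw [laplaceSymbolCLM_apply, norm_mul, Complex.norm_real, Real.norm_eq_abs, neg_mul, abs_neg,
    abs_of_nonneg (by positivity)]
  by_cases h : R < ‖η‖
  · simp [hψ η h]
  · push Not at h
    have := norm_nonneg η
    have : (2 * Real.pi) ^ 2 * ‖η‖ ^ 2 ≤ (2 * Real.pi * R) ^ 2 := by
      rw [mul_pow _ R]; gcongr
    gcongr

variable [FiniteDimensional ℝ E] [MeasurableSpace E] [BorelSpace E]

/-- The tempered distribution given by a bounded function. -/
def boundedDistribution (f : E → ℂ) (hf : MemLp f ⊤ (volume : Measure E)) : 𝓢'(E, ℂ) :=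
  Lp.toTemperedDistribution (hf.toLp f)

theorem boundedDistribution_apply {f : E → ℂ} (hf : MemLp f ⊤ (volume : Measure E))
    (ψ : 𝓢(E, ℂ)) : boundedDistribution f hf ψ = ∫ η, f η * ψ η := by
  rw [boundedDistribution, Lp.toTemperedDistribution_apply]
  refine integral_congr_ae ?_
  filter_upwards [hf.coeFn_toLp] with x hx
  rw [hx, smul_eq_mul, mul_comm]

theorem integrable_mul_schwartz {f : E → ℂ} (hf : MemLp f ⊤ (volume : Measure E))
    (ψ : 𝓢(E, ℂ)) : Integrable fun η => f η * ψ η := by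
  have := (ψ.memLp 1 (volume : Measure E)).mul hf (r := 1)
  exact memLp_one_iff_integrable.1 this

theorem norm_boundedDistribution_apply_le {f : E → ℂ} (hf : MemLp f ⊤ (volume : Measure E))
    {C : ℝ} (hC : ∀ η, ‖f η‖ ≤ C) (ψ : 𝓢(E, ℂ)) :
    ‖boundedDistribution f hf ψ‖ ≤ C * ‖ψ.toLp 1 (volume : Measure E)‖ := by
  rw [boundedDistribution_apply]
  have h1 : ‖ψ.toLp 1 (volume : Measure E)‖ = ∫ η, ‖ψ η‖ := by
    rw [L1.norm_eq_integral_norm]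
    refine integral_congr_ae ?_
    filter_upwards [ψ.coeFn_toLp 1 (volume : Measure E)] with x hx
    rw [hx]
  rw [h1, ← integral_const_mul]
  refine norm_integral_le_of_norm_le (ψ.integrable.norm.const_mul C)
    (Eventually.of_forall fun η => ?_)
  rw [norm_mul]
  exact mul_le_mul_of_nonneg_right (hC η) (norm_nonneg _)

/-- A norm on test functions which controls the Fourier transforms of `H^σ` functions and of
integrable functions. -/
def testNorm (σ : ℝ) (ψ : 𝓢(E, ℂ)) : ℝ := dualNorm σ ψ + ‖ψ.toLp 1 (volume : Measure E)‖

theorem testNorm_nonneg (σ : ℝ) (ψ : 𝓢(E, ℂ)) : 0 ≤ testNorm σ ψ :=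
  add_nonneg (dualNorm_nonneg _ _) (norm_nonneg _)

theorem testNorm_laplaceSymbolCLM_le (σ : ℝ) {R : ℝ} {ψ : 𝓢(E, ℂ)}
    (hψ : ∀ η, R < ‖η‖ → ψ η = 0) :
    testNorm σ (laplaceSymbolCLM ψ) ≤ (2 * Real.pi * R) ^ 2 * testNorm σ ψ := by
  rw [testNorm, testNorm, mul_add]
  refine add_le_add ?_ ?_
  · refine Lp.norm_le_mul_norm_of_ae_le_mul ?_
    filter_upwards [SchwartzMap.coeFn_toLp (SchwartzMap.smulLeftCLM ℂ
      (fun x : E => (((1 + ‖x‖ ^ 2) ^ (-σ / 2) : ℝ) : ℂ)) ψ) 2 (volume : Measure E),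
      SchwartzMap.coeFn_toLp (SchwartzMap.smulLeftCLM ℂ
      (fun x : E => (((1 + ‖x‖ ^ 2) ^ (-σ / 2) : ℝ) : ℂ)) (laplaceSymbolCLM ψ)) 2
        (volume : Measure E)] with x h1 h2
    rw [h1, h2, SchwartzMap.smulLeftCLM_apply_apply (by fun_prop),
      SchwartzMap.smulLeftCLM_apply_apply (by fun_prop), norm_smul, norm_smul]
    have := norm_laplaceSymbolCLM_apply_le hψ x
    calc _ ≤ ‖(((1 + ‖x‖ ^ 2) ^ (-σ / 2) : ℝ) : ℂ)‖ * ((2 * Real.pi * R) ^ 2 * ‖ψ x‖) := by gcongr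
      _ = _ := by ring
  · refine Lp.norm_le_mul_norm_of_ae_le_mul ?_
    filter_upwards [SchwartzMap.coeFn_toLp ψ 1 (volume : Measure E),
      SchwartzMap.coeFn_toLp (laplaceSymbolCLM ψ) 1 (volume : Measure E)] with x h1 h2
    rw [h1, h2]
    exact norm_laplaceSymbolCLM_apply_le hψ x

/-- A family of functionals satisfying the Volterra equation of the Laplacian symbol vanishes on
test functions with bounded support. -/
theorem eq_zero_of_volterra_laplaceSymbol {A : ℝ → ℝ} {X M σ R : ℝ}
    (hA : IntegrableOn A (Set.Ioc 0 X)) {D : 𝓢(E, ℂ) → ℝ → ℂ}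
    (hM : ∀ ψ, ∀ t ∈ Set.Icc 0 X, ‖D ψ t‖ ≤ M * testNorm σ ψ)
    (hD : ∀ ψ, ∀ t ∈ Set.Icc 0 X, D ψ t = volterraConv A (D (laplaceSymbolCLM ψ)) t)
    {ψ : 𝓢(E, ℂ)} (hψ : ∀ η, R < ‖η‖ → ψ η = 0) {t : ℝ} (ht : t ∈ Set.Icc 0 X) : D ψ t = 0 := by
  obtain ⟨μ, hμ0, hμ⟩ : ∃ μ : ℝ, 0 ≤ μ ∧ weightedMass A X μ * (2 * Real.pi * R) ^ 2 ≤ 1 / 2 := by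
    have h := (tendsto_weightedMass hA).mul_const ((2 * Real.pi * R) ^ 2)
    rw [zero_mul] at h
    obtain ⟨μ, h1, h2⟩ := ((eventually_ge_atTop (0 : ℝ)).and
      (h.eventually_le_const (by norm_num : (0 : ℝ) < 1 / 2))).exists
    exact ⟨μ, h1, h2⟩
  have hM0 : ∀ ψ, ∀ t ∈ Set.Icc 0 X, testNorm σ ψ = 0 → D ψ t = 0 := fun ψ t ht h => by
    have := hM ψ t ht
    rw [h, mul_zero] at this
    exact norm_le_zero_iff.1 this
  let ι := {ψ : 𝓢(E, ℂ) // ∀ η, R < ‖η‖ → ψ η = 0} × Set.Icc (0 : ℝ) X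
  -- The supremum runs over times and test functions together, as the equation replaces `ψ` by its
  -- product with the symbol. If `testNorm` is zero, the quotient is zero by convention and `hM0`
  -- takes over.
  let e : ι → ℝ := fun i => ‖D i.1 i.2‖ * Real.exp (-(μ * i.2)) / testNorm σ i.1.1
  have key : ∀ i, e i ≤ 2 * 0 := by
    refine le_two_mul_of_half_contraction (M := |M|) (fun i => ?_) fun S hS i => ?_
    · refine div_le_of_le_mul₀ (testNorm_nonneg _ _) (abs_nonneg _) ?_
      have h1 : Real.exp (-(μ * i.2)) ≤ 1 := by
        rw [Real.exp_le_one_iff]; nlinarith [i.2.2.1]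
      have h2 := (hM i.1 i.2 i.2.2).trans
        (mul_le_mul_of_nonneg_right (le_abs_self M) (testNorm_nonneg σ _))
      nlinarith [norm_nonneg (D i.1 i.2), Real.exp_pos (-(μ * i.2))]
    · have hS0 : 0 ≤ S := le_trans (div_nonneg (by positivity) (testNorm_nonneg _ _)) (hS i)
      have hall : ∀ ψ : 𝓢(E, ℂ), (∀ η, R < ‖η‖ → ψ η = 0) → ∀ τ ∈ Set.Icc 0 X,
          ‖D ψ τ‖ ≤ S * testNorm σ ψ * Real.exp (μ * τ) := by
        intro ψ hψ τ hτ
        rcases (testNorm_nonneg σ ψ).eq_or_lt with h | h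
        · simp [hM0 ψ τ hτ h.symm, ← h]
        · have h1 := hS (⟨ψ, hψ⟩, ⟨τ, hτ⟩)
          simp only [e] at h1
          rw [div_le_iff₀ h, Real.exp_neg, ← div_eq_mul_inv, div_le_iff₀ (Real.exp_pos _)] at h1
          exact h1
      obtain ⟨⟨ψ, hψ⟩, ⟨t, ht⟩⟩ := i
      have hLψ : ∀ η, R < ‖η‖ → laplaceSymbolCLM ψ η = 0 := fun η h => by
        rw [laplaceSymbolCLM_apply, hψ η h, mul_zero]
      have h1 := norm_volterraConv_le hA μ (hall _ hLψ) ht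
      rw [← hD ψ t ht] at h1
      have h2 := testNorm_laplaceSymbolCLM_le σ hψ
      have h3 := testNorm_nonneg σ ψ
      have h4 := weightedMass_nonneg A X μ
      simp only [e, zero_add]
      refine div_le_of_le_mul₀ h3 (by positivity) ?_
      rw [Real.exp_neg, ← div_eq_mul_inv, div_le_iff₀ (Real.exp_pos _)]
      refine h1.trans (mul_le_mul_of_nonneg_right ?_ (Real.exp_pos _).le)
      calc weightedMass A X μ * (S * testNorm σ (laplaceSymbolCLM ψ))
          ≤ weightedMass A X μ * (S * ((2 * Real.pi * R) ^ 2 * testNorm σ ψ)) := by gcongr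
        _ = (weightedMass A X μ * (2 * Real.pi * R) ^ 2) * (S * testNorm σ ψ) := by ring
        _ ≤ 1 / 2 * (S * testNorm σ ψ) := by gcongr
        _ = _ := by ring
  have h1 := key (⟨ψ, hψ⟩, ⟨t, ht⟩)
  simp only [e, mul_zero] at h1
  rcases (testNorm_nonneg σ ψ).eq_or_lt with h | h
  · exact hM0 ψ t ht h.symm
  · rw [div_le_iff₀ h, zero_mul] at h1
    have h2 := Real.exp_pos (-(μ * t))
    have h3 : ‖D ψ t‖ ≤ 0 := by
      by_contra hlt
      push Not at hlt
      nlinarith [mul_pos hlt h2]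
    exact norm_le_zero_iff.1 h3

end FourierUniqueness

/-! ### The Fourier transform of the solution. -/

section FourierSolution

variable {E : Type*} [NormedAddCommGroup E] [InnerProductSpace ℝ E]
  [FiniteDimensional ℝ E] [MeasurableSpace E] [BorelSpace E]

theorem continuous_fourier {f : E → ℂ} (hf : Integrable f) : Continuous (𝓕 f) :=
  VectorFourier.fourierIntegral_continuous Real.continuous_fourierChar
    (innerSL ℝ).continuous₂ hf

theorem norm_fourier_le (f : E → ℂ) (η : E) : ‖𝓕 f η‖ ≤ ∫ x, ‖f x‖ :=
  VectorFourier.norm_fourierIntegral_le_integral_norm _ _ _ _ _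

theorem integral_mul_fourier_schwartz {f : E → ℂ} (hf : Integrable f) (ψ : 𝓢(E, ℂ)) :
    ∫ x, f x * (𝓕 ψ) x = ∫ η, 𝓕 f η * ψ η := by
  have h := VectorFourier.integral_fourierIntegral_smul_eq_flip (L := innerₗ E)
    Real.continuous_fourierChar continuous_inner hf ψ.integrable (μ := volume) (ν := volume)
  rw [flip_innerₗ] at h
  exact h.symm

/-- The Fourier transform `û₀(η) w(|2πη|², t)` of the solution. -/
def solutionSymbol (A : ℝ → ℝ) (u₀ : E → ℂ) (t : ℝ) (η : E) : ℂ :=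
  𝓕 u₀ η * (volterraSol A ((2 * Real.pi) ^ 2 * ‖η‖ ^ 2) t : ℂ)

variable {A : ℝ → ℝ} {u₀ : E → ℂ}

theorem continuous_solutionSymbol
    (hA : ∀ X, IntegrableOn A (Set.Ioc 0 X)) (hu₀ : Integrable u₀) :
    Continuous fun p : ℝ × E => solutionSymbol A u₀ p.1 p.2 := by
  have h1 := (continuous_fourier hu₀).comp (continuous_snd (X := ℝ) (Y := E))
  have h2 : Continuous fun p : ℝ × E => volterraSol A ((2 * Real.pi) ^ 2 * ‖p.2‖ ^ 2) p.1 :=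
    (continuous_volterraSol hA).comp (f := fun p : ℝ × E => ((2 * Real.pi) ^ 2 * ‖p.2‖ ^ 2, p.1))
      (by fun_prop)
  exact h1.mul (Complex.continuous_ofReal.comp h2)

theorem norm_solutionSymbol_le
    (hbound : ∀ z, 0 ≤ z → ∀ t, |volterraSol A z t| ≤ 1) (t : ℝ) (η : E) :
    ‖solutionSymbol A u₀ t η‖ ≤ ∫ x, ‖u₀ x‖ := by
  rw [solutionSymbol, norm_mul, Complex.norm_real]
  have h1 := norm_fourier_le u₀ η
  have h2 := hbound ((2 * Real.pi) ^ 2 * ‖η‖ ^ 2) (by positivity) t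
  calc ‖𝓕 u₀ η‖ * ‖volterraSol A ((2 * Real.pi) ^ 2 * ‖η‖ ^ 2) t‖ ≤ (∫ x, ‖u₀ x‖) * 1 :=
        mul_le_mul h1 h2 (norm_nonneg _) (integral_nonneg fun _ => norm_nonneg _)
    _ = _ := mul_one _

theorem memLp_solutionSymbol
    (hA : ∀ X, IntegrableOn A (Set.Ioc 0 X))
    (hbound : ∀ z, 0 ≤ z → ∀ t, |volterraSol A z t| ≤ 1) (hu₀ : Integrable u₀) (t : ℝ) :
    MemLp (solutionSymbol A u₀ t) ⊤ (volume : Measure E) :=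
  memLp_top_of_bound ((continuous_solutionSymbol hA hu₀).comp
    (continuous_const.prodMk continuous_id)).aestronglyMeasurable _
    (Eventually.of_forall (norm_solutionSymbol_le hbound t))

/-- The scalar Volterra equation at `z = (2π‖η‖)²`, integrated against `𝓕 u₀ η * ψ η`, with Fubini
for the time convolution. -/
theorem integral_solutionSymbol_mul_eq
    (hA : ∀ X, IntegrableOn A (Set.Ioc 0 X))
    (hbound : ∀ z, 0 ≤ z → ∀ t, |volterraSol A z t| ≤ 1) (hu₀ : Integrable u₀) (ψ : 𝓢(E, ℂ)) (t : ℝ) :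
    ∫ η, solutionSymbol A u₀ t η * ψ η = (∫ η, 𝓕 u₀ η * ψ η)
      + volterraConv A (fun τ => ∫ η, solutionSymbol A u₀ τ η * laplaceSymbolCLM ψ η) t := by
  have hmeas : MemLp (𝓕 u₀) ⊤ (volume : Measure E) :=
    memLp_top_of_bound (continuous_fourier hu₀).aestronglyMeasurable _
      (Eventually.of_forall (norm_fourier_le u₀))
  have hswap : volterraConv A (fun τ => ∫ η, solutionSymbol A u₀ τ η * laplaceSymbolCLM ψ η) t
      = ∫ η, ∫ s in Set.Ioc 0 t, A s • (solutionSymbol A u₀ (t - s) η * laplaceSymbolCLM ψ η) := by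
    rw [volterraConv]
    simp_rw [← integral_smul]
    refine integral_integral_swap (f := fun s η => A s • (solutionSymbol A u₀ (t - s) η
      * laplaceSymbolCLM ψ η)) ?_
    have h1 : Integrable (fun p : ℝ × E => A p.1 • laplaceSymbolCLM ψ p.2)
        ((volume.restrict (Set.Ioc 0 t)).prod (volume : Measure E)) :=
      (hA t).smul_prod (laplaceSymbolCLM ψ).integrable
    have h2 := h1.bdd_mul (f := fun p : ℝ × E => solutionSymbol A u₀ (t - p.1) p.2)
      (c := ∫ x, ‖u₀ x‖) ((continuous_solutionSymbol hA hu₀).comp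
        (f := fun p : ℝ × E => (t - p.1, p.2)) (by fun_prop)).aestronglyMeasurable
      (Eventually.of_forall fun p => norm_solutionSymbol_le hbound _ _)
    refine h2.congr (Eventually.of_forall fun p => ?_)
    simp only [Function.uncurry, Complex.real_smul]
    ring
  rw [hswap, ← sub_eq_iff_eq_add',
    ← integral_sub (integrable_mul_schwartz (memLp_solutionSymbol hA hbound hu₀ t) ψ)
      (integrable_mul_schwartz hmeas ψ)]
  refine integral_congr_ae (Eventually.of_forall fun η => ?_)
  have h3 := volterraSol_eq hA ((2 * Real.pi) ^ 2 * ‖η‖ ^ 2) t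
  have h4 : ∫ s in Set.Ioc 0 t, A s • (solutionSymbol A u₀ (t - s) η * laplaceSymbolCLM ψ η)
      = ((volterraConv A (volterraSol A ((2 * Real.pi) ^ 2 * ‖η‖ ^ 2)) t : ℝ) : ℂ)
        * (𝓕 u₀ η * laplaceSymbolCLM ψ η) := by
    rw [volterraConv, ← integral_complex_ofReal, ← integral_mul_const]
    refine integral_congr_ae (Eventually.of_forall fun s => ?_)
    simp only [solutionSymbol, Complex.real_smul, smul_eq_mul, Complex.ofReal_mul]
    ring
  beta_reduce
  rw [h4, laplaceSymbolCLM_apply, solutionSymbol, h3]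
  push_cast
  ring

theorem continuous_integral_solutionSymbol
    (hA : ∀ X, IntegrableOn A (Set.Ioc 0 X))
    (hbound : ∀ z, 0 ≤ z → ∀ t, |volterraSol A z t| ≤ 1) (hu₀ : Integrable u₀) (ψ : 𝓢(E, ℂ)) :
    Continuous fun t => ∫ η, solutionSymbol A u₀ t η * ψ η := by
  refine continuous_of_dominated (bound := fun η => (∫ x, ‖u₀ x‖) * ‖ψ η‖)
    (fun t => (integrable_mul_schwartz (memLp_solutionSymbol hA hbound hu₀ t) ψ).1)
    (fun t => Eventually.of_forall fun η => ?_) (ψ.integrable.norm.const_mul _)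
    (Eventually.of_forall fun η => ?_)
  · rw [norm_mul]
    exact mul_le_mul_of_nonneg_right (norm_solutionSymbol_le hbound t η) (norm_nonneg _)
  · exact ((continuous_solutionSymbol hA hu₀).comp
      (continuous_id.prodMk continuous_const)).mul continuous_const

/-- The difference `D` of the two sides satisfies the homogeneous Volterra equation, since the
initial values cancel. It vanishes on compactly supported `ψ` by uniqueness, and on all `ψ` because
both sides are tempered distributions. The exponent `σ` enters only through `testNorm`. -/
theorem IsSolution.fourier_apply {a₀ : ℝ} {a : ℝ → ℝ} {u₀ : E → ℂ} {σ : ℝ}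
    {u : ℝ → 𝓢'(E, ℂ)} (hu : IsSolution a₀ a u₀ σ u) (ha : ∀ X, IntegrableOn a (Set.Ioc 0 X))
    (hu₀ : Integrable u₀)
    (hbound : ∀ z, 0 ≤ z → ∀ t, |volterraSol (integratedKernel a₀ a) z t| ≤ 1)
    (ψ : 𝓢(E, ℂ)) {t : ℝ} (ht : 0 ≤ t) :
    𝓕 (u t) ψ = ∫ η, solutionSymbol (integratedKernel a₀ a) u₀ t η * ψ η := by
  set A := integratedKernel a₀ a
  have hA : ∀ X, IntegrableOn A (Set.Ioc 0 X) := integrableOn_integratedKernel a₀ ha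
  set D : 𝓢(E, ℂ) → ℝ → ℂ := fun ψ τ =>
    pairing u (𝓕 ψ) τ - ∫ η, solutionSymbol A u₀ τ η * ψ η with hDdef
  obtain ⟨M, hM0, hM⟩ := hu.continuous.exists_norm_le t
  set C := ∫ x, ‖u₀ x‖ with hC
  have hC0 : 0 ≤ C := integral_nonneg fun _ => norm_nonneg _
  have hDle : ∀ ψ, ∀ τ ∈ Set.Icc 0 t, ‖D ψ τ‖ ≤ (M + C) * testNorm σ ψ := by
    intro ψ τ hτ
    have h1 := hM τ hτ ψ
    have h2 := norm_boundedDistribution_apply_le (memLp_solutionSymbol hA hbound hu₀ τ)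
      (norm_solutionSymbol_le hbound τ) ψ
    rw [boundedDistribution_apply] at h2
    rw [hDdef]
    beta_reduce
    rw [pairing_of_nonneg u _ hτ.1]
    refine (norm_sub_le _ _).trans ((add_le_add h1 h2).trans ?_)
    have h3 := dualNorm_nonneg σ ψ
    have h4 := norm_nonneg (ψ.toLp 1 (volume : Measure E))
    rw [testNorm]
    nlinarith [mul_nonneg hM0 h4, mul_nonneg hC0 h3]
  have hDeq : ∀ ψ, ∀ τ ∈ Set.Icc 0 t, D ψ τ = volterraConv A (D (laplaceSymbolCLM ψ)) τ := by
    intro ψ τ hτ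
    have h1 := hu.pairing_eq ha (𝓕 ψ) hτ.1
    have h2 := integral_solutionSymbol_mul_eq hA hbound hu₀ ψ τ
    have h3 : pairing u (𝓕 ψ) 0 = ∫ η, 𝓕 u₀ η * ψ η := by
      rw [pairing_of_nonneg u _ le_rfl, hu.initial, integral_mul_fourier_schwartz hu₀]
    have h4 : pairing u (Δ (𝓕 ψ)) = pairing u (𝓕 (laplaceSymbolCLM ψ)) :=
      funext fun s => apply_laplacian_fourier _ ψ
    rw [hDdef]
    beta_reduce
    rw [h1, h2, h3, h4, add_sub_add_left_eq_sub, volterraConv, volterraConv, volterraConv,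
      ← integral_sub (integrableOn_volterra_sub (hA τ) (hu.continuous.continuous_pairing _))
        (integrableOn_volterra_sub (hA τ) (continuous_integral_solutionSymbol hA hbound hu₀ _))]
    simp_rw [smul_sub]
  obtain ⟨ψs, hψs, hlim⟩ := exists_seq_hasCompactSupport_tendsto ψ
  have hzero : ∀ n, D (ψs n) t = 0 := by
    intro n
    obtain ⟨R, hR⟩ := (hψs n).isCompact.isBounded.subset_closedBall (0 : E)
    refine eq_zero_of_volterra_laplaceSymbol (R := R) (hA t) hDle hDeq (fun η hη => ?_)
      ⟨ht, le_rfl⟩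
    refine image_eq_zero_of_notMem_tsupport fun h => ?_
    have := hR h
    rw [mem_closedBall_zero_iff] at this
    exact absurd this (not_le.2 hη)
  have hlim1 : Tendsto (fun n => 𝓕 (u t) (ψs n)) atTop (𝓝 (𝓕 (u t) ψ)) :=
    ((𝓕 (u t)).continuous.tendsto ψ).comp hlim
  have hm := memLp_solutionSymbol hA hbound hu₀ t
  have hlim2 : Tendsto (fun n => boundedDistribution _ hm (ψs n)) atTop
      (𝓝 (boundedDistribution _ hm ψ)) :=
    ((boundedDistribution _ hm).continuous.tendsto ψ).comp hlim
  rw [← boundedDistribution_apply hm]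
  refine tendsto_nhds_unique hlim1 (hlim2.congr fun n => ?_)
  have h := hzero n
  rw [hDdef] at h
  beta_reduce at h
  rw [pairing_of_nonneg u _ ht, sub_eq_zero] at h
  rw [boundedDistribution_apply, TemperedDistribution.fourier_apply, h]

end FourierSolution

/-! ### Symbols under dilation and weighted convergence. -/

section SelfSimilarLimit

section

variable {E : Type*} [NormedAddCommGroup E]

/-- The Fourier transform `w_∞(|2πη|², t)` of the self-similar profile. -/
def limitSymbol (β t : ℝ) (η : E) : ℂ :=
  (volterraSol (powerKernel β) ((2 * Real.pi) ^ 2 * ‖η‖ ^ 2) t : ℂ)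

theorem mittagLeffler_eq_limitSymbol [NormedSpace ℝ E] {β : ℝ} (hβ : -1 < β) {t : ℝ}
    (ht : 0 ≤ t) (η : E) :
    mittagLeffler (1 + β) ((-(‖(2 * Real.pi) • η‖ ^ 2 * t ^ (1 + β)) : ℝ) : ℂ)
      = limitSymbol β t η := by
  rw [limitSymbol, ← mittagLeffler_eq_volterraSol hβ _ ht, norm_smul,
    Real.norm_of_nonneg (by positivity), mul_pow]

theorem norm_limitSymbol_le {A : ℝ → ℝ} {β : ℝ} (hA : RegularlyVarying A β)
    (hc : ContinuousOn A (Set.Ici 0)) (hβ : -1 < β)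
    (hbound : ∀ z, 0 ≤ z → ∀ t, |volterraSol A z t| ≤ 1) {t : ℝ} (ht : 0 ≤ t) (η : E) :
    ‖limitSymbol β t η‖ ≤ 1 := by
  rw [limitSymbol, Complex.norm_real]
  exact abs_volterraSol_powerKernel_le_one hA hc hβ hbound (by positivity) ht

theorem continuous_limitSymbol {β : ℝ} (hβ : -1 < β) (t : ℝ) :
    Continuous (limitSymbol β t : E → ℂ) :=
  Complex.continuous_ofReal.comp ((continuous_volterraSol (integrableOn_powerKernel hβ)).comp
    (f := fun η : E => ((2 * Real.pi) ^ 2 * ‖η‖ ^ 2, t)) (by fun_prop))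

end

variable {E : Type*} [NormedAddCommGroup E] [InnerProductSpace ℝ E]
  [FiniteDimensional ℝ E] [MeasurableSpace E] [BorelSpace E]

theorem besselPotential_eq_of_fourier_eq {s : ℝ} {v : 𝓢'(E, ℂ)} {F : E → ℂ}
    (hv : ∀ ψ : 𝓢(E, ℂ), 𝓕 v ψ = ∫ η, F η * ψ η)
    (hF : MemLp (fun η => (((1 + ‖η‖ ^ 2) ^ (s / 2) : ℝ) : ℂ) * F η) 2 (volume : Measure E)) :
    TemperedDistribution.besselPotential E ℂ s v
      = ((𝓕⁻ hF.toLp : Lp ℂ 2 (volume : Measure E)) : 𝓢'(E, ℂ)) := by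
  have h : 𝓕 (TemperedDistribution.besselPotential E ℂ s v)
      = ((hF.toLp : Lp ℂ 2 (volume : Measure E)) : 𝓢'(E, ℂ)) := by
    ext ψ
    rw [TemperedDistribution.fourier_besselPotential_eq_smulLeftCLM_fourier_apply,
      TemperedDistribution.smulLeftCLM_apply_apply, hv, Lp.toTemperedDistribution_apply]
    refine integral_congr_ae ?_
    filter_upwards [hF.coeFn_toLp] with η hη
    rw [hη, SchwartzMap.smulLeftCLM_apply_apply (by fun_prop), smul_eq_mul, smul_eq_mul]
    ring
  rw [← Lp.fourierInv_toTemperedDistribution_eq, ← h, FourierTransform.fourierInv_fourier_eq]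

theorem memSobolev_of_fourier_eq {s : ℝ} {v : 𝓢'(E, ℂ)} {F : E → ℂ}
    (hv : ∀ ψ : 𝓢(E, ℂ), 𝓕 v ψ = ∫ η, F η * ψ η)
    (hF : MemLp (fun η => (((1 + ‖η‖ ^ 2) ^ (s / 2) : ℝ) : ℂ) * F η) 2 (volume : Measure E)) :
    TemperedDistribution.MemSobolev s 2 v :=
  ⟨_, besselPotential_eq_of_fourier_eq hv hF⟩

theorem sobolevENorm_le_of_fourier_eq {s : ℝ} {v : 𝓢'(E, ℂ)} {F : E → ℂ}
    (hv : ∀ ψ : 𝓢(E, ℂ), 𝓕 v ψ = ∫ η, F η * ψ η)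
    (hF : MemLp (fun η => (((1 + ‖η‖ ^ 2) ^ (s / 2) : ℝ) : ℂ) * F η) 2 (volume : Measure E)) :
    sobolevENorm s v
      ≤ eLpNorm (fun η => (((1 + ‖η‖ ^ 2) ^ (s / 2) : ℝ) : ℂ) * F η) 2 (volume : Measure E) := by
  rw [sobolevENorm]
  refine (iInf₂_le (𝓕⁻ hF.toLp : Lp ℂ 2 (volume : Measure E))
    (besselPotential_eq_of_fourier_eq hv hF)).trans_eq ?_
  have h : ‖(𝓕⁻ hF.toLp : Lp ℂ 2 (volume : Measure E))‖
      = ‖(hF.toLp : Lp ℂ 2 (volume : Measure E))‖ := by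
    rw [← Lp.norm_fourier_eq, FourierTransform.fourier_fourierInv_eq]
  rw [← ofReal_norm, h, ofReal_norm, Lp.enorm_toLp]

theorem dilateTest_fourier {K : ℝ} (hK : 0 < K) (ψ : 𝓢(E, ℂ)) :
    dilateTest K hK.ne' (𝓕 ψ)
      = 𝓕 (((K ^ Module.finrank ℝ E : ℝ) : ℂ) • dilateTest K⁻¹ (inv_ne_zero hK.ne') ψ) := by
  ext x
  rw [dilateTest_apply, SchwartzMap.fourier_coe, SchwartzMap.fourier_coe, Real.fourier_eq,
    Real.fourier_eq]
  have h := Measure.integral_comp_smul (volume : Measure E)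
    (fun v => Real.fourierChar (-inner ℝ v (K⁻¹ • x)) • ψ v) K
  rw [abs_of_pos (by positivity), eq_inv_smul_iff₀ (by positivity)] at h
  rw [← h, ← integral_smul]
  refine integral_congr_ae (Eventually.of_forall fun v => ?_)
  beta_reduce
  rw [smul_apply, dilateTest_apply, inv_inv, inner_smul_left, inner_smul_right]
  simp only [RCLike.conj_to_real, mul_inv_cancel_left₀ hK.ne', Complex.real_smul, smul_eq_mul]
  rw [Circle.smul_def, Circle.smul_def, smul_eq_mul, smul_eq_mul]
  ring

theorem fourier_dilate {K : ℝ} (hK : 0 < K) {v : 𝓢'(E, ℂ)} {F : E → ℂ}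
    (hv : ∀ ψ : 𝓢(E, ℂ), 𝓕 v ψ = ∫ η, F η * ψ η) (ψ : 𝓢(E, ℂ)) :
    𝓕 (dilate K v) ψ = ∫ η, F (K⁻¹ • η) * ψ η := by
  rw [TemperedDistribution.fourier_apply, dilate_apply K hK.ne', dilateTest_fourier hK,
    ← TemperedDistribution.fourier_apply, map_smul, hv]
  have h := Measure.integral_comp_smul (volume : Measure E) (fun η => F (K⁻¹ • η) * ψ η) K
  rw [abs_of_pos (by positivity), eq_inv_smul_iff₀ (by positivity)] at h
  rw [← h, Complex.real_smul, smul_eq_mul]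
  congr 1
  refine integral_congr_ae (Eventually.of_forall fun η => ?_)
  beta_reduce
  rw [dilateTest_apply, inv_inv, inv_smul_smul₀ hK.ne']

/-- The square of the weight is `(1 + ‖η‖²)^s`, and `-2s` exceeds the dimension. -/
theorem memLp_sobolevWeight {s : ℝ} (hs : s < -(Module.finrank ℝ E : ℝ) / 2) :
    MemLp (fun η : E => (1 + ‖η‖ ^ 2) ^ (s / 2)) 2 (volume : Measure E) := by
  have hs' : (Module.finrank ℝ E : ℝ) < 2 * -s := by linarith
  have hc : Continuous fun η : E => (1 + ‖η‖ ^ 2) ^ (s / 2) := by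
    have : (fun x : E ↦ (1 + ‖x‖ ^ 2) ^ (s / 2)).HasTemperateGrowth := by fun_prop
    exact this.1.continuous
  rw [memLp_two_iff_integrable_sq hc.aestronglyMeasurable]
  refine (integrable_rpow_neg_one_add_norm_sq hs').congr (Eventually.of_forall fun η => ?_)
  beta_reduce
  rw [← Real.rpow_mul_natCast (by positivity)]
  congr 1
  push_cast
  ring

theorem memLp_weight_mul {f : E → ℝ} (hf : MemLp f 2 (volume : Measure E)) {F : E → ℂ} {C : ℝ}
    (hF : Continuous F) (hC : ∀ η, ‖F η‖ ≤ C) :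
    MemLp (fun η => (f η : ℂ) * F η) 2 (volume : Measure E) := by
  refine hf.of_le_mul (c := C)
    ((Complex.continuous_ofReal.comp_aestronglyMeasurable hf.1).mul hF.aestronglyMeasurable)
    (Eventually.of_forall fun η => ?_)
  rw [norm_mul, Complex.norm_real, mul_comm]
  exact mul_le_mul_of_nonneg_right (hC η) (norm_nonneg _)

/-- A family of uniformly bounded functions which tends to zero uniformly on bounded sets tends to
zero in the weighted space, if the weight is square integrable. -/
theorem exists_eLpNorm_weight_mul_lt {f : E → ℝ} (hf : MemLp f 2 (volume : Measure E)) (C : ℝ)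
    {ε : ℝ≥0∞} (hε : 0 < ε) : ∃ R δ : ℝ, 0 < δ ∧ ∀ F : E → ℂ, Continuous F → (∀ η, ‖F η‖ ≤ C) →
      (∀ η, ‖η‖ ≤ R → ‖F η‖ ≤ δ) →
      eLpNorm (fun η => (f η : ℂ) * F η) 2 (volume : Measure E) < ε := by
  obtain ⟨ε₁, hε₁, hlt⟩ := exists_between hε
  have hε2 : ε₁ / 2 ≠ 0 := by simp [hε₁.ne']
  -- Outside a ball containing the support of `g`, the error `C f - g` is `C f` itself and dominates
  -- `f F`; inside, the smallness of `F` is used.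
  obtain ⟨g, hg, hfg, hgc, hgL⟩ := (hf.const_mul C).exists_hasCompactSupport_eLpNorm_sub_le
    (by simp) hε2
  obtain ⟨R, hR⟩ := hg.isCompact.isBounded.subset_closedBall (0 : E)
  obtain ⟨δ, hδ, hδε⟩ := ENNReal.exists_nnreal_pos_mul_lt hf.2.ne hε2
  refine ⟨R, δ, hδ, fun F hF hC hsmall => ?_⟩
  have hpt : ∀ η, ‖(f η : ℂ) * F η‖ ≤ (δ : ℝ) * ‖f η‖ + ‖C * f η - g η‖ := by
    intro η
    rw [norm_mul, Complex.norm_real, mul_comm]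
    by_cases h : ‖η‖ ≤ R
    · have := mul_le_mul_of_nonneg_right (hsmall η h) (norm_nonneg (f η))
      linarith [norm_nonneg (C * f η - g η)]
    · have hg0 : g η = 0 := image_eq_zero_of_notMem_tsupport fun hη =>
        h (by simpa using hR hη)
      have hC0 : 0 ≤ C := (norm_nonneg _).trans (hC 0)
      rw [hg0, sub_zero, norm_mul C, Real.norm_of_nonneg hC0]
      have := mul_le_mul_of_nonneg_right (hC η) (norm_nonneg (f η))
      have hδf : 0 ≤ (δ : ℝ) * ‖f η‖ := by positivity
      linarith
  have h1 : eLpNorm (fun η => (δ : ℝ) * ‖f η‖) 2 (volume : Measure E)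
      = δ * eLpNorm f 2 (volume : Measure E) := by
    have := eLpNorm_const_smul (δ : ℝ) (fun η => ‖f η‖) 2 (volume : Measure E)
    rw [eLpNorm_norm] at this
    simpa using! this
  calc eLpNorm (fun η => (f η : ℂ) * F η) 2 (volume : Measure E)
      ≤ eLpNorm ((fun η => (δ : ℝ) * ‖f η‖) + fun η => ‖C * f η - g η‖) 2 volume := by
        refine eLpNorm_mono fun η => (hpt η).trans (le_abs_self _)
    _ ≤ eLpNorm (fun η => (δ : ℝ) * ‖f η‖) 2 volume
          + eLpNorm (fun η => ‖C * f η - g η‖) 2 volume :=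
        eLpNorm_add_le (hf.1.norm.const_mul _)
          ((hf.1.const_mul C).sub hgL.1).norm one_le_two
    _ ≤ ε₁ / 2 + ε₁ / 2 := by
        rw [h1, eLpNorm_norm]
        exact add_le_add (by rw [mul_comm] at hδε; rw [mul_comm]; exact hδε.le) hfg
    _ = ε₁ := ENNReal.add_halves ε₁
    _ < ε := hlt

/-- At the frequency `η / k(T)` the parameter of the scalar solution is exactly the one in
`tendsto_volterraSol_rescaled`, while `𝓕 u₀` at that frequency tends to `𝓕 u₀ 0`, the total mass. -/
theorem eventually_norm_symbol_sub_le {A : ℝ → ℝ} {β : ℝ} (hA : RegularlyVarying A β)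
    (hc : ContinuousOn A (Set.Ici 0)) (hβ : -1 < β)
    (hbound : ∀ z, 0 ≤ z → ∀ t, |volterraSol A z t| ≤ 1) {u₀ : E → ℂ} (hu₀ : Integrable u₀)
    (R d : ℝ) {δ : ℝ} (hδ : 0 < δ) :
    ∀ᶠ T in atTop, 0 < √(T * A T * Real.Gamma (1 + β)) ∧ ∀ t ∈ Set.Icc 0 d, ∀ η : E, ‖η‖ ≤ R →
      ‖solutionSymbol A u₀ (T * t) ((√(T * A T * Real.Gamma (1 + β)))⁻¹ • η)
        - (∫ x, u₀ x) * limitSymbol β t η‖ ≤ δ := by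
  have hg : 0 < Real.Gamma (1 + β) := Real.Gamma_pos_of_pos (by linarith)
  set C := ∫ x, ‖u₀ x‖ with hC
  have hC0 : 0 ≤ C := integral_nonneg fun _ => norm_nonneg _
  have h0 : 𝓕 u₀ 0 = ∫ x, u₀ x := by simp [Real.fourier_eq]
  have hKlim : Tendsto (fun T => √(T * A T * Real.Gamma (1 + β))) atTop atTop :=
    Real.tendsto_sqrt_atTop.comp ((hA.tendsto_mul_self hc hβ).atTop_mul_const hg)
  have hε : 0 < δ / 2 / (C + 1) := by positivity
  have h1 := tendsto_volterraSol_rescaled hA hc hβ hbound (d := d)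
    (Z := (2 * Real.pi) ^ 2 * R ^ 2) (by positivity) hε
  obtain ⟨r, hr, hrδ⟩ := Metric.continuousAt_iff.1
    ((continuous_fourier hu₀).continuousAt (x := (0 : E))) (δ / 2) (half_pos hδ)
  filter_upwards [h1, hKlim.eventually_gt_atTop 0, hKlim.eventually_gt_atTop (|R| / r)]
    with T hT hK0 hKr
  refine ⟨hK0, fun t ht η hη => ?_⟩
  set K := √(T * A T * Real.Gamma (1 + β)) with hK
  have hK2 : K ^ 2 = T * A T * Real.Gamma (1 + β) := Real.sq_sqrt (Real.sqrt_pos.1 hK0).le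
  have hR : |R| = R := abs_of_nonneg ((norm_nonneg η).trans hη)
  have hη2 : ‖η‖ ^ 2 ≤ R ^ 2 := by gcongr
  have h2 := hT ((2 * Real.pi) ^ 2 * ‖η‖ ^ 2)
    ⟨by positivity, mul_le_mul_of_nonneg_left hη2 (by positivity)⟩ t ht
  have h3 : (2 * Real.pi) ^ 2 * ‖K⁻¹ • η‖ ^ 2
      = (2 * Real.pi) ^ 2 * ‖η‖ ^ 2 / (T * A T * Real.Gamma (1 + β)) := by
    rw [← hK2, norm_smul, norm_inv, Real.norm_of_nonneg hK0.le]
    field_simp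
  rw [← h3] at h2
  have h4 : ‖𝓕 u₀ (K⁻¹ • η) - 𝓕 u₀ 0‖ ≤ δ / 2 := by
    rw [← dist_eq_norm]
    refine (hrδ ?_).le
    rw [dist_zero_right, norm_smul, norm_inv, Real.norm_of_nonneg hK0.le, inv_mul_lt_iff₀ hK0]
    rw [div_lt_iff₀ hr, hR] at hKr
    linarith
  have h5 := hbound ((2 * Real.pi) ^ 2 * ‖K⁻¹ • η‖ ^ 2) (by positivity) (T * t)
  have h6 : ‖𝓕 u₀ (0 : E)‖ ≤ C := norm_fourier_le u₀ 0
  have h7 : solutionSymbol A u₀ (T * t) (K⁻¹ • η) - (∫ x, u₀ x) * limitSymbol β t η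
      = (𝓕 u₀ (K⁻¹ • η) - 𝓕 u₀ 0)
          * (volterraSol A ((2 * Real.pi) ^ 2 * ‖K⁻¹ • η‖ ^ 2) (T * t) : ℂ)
        + 𝓕 u₀ 0 * ((volterraSol A ((2 * Real.pi) ^ 2 * ‖K⁻¹ • η‖ ^ 2) (T * t)
          - volterraSol (powerKernel β) ((2 * Real.pi) ^ 2 * ‖η‖ ^ 2) t : ℝ) : ℂ) := by
    rw [solutionSymbol, limitSymbol, h0]
    push_cast
    ring
  rw [h7]
  refine (norm_add_le _ _).trans ?_
  rw [norm_mul, norm_mul, Complex.norm_real, Complex.norm_real, Real.norm_eq_abs,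
    Real.norm_eq_abs]
  have h8 := mul_le_mul h4 h5 (abs_nonneg _) (half_pos hδ).le
  have h9 := mul_le_mul h6 h2 (abs_nonneg _) hC0
  have h10 : C * (δ / 2 / (C + 1)) ≤ δ / 2 := by
    rw [mul_div_assoc', div_le_iff₀ (by positivity)]
    nlinarith
  linarith

end SelfSimilarLimit

/-! ### Convergence of the rescaled solutions. -/

section MainConvergence

variable {E : Type*} [NormedAddCommGroup E] [InnerProductSpace ℝ E]
  [FiniteDimensional ℝ E] [MeasurableSpace E] [BorelSpace E]

theorem exists_limit {A : ℝ → ℝ} {β : ℝ} (hA : RegularlyVarying A β)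
    (hc : ContinuousOn A (Set.Ici 0)) (hβ : -1 < β)
    (hbound : ∀ z, 0 ≤ z → ∀ t, |volterraSol A z t| ≤ 1) :
    ∃ U : ℝ → 𝓢'(E, ℂ), ∀ t, 0 ≤ t → ∀ ψ : 𝓢(E, ℂ), 𝓕 (U t) ψ = ∫ η, limitSymbol β t η * ψ η := by
  have hm : ∀ t, 0 ≤ t → MemLp (limitSymbol β t) ⊤ (volume : Measure E) := fun t ht =>
    memLp_top_of_bound (continuous_limitSymbol hβ t).aestronglyMeasurable 1
      (Eventually.of_forall (norm_limitSymbol_le hA hc hβ hbound ht))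
  refine ⟨fun t => if ht : 0 ≤ t then 𝓕⁻ (boundedDistribution _ (hm t ht)) else 0,
    fun t ht ψ => ?_⟩
  beta_reduce
  rw [dif_pos ht, FourierTransform.fourier_fourierInv_eq, boundedDistribution_apply]

/-- The transform `G` of the difference is bounded by twice the `L¹` norm of `u₀` and is uniformly
small on a prescribed ball, so `exists_eLpNorm_weight_mul_lt` applies. The threshold for `T` does
not depend on `t`. -/
theorem IsSolution.tendsto_selfSimilar {a₀ : ℝ} {a : ℝ → ℝ} {u₀ : E → ℂ} {σ β : ℝ}
    {u U : ℝ → 𝓢'(E, ℂ)} (hu : IsSolution a₀ a u₀ σ u) (ha : ∀ X, IntegrableOn a (Set.Ioc 0 X))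
    (hu₀ : Integrable u₀) (hβ : -1 < β) (hA : RegularlyVarying (integratedKernel a₀ a) β)
    (hbound : ∀ z, 0 ≤ z → ∀ t, |volterraSol (integratedKernel a₀ a) z t| ≤ 1)
    (hU : ∀ t, 0 ≤ t → ∀ ψ : 𝓢(E, ℂ), 𝓕 (U t) ψ = ∫ η, limitSymbol β t η * ψ η)
    {s : ℝ} (hs : s < -(Module.finrank ℝ E : ℝ) / 2) (d : ℝ) {ε : ℝ≥0∞} (hε : 0 < ε) :
    ∀ᶠ T : ℝ in atTop, ∀ t ∈ Set.Icc 0 d,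
      TemperedDistribution.MemSobolev s 2 (rescaled (scaling a₀ a β) u T t) ∧
      sobolevENorm s (rescaled (scaling a₀ a β) u T t - (∫ x, u₀ x) • U t) < ε := by
  have hc := continuousOn_integratedKernel a₀ ha
  have hAint : ∀ X, IntegrableOn (integratedKernel a₀ a) (Set.Ioc 0 X) :=
    integrableOn_integratedKernel a₀ ha
  set C := ∫ x, ‖u₀ x‖ with hC
  have hw := memLp_sobolevWeight (E := E) hs
  obtain ⟨R, δ, hδ, hR⟩ := exists_eLpNorm_weight_mul_lt hw (2 * C) hε
  filter_upwards [eventually_norm_symbol_sub_le hA hc hβ hbound hu₀ R d hδ,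
    eventually_ge_atTop (0 : ℝ)] with T hT hT0 t ht
  obtain ⟨hK, hT⟩ := hT
  set K := √(T * integratedKernel a₀ a T * Real.Gamma (1 + β)) with hKdef
  set F : E → ℂ := fun η => solutionSymbol (integratedKernel a₀ a) u₀ (T * t) (K⁻¹ • η) with hF
  have hFc : Continuous F := (continuous_solutionSymbol hAint hu₀).comp
    (f := fun η : E => (T * t, K⁻¹ • η)) (by fun_prop)
  have hFle : ∀ η, ‖F η‖ ≤ C := fun η => norm_solutionSymbol_le hbound _ _
  have hFv : ∀ ψ : 𝓢(E, ℂ), 𝓕 (rescaled (scaling a₀ a β) u T t) ψ = ∫ η, F η * ψ η :=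
    fourier_dilate hK fun ψ => hu.fourier_apply ha hu₀ hbound ψ (mul_nonneg hT0 ht.1)
  set G : E → ℂ := fun η => F η - (∫ x, u₀ x) * limitSymbol β t η with hG
  have hLc : Continuous (limitSymbol β t : E → ℂ) := continuous_limitSymbol hβ t
  have hGc : Continuous G := hFc.sub (continuous_const.mul hLc)
  have hLle : ∀ η : E, ‖(∫ x, u₀ x) * limitSymbol β t η‖ ≤ C := fun η => by
    rw [norm_mul]
    calc ‖∫ x, u₀ x‖ * ‖limitSymbol β t η‖ ≤ C * 1 :=
          mul_le_mul (norm_integral_le_integral_norm _)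
            (norm_limitSymbol_le hA hc hβ hbound ht.1 η) (norm_nonneg _)
            (integral_nonneg fun _ => norm_nonneg _)
      _ = C := mul_one C
  have hGle : ∀ η, ‖G η‖ ≤ 2 * C := fun η => by
    rw [two_mul]
    exact (norm_sub_le _ _).trans (add_le_add (hFle η) (hLle η))
  have hGv : ∀ ψ : 𝓢(E, ℂ),
      𝓕 (rescaled (scaling a₀ a β) u T t - (∫ x, u₀ x) • U t) ψ = ∫ η, G η * ψ η := by
    intro ψ
    have h1 := hFv ψ
    have h2 := hU t ht.1 ψ
    rw [TemperedDistribution.fourier_apply] at h1 h2 ⊢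
    rw [sub_apply, smul_apply, h1, h2, smul_eq_mul, ← integral_const_mul,
      ← integral_sub]
    · refine integral_congr_ae (Eventually.of_forall fun η => ?_)
      simp only [hG]
      ring
    · exact integrable_mul_schwartz (memLp_top_of_bound hFc.aestronglyMeasurable C
        (Eventually.of_forall hFle)) ψ
    · have := integrable_mul_schwartz (memLp_top_of_bound
        (continuous_const.mul hLc).aestronglyMeasurable C (Eventually.of_forall hLle)) ψ
      simpa only [mul_assoc, Pi.mul_apply] using this
  refine ⟨memSobolev_of_fourier_eq hFv (memLp_weight_mul hw hFc hFle), ?_⟩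
  exact (sobolevENorm_le_of_fourier_eq hGv (memLp_weight_mul hw hGc hGle)).trans_lt
    (hR G hGc hGle (hT t ht))

end MainConvergence

end SelfSimilar

end

theorem theorem4p2 (n : ℕ) (a₀ : ℝ) (a : ℝ → ℝ) (β : ℝ)
    (u₀ : EuclideanSpace ℝ (Fin n) → ℂ) (σ : ℝ) (u : ℝ → 𝓢'(EuclideanSpace ℝ (Fin n), ℂ))
    -- standing assumptions on the coefficients and the initial value
    (ha₀ : 0 ≤ a₀)
    (ha_int : IntegrableOn a (Set.Ioo 0 1))
    (ha_bdd : ∀ ε : ℝ, 0 < ε → MemLp a ⊤ (volume.restrict (Set.Ici ε)))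
    (hu₀ : Integrable u₀)
    -- `lim_{h ↓ 0} (a₀ + Re ã(iy + h)) ≥ 0` for all real `y`
    (hpos : ∀ y : ℝ, 0 ≤ liminf
      (fun h : ℝ => ((a₀ + (SelfSimilar.laplaceTransform a
        (Complex.I * (y : ℂ) + (h : ℂ))).re : ℝ) : EReal)) (𝓝[>] (0 : ℝ)))
    -- regular variation of `A`
    (hβ : β ∈ Set.Ioc (-1 : ℝ) 1)
    (hA : SelfSimilar.RegularlyVarying (SelfSimilar.integratedKernel a₀ a) β)
    -- `u` is the solution of the initial value problem
    (hu : SelfSimilar.IsSolution a₀ a u₀ σ u) :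
    ∃ u_inf : ℝ → 𝓢'(EuclideanSpace ℝ (Fin n), ℂ),
      (∀ t : ℝ, 0 < t → SelfSimilar.HasFourierTransform (u_inf t)
        (fun ξ => SelfSimilar.mittagLeffler (1 + β)
          ((-(‖ξ‖ ^ 2 * t ^ (1 + β)) : ℝ) : ℂ))) ∧
      ∀ s : ℝ, s < -(n : ℝ) / 2 →
        (∀ t : ℝ, 0 < t → TemperedDistribution.MemSobolev s 2 (u_inf t)) ∧
        ∀ c d : ℝ, 0 < c → c ≤ d → ∀ ε : ℝ≥0∞, 0 < ε →
          ∀ᶠ T : ℝ in atTop, ∀ t ∈ Set.Icc c d,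
            TemperedDistribution.MemSobolev s 2
              (SelfSimilar.rescaled (SelfSimilar.scaling a₀ a β) u T t) ∧
            SelfSimilar.sobolevENorm s
              (SelfSimilar.rescaled (SelfSimilar.scaling a₀ a β) u T t
                - (∫ x, u₀ x) • u_inf t) < ε := by
  open SelfSimilar in
  have ha := integrableOn_Ioc_of_kernel ha_int ha_bdd
  have ha' := integrableOn_div_one_add_sq_of_kernel ha_int ha_bdd
  -- The sign condition on the symbol enters the argument only here.
  have henergy : ∀ w : ℝ → ℝ, Continuous w → ∀ X,
      0 ≤ ∫ t in Set.Ioc 0 X, w t * (a₀ * w t + volterraConv a w t) := fun w hw X =>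
    energy_nonneg ha' ha (abel_of_liminf ha' hpos) hw X
  have hbound : ∀ z, 0 ≤ z → ∀ t, |volterraSol (integratedKernel a₀ a) z t| ≤ 1 := fun z hz t =>
    abs_volterraSol_le_one ha henergy hz t
  have hc := continuousOn_integratedKernel a₀ ha
  obtain ⟨U, hU⟩ := exists_limit (E := EuclideanSpace ℝ (Fin n)) hA hc hβ.1 hbound
  refine ⟨U, fun t ht φ => ?_, fun s hs => ?_⟩
  · have hm : MemLp (limitSymbol β t) ⊤ (volume : Measure (EuclideanSpace ℝ (Fin n))) :=
      memLp_top_of_bound (continuous_limitSymbol hβ.1 t).aestronglyMeasurable 1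
        (Eventually.of_forall (norm_limitSymbol_le hA hc hβ.1 hbound ht.le))
    simp only [mittagLeffler_eq_limitSymbol hβ.1 ht.le]
    exact ⟨integrable_mul_schwartz hm φ, hU t ht.le φ⟩
  · have hs' : s < -(Module.finrank ℝ (EuclideanSpace ℝ (Fin n)) : ℝ) / 2 := by
      rwa [finrank_euclideanSpace_fin]
    refine ⟨fun t ht => memSobolev_of_fourier_eq (hU t ht.le) (memLp_weight_mul
      (memLp_sobolevWeight hs') (continuous_limitSymbol hβ.1 t)
      (norm_limitSymbol_le hA hc hβ.1 hbound ht.le)), fun c d hc0 _ ε hε => ?_⟩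
    -- The convergence is in fact uniform on all of `[0, d]`.
    filter_upwards [hu.tendsto_selfSimilar ha hu₀ hβ.1 hA hbound hU hs' d hε] with T hT t ht
    exact hT t ⟨hc0.le.trans ht.1, ht.2⟩
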